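/- Let $\rho>0$, $a_0>0$ be real and $\ell\in\mathbb Z$ with $|\ell|\ge 2$. For real $\varepsilon$ let $V_\varepsilon=-(a_0^2-\varepsilon)\mathbf 1_{\{|x|\le\rho\}}$ on $\mathbb R^2$. Suppose that for some $\varepsilon_1>0$ there are, for every $\varepsilon\in(-\varepsilon_1,0)$, a real number $E_\varepsilon$ and a nontrivial $\psi_\varepsilon\in L^2(\mathbb R^2)$ with $\partial_\theta\psi_\varepsilon=i\ell\psi_\varepsilon$ and $(-\Delta+V_\varepsilon-E_\varepsilon)\psi_\varepsilon=0$ in the sense of distributions, and that $E_\varepsilon\uparrow 0$ as $\varepsilon\uparrow 0$. (The monotonicity of $E_\varepsilon$ is not needed: it suffices that $E_\varepsilon$ tends to $0$ through negative values.) A number $\lambda\in\mathbb C\setminus -i(0,\infty)$ is called a resonance of $-\Delta+V_\varepsilon$ if there is a nontrivial $u\in L^2_{\mathrm{loc}}(\mathbb R^2)$ that solves $(-\Delta+V_\varepsilon-\lambda^2)u=0$ and is outgoing, that is, $u(r,\theta)=\sum_{m\in\mathbb Z}c_mH^{(1)}_m(\lambda r)e^{im\theta}$ for $r>\rho$ with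 some $c_m\in\mathbb C$; here $H^{(1)}_m$ is the Hankel function, continued from the positive axis to the plane cut along $-i[0,\infty)$. (At $\lambda=0$ the functions $H^{(1)}_m(\lambda r)$ are replaced by $r^{-|m|}$.) Then there is an $\varepsilon_0>0$ such that for all real $\varepsilon$ with $0<|\varepsilon|<\varepsilon_0$ the operator $-\Delta+V_\varepsilon$ has a resonance $\lambda_\varepsilon$ satisfying, as $\varepsilon\to0$, $$\lambda_\varepsilon=\sqrt{\varepsilon\,\frac{|\ell|-1}{|\ell|}}+O\!\left(|\varepsilon|^{3/2}\bigl(1+\delta_{|\ell|,2}\log|\varepsilon|\bigr)\right),$$ where the square root has nonnegative real and imaginary parts. Moreover, as $\varepsilon\uparrow0$, $$E_\varepsilon=\frac{|\ell|-1}{|\ell|}\,\varepsilon+O\!\left(\varepsilon^2\bigl(1+\delta_{|\ell|,2}\log|\varepsilon|\bigr)\right).$$ -/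

import Mathlib

open Filter Topology MeasureTheory Asymptotics

open scoped ContDiff

noncomputable section

/-- The Bessel function `J_ν(z) = (z/2)^ν ∑ (-z²/4)^k / (k! Γ(ν+k+1))` of complex order `ν`.
The power `(z/2)^ν` is taken with the branch cut along the negative imaginary axis: as
`z/2 = e^{iπ/2} · (z/(2i))`, it is `e^{iπν/2} (z/(2i))^ν` with the principal power, that is,
`arg z` is chosen in `(-π/2, 3π/2]`.  At the poles of `Γ` the summand is `0`, in agreement with
`1/Γ = 0` there. -/
def besselJ (ν z : ℂ) : ℂ :=
  Complex.exp (Real.pi * Complex.I * ν / 2) * (z / (2 * Complex.I)) ^ ν *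
    ∑' k : ℕ, (-z ^ 2 / 4) ^ k / ((k.factorial : ℂ) * Complex.Gamma (ν + k + 1))

/-- The Bessel function of the second kind of integer order,
`Y_ℓ(z) = (1/π) ∂_ν J_ν(z)|_{ν = ℓ} + ((-1)^ℓ/π) ∂_ν J_ν(z)|_{ν = -ℓ}`. -/
def besselY (ℓ : ℤ) (z : ℂ) : ℂ :=
  (1 / Real.pi) * deriv (fun ν : ℂ => besselJ ν z) (ℓ : ℂ) +
    ((-1) ^ ℓ / Real.pi) * deriv (fun ν : ℂ => besselJ ν z) (-(ℓ : ℂ))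

/-- The Hankel function `H_ℓ^{(1)} = J_ℓ + i Y_ℓ` on the plane cut along the negative imaginary
axis. -/
def hankelOne (ℓ : ℤ) (z : ℂ) : ℂ :=
  besselJ ℓ z + Complex.I * besselY ℓ z

/-- `φ` is a test function on the plane: smooth with compact support.  Here and below `ℝ²` is
identified with `ℂ`, with its Euclidean norm and Lebesgue measure. -/
def IsTestFunction (φ : ℂ → ℂ) : Prop :=
  ContDiff ℝ ∞ φ ∧ HasCompactSupport φ

/-- `u` is an `L²_loc(ℝ²)` solution of `(-Δ + V - E) u = 0` in the sense of distributions. -/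
def IsSolution (V : ℂ → ℝ) (E : ℂ) (u : ℂ → ℂ) : Prop :=
  (∀ K : Set ℂ, IsCompact K → MemLp u 2 (volume.restrict K)) ∧
    ∀ φ : ℂ → ℂ, IsTestFunction φ →
      ∫ z : ℂ, u z * (-(Laplacian.laplacian φ z) + ((V z : ℂ) - E) * φ z) = 0

/-- `∂_θ ψ = i ℓ ψ` in the sense of distributions, where `(∂_θ φ)(z)` is the derivative of `φ` at
`z` in the direction `i z`. -/
def HasAngularMode (ℓ : ℤ) (ψ : ℂ → ℂ) : Prop :=
  ∀ φ : ℂ → ℂ, IsTestFunction φ →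
    ∫ z : ℂ, ψ z * fderiv ℝ φ z (Complex.I * z) = -∫ z : ℂ, (Complex.I * ℓ * ψ z) * φ z

/-- The radial factor of the `ℓ`th outgoing mode: `H_ℓ^{(1)}(lam r)` for `lam ≠ 0` and `r^{-|ℓ|}`
for `lam = 0`. -/
def outgoingFactor (lam : ℂ) (ℓ : ℤ) (r : ℝ) : ℂ :=
  if lam = 0 then (r : ℂ) ^ (-|ℓ|) else hankelOne ℓ (lam * r)

/-- `u` is outgoing: `u(r, θ) = ∑_ℓ c_ℓ H_ℓ^{(1)}(lam r) e^{iℓθ}` for `r > ρ` (and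
`u(r, θ) = ∑_ℓ c_ℓ r^{-|ℓ|} e^{iℓθ}` if `lam = 0`). -/
def IsOutgoing (ρ : ℝ) (lam : ℂ) (u : ℂ → ℂ) : Prop :=
  ∃ c : ℤ → ℂ, ∀ᵐ z : ℂ, ρ < ‖z‖ →
    HasSum (fun ℓ : ℤ => c ℓ * outgoingFactor lam ℓ ‖z‖ * (z / (‖z‖ : ℂ)) ^ ℓ) (u z)

/-- For a potential `V` that vanishes outside the disk of radius `ρ`, the number
`lam ∈ ℂ ∖ -i(0,∞)` is a resonance of `-Δ + V`: there is a nontrivial outgoing solution of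
`(-Δ + V - lam²) u = 0`. -/
def IsResonance (V : ℂ → ℝ) (ρ : ℝ) (lam : ℂ) : Prop :=
  ¬ (lam.re = 0 ∧ lam.im < 0) ∧
    ∃ u : ℂ → ℂ, ¬ u =ᵐ[volume] 0 ∧ IsSolution V (lam ^ 2) u ∧ IsOutgoing ρ lam u

/-- The circular well of radius `ρ` and depth `A = a²`: `-A` on `|z| ≤ ρ` and `0` elsewhere. -/
def circularWell (ρ A : ℝ) (z : ℂ) : ℝ :=
  if ‖z‖ ≤ ρ then -A else 0

end

/-! Separation of variables turns the resonance condition and the eigenvalue condition into one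
scalar equation. Write |ℓ| = n + 2, s = r², e = ερ²/4, t = -λ²ρ²/4 and τ = -a₀²ρ²/4. In the variable
s the inner solution is the entire series `bA` (the Bessel function J without its power). The outer
solution is `bM`, an entire series plus t^k log t times another one (the Hankel function up to a
power). At the edge of the well their arguments are τ + e + t and t. The derivative and recurrence
relations of these families reduce a C¹ match there to `matchF` = 0.

At e = t = 0 the equation says bA (n+1) τ = 0, that is J_{|ℓ|-1}(a₀ρ) = 0. Passing to the limit
along the given eigenvalues proves that the well is critical in this sense; the construction of
resonances uses nothing else about them. At a critical τ the derivative of `matchF` in t is nonzero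
(`slope_ne_zero`), because consecutive `bA` have no common real zero by a Wronskian identity. The
linearized equation has the root t = -((n+1)/(n+2)) e, i.e. λ² = ε(|ℓ|-1)/|ℓ|.

The logarithm prevents `matchF` from being holomorphic at t = 0, so the implicit function theorem is
replaced by a quantitative argument on half planes. There the t-derivative still tends to its value
at the origin (`exists_matchF_approx`). Hence there is a zero near the linear root
(`exists_zero_matchF`), and every small zero is near it (`exists_norm_sub_approxZero_le`), with the
residual at the linear root as error (`matchF_approxZero_isBigO`). The logarithm enters the equation
through t^(n+2) log t; it exceeds t² only when n = 0, which explains the factor for |ℓ| = 2. The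
half plane Re t > 0 serves ε < 0 and Re t < 0 serves ε > 0.

Conversely, zeros give resonances by gluing (`isResonance_of_matching`): the glued function is C¹
across the circle, so Green's identity has no boundary term. For eigenvalues one needs that a square
integrable distributional mode satisfies the matching equation (`exists_matching_of_mode`). The mode
is reduced to a weak equation on the half line, shown to be regular, and expanded in the model
solutions on both sides of the edge. Square integrability at 0 and at infinity selects one solution
on each side. At infinity no asymptotics are needed: the decaying solution is unique up to a factor,
which fixes the branch constant c of the logarithm, and the estimates hold for every c. -/

namespace CircularWell

noncomputable section

/-! ### Exponential generating functions -/

/-- The exponential generating function of the sequence `c`. -/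
def egf (c : ℕ → ℂ) (t : ℂ) : ℂ := ∑' k : ℕ, t ^ k / (k.factorial : ℂ) * c k

theorem summable_egf {c : ℕ → ℂ} {C : ℝ} (hc : ∀ k, ‖c k‖ ≤ C) (t : ℂ) :
    Summable fun k : ℕ => t ^ k / (k.factorial : ℂ) * c k := by
  refine Summable.of_norm_bounded ((Real.summable_pow_div_factorial ‖t‖).mul_right C) fun k => ?_
  rw [norm_mul, norm_div, norm_pow, Complex.norm_natCast]
  exact mul_le_mul_of_nonneg_left (hc k) (by positivity)

theorem hasSum_mul_egf {c : ℕ → ℂ} {C : ℝ} (hc : ∀ k, ‖c k‖ ≤ C) (t : ℂ) :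
    HasSum (fun k : ℕ => t ^ k / (k.factorial : ℂ) * (k * c k))
      (t * egf (fun k => c (k + 1)) t) := by
  have h := (summable_egf (fun k => hc (k + 1)) t).hasSum.mul_left t
  rw [← hasSum_nat_add_iff' 1]
  simp only [Finset.range_one, Finset.sum_singleton, Nat.cast_zero, zero_mul, mul_zero, sub_zero]
  refine h.congr_fun fun k => ?_
  have h1 : ((k + 1).factorial : ℂ) = (k + 1) * k.factorial := by
    rw [Nat.factorial_succ]; push_cast; ring
  have h2 : ((k : ℂ) + 1) ≠ 0 := by exact_mod_cast k.succ_ne_zero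
  have h3 : (k.factorial : ℂ) ≠ 0 := by exact_mod_cast k.factorial_ne_zero
  rw [h1]; push_cast; field_simp; ring

theorem hasDerivAt_egf {c : ℕ → ℂ} {C : ℝ} (hc : ∀ k, ‖c k‖ ≤ C) (t : ℂ) :
    HasDerivAt (egf c) (egf (fun k => c (k + 1)) t) t := by
  set R := ‖t‖ + 1
  have hC : 0 ≤ C := (norm_nonneg _).trans (hc 0)
  set u : ℕ → ℝ := fun k => (k : ℝ) * R ^ (k - 1) / k.factorial * C with hu
  have hus : Summable u := by
    rw [← summable_nat_add_iff 1]
    refine ((Real.summable_pow_div_factorial R).mul_right C).congr fun k => ?_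
    simp only [hu, Nat.factorial_succ, Nat.add_sub_cancel]
    have h2 : ((k : ℝ) + 1) ≠ 0 := by positivity
    have h3 : (k.factorial : ℝ) ≠ 0 := by exact_mod_cast k.factorial_ne_zero
    push_cast; field_simp
  have key := hasDerivAt_tsum_of_isPreconnected (𝕜 := ℂ) (u := u) (t := Metric.ball 0 R)
    (g := fun k s => s ^ k / (k.factorial : ℂ) * c k)
    (g' := fun k s => (k * s ^ (k - 1)) / (k.factorial : ℂ) * c k) (y₀ := 0) (y := t)
    hus Metric.isOpen_ball (convex_ball (0 : ℂ) R).isPreconnected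
    (fun k s _ => ((hasDerivAt_pow k s).div_const _).mul_const _)
    (fun k s hs => by
      rw [norm_mul, norm_div, norm_mul, norm_pow, Complex.norm_natCast, Complex.norm_natCast]
      have : ‖s‖ ≤ R := by simpa using (Metric.mem_ball.1 hs).le
      simp only [hu]
      gcongr
      exact hc k)
    (by simp [R]; positivity) (summable_egf hc 0) (by simp [R])
  have : egf (fun k => c (k + 1)) t = ∑' k : ℕ, (k * t ^ (k - 1)) / (k.factorial : ℂ) * c k := by
    symm
    rw [Summable.tsum_eq_zero_add]
    · simp only [egf, Nat.cast_zero, zero_mul, zero_div, zero_add]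
      refine tsum_congr fun k => ?_
      have h1 : ((k + 1).factorial : ℂ) = (k + 1) * k.factorial := by
        rw [Nat.factorial_succ]; push_cast; ring
      have h2 : ((k : ℂ) + 1) ≠ 0 := by exact_mod_cast k.succ_ne_zero
      have h3 : (k.factorial : ℂ) ≠ 0 := by exact_mod_cast k.factorial_ne_zero
      rw [h1, Nat.add_sub_cancel]; push_cast; field_simp
    · refine Summable.of_norm_bounded hus fun k => ?_
      rw [norm_mul, norm_div, norm_mul, norm_pow, Complex.norm_natCast, Complex.norm_natCast]
      have : ‖t‖ ≤ R := by simp [R]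
      simp only [hu]
      gcongr
      exact hc k
  rw [this]
  exact key

theorem egf_zero (c : ℕ → ℂ) : egf c 0 = c 0 := by
  rw [egf, tsum_eq_single 0]
  · simp
  · intro k hk; simp [hk]

/-! ### The reciprocal Gamma function -/

/-- The entire function `1/Γ`. -/
def rGamma (z : ℂ) : ℂ := (Complex.Gamma z)⁻¹

theorem differentiable_rGamma : Differentiable ℂ rGamma := Complex.differentiable_one_div_Gamma

theorem rGamma_eq (z : ℂ) : rGamma z = z * rGamma (z + 1) :=
  Complex.one_div_Gamma_eq_self_mul_one_div_Gamma_add_one z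

theorem deriv_rGamma_eq (z : ℂ) :
    deriv rGamma z = rGamma (z + 1) + z * deriv rGamma (z + 1) := by
  have h1 : HasDerivAt (fun w => rGamma (w + 1)) (deriv rGamma (z + 1)) z :=
    (differentiable_rGamma (z + 1)).hasDerivAt.comp_add_const z 1
  have h2 : HasDerivAt (fun w => w * rGamma (w + 1)) _ z := (hasDerivAt_id z).mul h1
  have h3 : rGamma = fun w => w * rGamma (w + 1) := funext rGamma_eq
  conv_lhs => rw [h3]
  simpa using h2.deriv

theorem rGamma_neg_nat (n : ℕ) : rGamma (-n) = 0 := by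
  simp [rGamma, Complex.Gamma_neg_nat_eq_zero]

theorem rGamma_nat_add_one (n : ℕ) : rGamma (n + 1) = (n.factorial : ℂ)⁻¹ := by
  simp [rGamma, Complex.Gamma_nat_eq_factorial]

theorem deriv_rGamma_neg_succ (n : ℕ) :
    deriv rGamma (-((n + 1 : ℕ) : ℂ)) = -(n + 1) * deriv rGamma (-n) := by
  rw [deriv_rGamma_eq]
  have : -((n + 1 : ℕ) : ℂ) + 1 = -n := by push_cast; ring
  rw [this, rGamma_neg_nat]; push_cast; ring

/-- The zeros of 1/Γ are simple. These derivatives are the values at t = 0 of the second solutions,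
so every later nonvanishing statement rests on them. -/
theorem deriv_rGamma_neg_nat_ne_zero (n : ℕ) : deriv rGamma (-n) ≠ 0 := by
  induction n with
  | zero =>
    rw [deriv_rGamma_eq]
    simp [rGamma]
  | succ n ih =>
    rw [deriv_rGamma_neg_succ]
    exact mul_ne_zero (neg_ne_zero.2 (by exact_mod_cast n.succ_ne_zero)) ih

/-- For small k the argument stays in a compact ball. Once |ν + k| ≥ 1, the functional equation
makes |1/Γ(ν + k)| nonincreasing in k. -/
theorem exists_bound_rGamma (R : ℝ) :
    ∃ C : ℝ, ∀ ν : ℂ, ‖ν‖ ≤ R → ∀ k : ℕ, ‖rGamma (ν + k)‖ ≤ C := by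
  obtain ⟨N, hN⟩ := exists_nat_gt (R + 1)
  obtain ⟨C, hC⟩ := (isCompact_closedBall (0 : ℂ) (R + N)).exists_bound_of_continuousOn
    differentiable_rGamma.continuous.continuousOn
  refine ⟨C, fun ν hν k => ?_⟩
  induction k with
  | zero =>
    apply hC
    have : (0 : ℝ) ≤ N := N.cast_nonneg
    simp; linarith
  | succ k ih =>
    rcases lt_or_ge k N with hk | hk
    · apply hC
      rw [mem_closedBall_zero_iff]
      refine (norm_add_le _ _).trans ?_
      rw [Complex.norm_natCast]
      have : ((k + 1 : ℕ) : ℝ) ≤ N := by exact_mod_cast hk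
      linarith
    · have h1 : 1 ≤ ‖ν + k‖ := by
        have h2 := norm_sub_le_norm_add (k : ℂ) ν
        rw [Complex.norm_natCast, add_comm] at h2
        have : (N : ℝ) ≤ k := by exact_mod_cast hk
        linarith
      have h3 := congrArg norm (rGamma_eq (ν + k))
      rw [norm_mul] at h3
      have h4 : ν + ((k + 1 : ℕ) : ℂ) = ν + k + 1 := by push_cast; ring
      rw [h4]
      refine le_trans ?_ ih
      rw [h3]
      exact le_mul_of_one_le_left (norm_nonneg _) h1

/-- Cauchy's estimate on unit circles. -/
theorem exists_bound_deriv_rGamma (R : ℝ) :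
    ∃ C : ℝ, ∀ ν : ℂ, ‖ν‖ ≤ R → ∀ k : ℕ, ‖deriv rGamma (ν + k)‖ ≤ C := by
  obtain ⟨C, hC⟩ := exists_bound_rGamma (R + 1)
  refine ⟨C, fun ν hν k => ?_⟩
  have := Complex.norm_deriv_le_of_forall_mem_sphere_norm_le (c := ν + k) (f := rGamma) (C := C)
    one_pos differentiable_rGamma.diffContOnCl fun z hz => by
      have h1 : z = (z - k) + k := by ring
      rw [h1]
      apply hC
      have h2 : ‖z - (ν + k)‖ = 1 := by simpa [dist_eq_norm] using hz
      calc ‖z - k‖ = ‖(z - (ν + k)) + ν‖ := by congr 1; ring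
        _ ≤ 1 + R := (norm_add_le _ _).trans (by rw [h2]; linarith)
        _ = R + 1 := by ring
  simpa using this

theorem exists_bound_rGamma_add (ν a : ℂ) : ∃ C : ℝ, ∀ k : ℕ, ‖rGamma (ν + k + a)‖ ≤ C := by
  obtain ⟨C, hC⟩ := exists_bound_rGamma ‖ν + a‖
  exact ⟨C, fun k => by simpa [add_right_comm] using hC (ν + a) le_rfl k⟩

theorem exists_bound_deriv_rGamma_add (ν a : ℂ) :
    ∃ C : ℝ, ∀ k : ℕ, ‖deriv rGamma (ν + k + a)‖ ≤ C := by
  obtain ⟨C, hC⟩ := exists_bound_deriv_rGamma ‖ν + a‖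
  exact ⟨C, fun k => by simpa [add_right_comm] using hC (ν + a) le_rfl k⟩

/-! ### The entire factor of the Bessel functions -/

/-- `bA ν t = ∑ t^k / (k! Γ(ν+k+1))`, so that `J_ν(z) = (z/2)^ν bA ν (-z²/4)`. -/
def bA (ν t : ℂ) : ℂ := egf (fun k => rGamma (ν + k + 1)) t

/-- The derivative of `bA ν t` with respect to `ν`. -/
def bB (ν t : ℂ) : ℂ := egf (fun k => deriv rGamma (ν + k + 1)) t

theorem hasDerivAt_bA (ν t : ℂ) : HasDerivAt (bA ν) (bA (ν + 1) t) t := by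
  obtain ⟨C, hC⟩ := exists_bound_rGamma_add ν 1
  have h := hasDerivAt_egf hC t
  have e : (fun k : ℕ => rGamma (ν + ((k + 1 : ℕ) : ℂ) + 1)) =
      fun k : ℕ => rGamma (ν + 1 + (k : ℂ) + 1) := by
    funext k; congr 1; push_cast; ring
  rw [e] at h
  exact h

theorem hasDerivAt_bB (ν t : ℂ) : HasDerivAt (bB ν) (bB (ν + 1) t) t := by
  obtain ⟨C, hC⟩ := exists_bound_deriv_rGamma_add ν 1
  have h := hasDerivAt_egf hC t
  have e : (fun k : ℕ => deriv rGamma (ν + ((k + 1 : ℕ) : ℂ) + 1)) =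
      fun k : ℕ => deriv rGamma (ν + 1 + (k : ℂ) + 1) := by
    funext k; congr 1; push_cast; ring
  rw [e] at h
  exact h

theorem continuous_bA (ν : ℂ) : Continuous (bA ν) :=
  continuous_iff_continuousAt.2 fun t => (hasDerivAt_bA ν t).continuousAt

theorem continuous_bB (ν : ℂ) : Continuous (bB ν) :=
  continuous_iff_continuousAt.2 fun t => (hasDerivAt_bB ν t).continuousAt

theorem bA_zero_right (ν : ℂ) : bA ν 0 = rGamma (ν + 1) := by simp [bA, egf_zero]

theorem bB_zero_right (ν : ℂ) : bB ν 0 = deriv rGamma (ν + 1) := by simp [bB, egf_zero]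

/-- The functional equation of 1/Γ produces the factor ν + 1 + k in each term; its part k shifts the
series and yields the term with t. This is the three-term recurrence of the Bessel functions. -/
theorem bA_eq (ν t : ℂ) : bA ν t = (ν + 1) * bA (ν + 1) t + t * bA (ν + 2) t := by
  obtain ⟨C, hC⟩ := exists_bound_rGamma_add (ν + 1) 1
  have h1 := (summable_egf hC t).hasSum.mul_left (ν + 1)
  have h2 := h1.add (hasSum_mul_egf hC t)
  have h3 : HasSum (fun k : ℕ => t ^ k / (k.factorial : ℂ) * rGamma (ν + k + 1)) _ :=
    h2.congr_fun fun k => by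
      rw [rGamma_eq (ν + k + 1), show ν + k + 1 + 1 = ν + 1 + k + 1 by ring]; ring
  rw [bA, egf, h3.tsum_eq]
  simp only [bA, egf]
  congr 3; funext k; congr 2; push_cast; ring

theorem bB_eq (ν t : ℂ) :
    bB ν t = bA (ν + 1) t + (ν + 1) * bB (ν + 1) t + t * bB (ν + 2) t := by
  obtain ⟨C, hC⟩ := exists_bound_deriv_rGamma_add (ν + 1) 1
  obtain ⟨C', hC'⟩ := exists_bound_rGamma_add (ν + 1) 1
  have h0 := (summable_egf hC' t).hasSum
  have h1 := (summable_egf hC t).hasSum.mul_left (ν + 1)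
  have h2 := (h0.add h1).add (hasSum_mul_egf hC t)
  have h3 : HasSum (fun k : ℕ => t ^ k / (k.factorial : ℂ) * deriv rGamma (ν + k + 1)) _ :=
    h2.congr_fun fun k => by
      rw [deriv_rGamma_eq (ν + k + 1), show ν + k + 1 + 1 = ν + 1 + k + 1 by ring]; ring
  rw [bB, egf, h3.tsum_eq]
  simp only [bA, bB, egf]
  congr 3; funext k; congr 2; push_cast; ring

/-- The first n coefficients vanish at the poles of Γ, and the others are shifted: J_{-n} = (-1)^n
J_n. -/
theorem bA_neg_nat (n : ℕ) (t : ℂ) : bA (-n) t = t ^ n * bA n t := by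
  obtain ⟨C, hC⟩ := exists_bound_rGamma_add (-n) 1
  obtain ⟨C', hC'⟩ := exists_bound_rGamma_add n 1
  have h1 := (summable_egf hC t).hasSum
  rw [← hasSum_nat_add_iff' n] at h1
  have h0 : ∑ i ∈ Finset.range n, t ^ i / (i.factorial : ℂ) * rGamma (-n + i + 1) = 0 := by
    refine Finset.sum_eq_zero fun i hi => ?_
    obtain ⟨j, rfl⟩ := Nat.exists_eq_add_of_lt (Finset.mem_range.1 hi)
    have : -((i + j + 1 : ℕ) : ℂ) + i + 1 = -j := by push_cast; ring
    rw [this, rGamma_neg_nat, mul_zero]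
  rw [h0, sub_zero] at h1
  have h2 := (summable_egf hC' t).hasSum.mul_left (t ^ n)
  refine (h1.congr_fun fun k => ?_).unique h2 |>.symm ▸ rfl
  have e1 : (n : ℂ) + k + 1 = ((n + k : ℕ) : ℂ) + 1 := by push_cast; ring
  have e2 : -(n : ℂ) + ((k + n : ℕ) : ℂ) + 1 = k + 1 := by push_cast; ring
  rw [e1, e2, rGamma_nat_add_one, rGamma_nat_add_one, add_comm n k, pow_add]
  ring

theorem hasDerivAt_bA_order (ν t : ℂ) : HasDerivAt (fun μ => bA μ t) (bB ν t) ν := by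
  obtain ⟨C, hC⟩ := exists_bound_deriv_rGamma (‖ν + 1‖ + 1)
  obtain ⟨C', hC'⟩ := exists_bound_rGamma_add ν 1
  refine hasDerivAt_tsum_of_isPreconnected (𝕜 := ℂ)
    (u := fun k : ℕ => ‖t‖ ^ k / k.factorial * C) (t := Metric.ball ν 1)
    (g := fun k μ => t ^ k / (k.factorial : ℂ) * rGamma (μ + k + 1))
    (g' := fun k μ => t ^ k / (k.factorial : ℂ) * deriv rGamma (μ + k + 1)) (y₀ := ν) (y := ν)
    ((Real.summable_pow_div_factorial ‖t‖).mul_right C)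
    Metric.isOpen_ball (convex_ball ν 1).isPreconnected
    (fun k μ _ => ?_) (fun k μ hμ => ?_) (by simp) (summable_egf hC' t) (by simp)
  · refine HasDerivAt.const_mul _ ?_
    have := (differentiable_rGamma (μ + (k + 1))).hasDerivAt.comp_add_const μ ((k : ℂ) + 1)
    simpa [add_assoc] using this
  · rw [norm_mul, norm_div, norm_pow, Complex.norm_natCast]
    refine mul_le_mul_of_nonneg_left ?_ (by positivity)
    have h1 : ‖μ - ν‖ < 1 := by simpa [dist_eq_norm] using hμ
    have h2 : ‖μ + 1‖ ≤ ‖ν + 1‖ + 1 := by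
      calc ‖μ + 1‖ = ‖(μ - ν) + (ν + 1)‖ := by congr 1; ring
        _ ≤ _ := (norm_add_le _ _).trans (by linarith)
    simpa [add_right_comm] using hC (μ + 1) h2 k

theorem bA_nat_eq (n : ℕ) (t : ℂ) :
    bA n t = (n + 1) * bA (n + 1 : ℕ) t + t * bA (n + 2 : ℕ) t := by
  have := bA_eq n t
  push_cast
  exact this

theorem bB_nat_eq (n : ℕ) (t : ℂ) :
    bB n t = bA (n + 1 : ℕ) t + (n + 1) * bB (n + 1 : ℕ) t + t * bB (n + 2 : ℕ) t := by
  have := bB_eq n t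
  push_cast
  exact this

theorem hasDerivAt_bA_nat (n : ℕ) (t : ℂ) : HasDerivAt (bA n) (bA (n + 1 : ℕ) t) t := by
  have := hasDerivAt_bA n t
  push_cast
  exact this

theorem hasDerivAt_bB_nat (n : ℕ) (t : ℂ) : HasDerivAt (bB n) (bB (n + 1 : ℕ) t) t := by
  have := hasDerivAt_bB n t
  push_cast
  exact this

theorem bA_nat_zero (n : ℕ) : bA n 0 = (n.factorial : ℂ)⁻¹ := by
  rw [bA_zero_right, rGamma_nat_add_one]

theorem hasDerivAt_pow_mul_bA (n : ℕ) (t : ℂ) :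
    HasDerivAt (fun t => t ^ (n + 1) * bA (n + 1 : ℕ) t) (t ^ n * bA n t) t := by
  have h := (hasDerivAt_pow (n + 1) t).mul (hasDerivAt_bA_nat (n + 1) t)
  refine h.congr_deriv ?_
  rw [bA_nat_eq n t, Nat.add_sub_cancel]
  push_cast
  ring_nf

/-- With `L = log t` and `t = -z²/4`, this is `(z/2)^n H_n(z)` up to a constant factor. -/
def bM (n : ℕ) (L t : ℂ) : ℂ := bB (-n) t + t ^ n * (L * bA n t + bB n t)

/-- Differentiating the logarithm gives t^n bA (n+1), and this cancels the inhomogeneous term of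
`bB_nat_eq`. Thus lowering the index is differentiation, as for the regular solution. -/
theorem hasDerivAt_bM (n : ℕ) {L : ℂ → ℂ} {t : ℂ} (hL : HasDerivAt L t⁻¹ t) (ht : t ≠ 0) :
    HasDerivAt (fun t => bM (n + 1) (L t) t) (bM n (L t) t) t := by
  have h1 := hasDerivAt_bB (-((n + 1 : ℕ) : ℂ)) t
  rw [show -((n + 1 : ℕ) : ℂ) + 1 = -n by push_cast; ring] at h1
  have h2 := (hL.mul (hasDerivAt_pow_mul_bA n t)).add
    ((hasDerivAt_pow (n + 1) t).mul (hasDerivAt_bB_nat (n + 1) t))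
  have h3 := h1.add h2
  have h4 : (fun t => bM (n + 1) (L t) t) = bB (-((n + 1 : ℕ) : ℂ)) +
      ((L * fun t => t ^ (n + 1) * bA (n + 1 : ℕ) t) +
        ((fun t => t ^ (n + 1)) * bB (n + 1 : ℕ))) := by
    funext t
    simp only [bM, Pi.add_apply, Pi.mul_apply]
    ring
  rw [h4]
  refine h3.congr_deriv ?_
  rw [bM, bB_nat_eq n t, Nat.add_sub_cancel]
  push_cast
  field_simp
  ring_nf

theorem bM_add_two (n : ℕ) (L t : ℂ) :
    bM (n + 2) L t = t * bM n L t - (n + 1) * bM (n + 1) L t := by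
  have h1 := bB_eq (-((n + 2 : ℕ) : ℂ)) t
  rw [show -((n + 2 : ℕ) : ℂ) + 1 = -((n + 1 : ℕ) : ℂ) by push_cast; ring,
    show -((n + 2 : ℕ) : ℂ) + 2 = -(n : ℂ) by push_cast; ring, bA_neg_nat] at h1
  simp only [bM]
  rw [h1, bA_nat_eq n t, bB_nat_eq n t]
  push_cast
  ring

theorem bM_add (n : ℕ) (L c t : ℂ) : bM n (L + c) t = bM n L t + c * (t ^ n * bA n t) := by
  simp only [bM]; ring

/-! ### Bessel and Hankel functions in terms of the series -/

theorem besselJ_eq (ν z : ℂ) :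
    besselJ ν z = Complex.exp (Real.pi * Complex.I * ν / 2) * (z / (2 * Complex.I)) ^ ν *
      bA ν (-z ^ 2 / 4) := by
  rw [besselJ, bA, egf]
  congr 1
  refine tsum_congr fun k => ?_
  rw [rGamma, div_mul_eq_mul_div, ← div_eq_mul_inv, div_div, mul_comm (Complex.Gamma _)]

theorem hasDerivAt_besselJ_order (ν : ℂ) {z : ℂ} (hz : z ≠ 0) :
    HasDerivAt (fun μ => besselJ μ z)
      (Complex.exp (Real.pi * Complex.I * ν / 2) * (z / (2 * Complex.I)) ^ ν *
        ((Real.pi * Complex.I / 2 + Complex.log (z / (2 * Complex.I))) * bA ν (-z ^ 2 / 4) +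
          bB ν (-z ^ 2 / 4))) ν := by
  have hb : z / (2 * Complex.I) ≠ 0 := div_ne_zero hz (by simp)
  have h1 : HasDerivAt (fun μ : ℂ => Complex.exp (Real.pi * Complex.I * μ / 2))
      (Complex.exp (Real.pi * Complex.I * ν / 2) * (Real.pi * Complex.I / 2)) ν := by
    have := (((hasDerivAt_id ν).const_mul (Real.pi * Complex.I : ℂ)).div_const 2).cexp
    simpa using this
  have h2 : HasDerivAt (fun μ : ℂ => (z / (2 * Complex.I)) ^ μ) _ ν :=
    (hasDerivAt_id ν).const_cpow (Or.inl hb)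
  have h3 := (h1.mul h2).mul (hasDerivAt_bA_order ν (-z ^ 2 / 4))
  have h4 : (fun μ => besselJ μ z) = fun μ => Complex.exp (Real.pi * Complex.I * μ / 2) *
      (z / (2 * Complex.I)) ^ μ * bA μ (-z ^ 2 / 4) := funext fun μ => besselJ_eq μ z
  rw [h4]
  refine h3.congr_deriv ?_
  simp only [id, Pi.mul_apply]
  ring

theorem besselJ_prefactor_nat (m : ℕ) (z : ℂ) :
    Complex.exp (Real.pi * Complex.I * m / 2) * (z / (2 * Complex.I)) ^ (m : ℂ) =
      (z / 2) ^ m := by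
  rw [Complex.cpow_natCast, show (Real.pi * Complex.I * m / 2 : ℂ) = m * (Real.pi / 2 * Complex.I)
    by ring, Complex.exp_nat_mul, Complex.exp_pi_div_two_mul_I, ← mul_pow]
  congr 1
  field_simp

theorem besselJ_prefactor_neg_nat (m : ℕ) (z : ℂ) :
    Complex.exp (Real.pi * Complex.I * (-m) / 2) * (z / (2 * Complex.I)) ^ (-m : ℂ) =
      ((z / 2) ^ m)⁻¹ := by
  rw [← besselJ_prefactor_nat, Complex.cpow_neg, mul_inv, ← Complex.exp_neg]
  congr 2; ring

/-- Differentiating the prefactors in the order gives iπ/2 + log(z/(2i)), once at m and once at -m.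
In J + iY the two terms iπ/2 add up to -J, which cancels J. What remains is 2 log(z/(2i)), a
logarithm of t = (z/(2i))². -/
theorem hankelOne_nat (m : ℕ) {z : ℂ} (hz : z ≠ 0) :
    hankelOne m z = Complex.I / Real.pi * (-1) ^ m * ((z / 2) ^ m)⁻¹ *
      bM m (2 * Complex.log (z / (2 * Complex.I))) (-z ^ 2 / 4) := by
  have hz2 : (z / 2) ^ m ≠ 0 := pow_ne_zero _ (div_ne_zero hz two_ne_zero)
  have hpi : (Real.pi : ℂ) ≠ 0 := by exact_mod_cast Real.pi_ne_zero
  have h0 : (z / 2) ^ m * (z / 2) ^ m = (-1) ^ m * (-z ^ 2 / 4) ^ m := by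
    rw [← mul_pow, ← mul_pow]; congr 1; ring
  have h1 : ((-1 : ℂ) ^ m) * (-1) ^ m = 1 := by rw [← mul_pow]; simp
  simp only [hankelOne, besselY, Int.cast_natCast, zpow_natCast]
  rw [(hasDerivAt_besselJ_order (m : ℂ) hz).deriv, (hasDerivAt_besselJ_order (-m : ℂ) hz).deriv,
    besselJ_eq, besselJ_prefactor_nat, besselJ_prefactor_neg_nat, bA_neg_nat, bM]
  set t := -z ^ 2 / 4
  set q := (z / 2) ^ m
  set ℒ := Complex.log (z / (2 * Complex.I))
  set s : ℂ := (-1) ^ m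
  have hq : q = s * t ^ m * q⁻¹ := by rw [← h0, mul_inv_cancel_right₀ hz2]
  rw [show q * bA m t = s * t ^ m * q⁻¹ * bA m t by rw [← hq],
    show q * ((Real.pi * Complex.I / 2 + ℒ) * bA m t + bB m t) =
      s * t ^ m * q⁻¹ * ((Real.pi * Complex.I / 2 + ℒ) * bA m t + bB m t) by rw [← hq]]
  have hI : Complex.I * Complex.I = -1 := Complex.I_mul_I
  field_simp
  linear_combination (2 * s * t ^ m * Real.pi * bA m t) * hI

theorem bB_neg_nat_zero (n : ℕ) : bB (-((n + 1 : ℕ) : ℂ)) 0 = deriv rGamma (-n) := by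
  rw [bB_zero_right]; congr 1; push_cast; ring

theorem bB_neg_nat_zero_ne_zero (n : ℕ) : bB (-((n + 1 : ℕ) : ℂ)) 0 ≠ 0 := by
  rw [bB_neg_nat_zero]; exact deriv_rGamma_neg_nat_ne_zero n

theorem bB_neg_nat_zero_succ (n : ℕ) :
    bB (-((n + 2 : ℕ) : ℂ)) 0 = -(n + 1) * bB (-((n + 1 : ℕ) : ℂ)) 0 := by
  rw [bB_neg_nat_zero (n + 1), bB_neg_nat_zero, deriv_rGamma_neg_succ]

/-- `bA n t` is real for real `t`, and at least `1 / n!` for `t ≥ 0`. -/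
theorem bA_nat_ofReal (n : ℕ) (t : ℝ) :
    ∃ a : ℝ, bA n t = a ∧ (0 ≤ t → (n.factorial : ℝ)⁻¹ ≤ a) := by
  have hterm : ∀ k : ℕ, (t : ℂ) ^ k / (k.factorial : ℂ) * rGamma (n + k + 1) =
      ((t ^ k / k.factorial * ((n + k).factorial : ℝ)⁻¹ : ℝ) : ℂ) := fun k => by
    rw [show (n : ℂ) + k + 1 = ((n + k : ℕ) : ℂ) + 1 by push_cast; ring, rGamma_nat_add_one]
    push_cast; ring
  obtain ⟨C, hC⟩ := exists_bound_rGamma_add n 1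
  have hs := summable_egf hC (t : ℂ)
  simp only [hterm] at hs
  have hs' : Summable fun k : ℕ => t ^ k / k.factorial * ((n + k).factorial : ℝ)⁻¹ := by
    exact_mod_cast hs
  refine ⟨∑' k : ℕ, t ^ k / k.factorial * ((n + k).factorial : ℝ)⁻¹, ?_, fun ht => ?_⟩
  · rw [bA, egf, Complex.ofReal_tsum]
    exact tsum_congr hterm
  · have := hs'.le_tsum 0 fun k _ => by positivity
    simpa using this

/-! ### The second solution near the origin -/

/-- A branch of the logarithm, shifted by `c`, on the half plane `0 < σ Re t`. -/
def lg (σ : ℝ) (c t : ℂ) : ℂ := Complex.log (σ * t) + c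

/-- The half plane `0 < σ Re t`. -/
def halfPlane (σ : ℝ) : Set ℂ := {t | 0 < σ * t.re}

theorem ne_zero_of_mem_halfPlane {σ : ℝ} {t : ℂ} (ht : t ∈ halfPlane σ) : t ≠ 0 := by
  rintro rfl
  simp [halfPlane] at ht

theorem isOpen_halfPlane (σ : ℝ) : IsOpen (halfPlane σ) :=
  isOpen_lt continuous_const (by fun_prop)

theorem convex_halfPlane (σ : ℝ) : Convex ℝ (halfPlane σ) := by
  intro x hx y hy a b ha hb hab
  simp only [halfPlane, Set.mem_ofPred_eq, Complex.add_re, Complex.real_smul, Complex.re_ofReal_mul]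
    at hx hy ⊢
  have : σ * (a * x.re + b * y.re) = a * (σ * x.re) + b * (σ * y.re) := by ring
  rw [this]
  rcases ha.eq_or_lt with rfl | ha
  · obtain rfl : b = 1 := by linarith
    simpa using hy
  · have := mul_pos ha hx
    have := mul_nonneg hb hy.le
    linarith

theorem hasDerivAt_lg {σ : ℝ} {c t : ℂ} (ht : t ∈ halfPlane σ) :
    HasDerivAt (lg σ c) t⁻¹ t := by
  have h1 : (σ : ℂ) * t ∈ Complex.slitPlane := by
    left; simpa [halfPlane] using ht
  have h2 := (((hasDerivAt_id t).const_mul (σ : ℂ)).clog h1).add_const c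
  refine h2.congr_deriv ?_
  have h3 : (σ : ℂ) ≠ 0 := by
    rintro h
    rw [Complex.ofReal_eq_zero] at h
    simp [halfPlane, h] at ht
  have h4 := ne_zero_of_mem_halfPlane ht
  simp only [id]
  field_simp

theorem norm_lg_le {σ : ℝ} (hσ : |σ| = 1) (c t : ℂ) :
    ‖lg σ c t‖ ≤ |Real.log ‖t‖| + (Real.pi + ‖c‖) := by
  have h1 : ‖Complex.log (σ * t)‖ ≤ |Real.log ‖t‖| + Real.pi := by
    refine (Complex.norm_le_abs_re_add_abs_im _).trans (add_le_add ?_ ?_)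
    · rw [Complex.log_re, norm_mul, Complex.norm_real, Real.norm_eq_abs, hσ, one_mul]
    · rw [Complex.log_im]; exact Complex.abs_arg_le_pi _
  calc ‖lg σ c t‖ ≤ _ := norm_add_le _ _
    _ ≤ _ := by linarith

/-- The limit is over a full neighbourhood of 0: the argument is bounded by π on every ray, whatever
the branch cut. -/
theorem tendsto_mul_lg {σ : ℝ} (hσ : |σ| = 1) (c : ℂ) :
    Tendsto (fun t => t * lg σ c t) (𝓝 0) (𝓝 0) := by
  have h1 : Tendsto (fun t : ℂ => |‖t‖ * Real.log ‖t‖| + ‖t‖ * (Real.pi + ‖c‖)) (𝓝 0) (𝓝 0) := by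
    have : Continuous fun t : ℂ => |‖t‖ * Real.log ‖t‖| + ‖t‖ * (Real.pi + ‖c‖) :=
      ((Real.continuous_mul_log.comp continuous_norm).abs).add
        (continuous_norm.mul continuous_const)
    simpa using this.tendsto 0
  refine squeeze_zero_norm (fun t => ?_) h1
  rw [norm_mul, abs_mul, abs_norm, ← mul_add]
  exact mul_le_mul_of_nonneg_left (norm_lg_le hσ c t) (norm_nonneg t)

/-- `bM` on the branch `lg σ c`. -/
def mM (σ : ℝ) (c : ℂ) (n : ℕ) (t : ℂ) : ℂ := bM n (lg σ c t) t

theorem hasDerivAt_mM {σ : ℝ} {c t : ℂ} (n : ℕ) (ht : t ∈ halfPlane σ) :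
    HasDerivAt (mM σ c (n + 1)) (mM σ c n t) t :=
  hasDerivAt_bM n (hasDerivAt_lg ht) (ne_zero_of_mem_halfPlane ht)

theorem mM_add_two (σ : ℝ) (c : ℂ) (n : ℕ) (t : ℂ) :
    mM σ c (n + 2) t = t * mM σ c n t - (n + 1) * mM σ c (n + 1) t :=
  bM_add_two n _ t

theorem mM_eq (σ : ℝ) (c : ℂ) (n : ℕ) (t : ℂ) :
    mM σ c (n + 1) t = bB (-((n + 1 : ℕ) : ℂ)) t +
      t ^ n * ((t * lg σ c t) * bA (n + 1 : ℕ) t + t * bB (n + 1 : ℕ) t) := by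
  rw [mM, bM]; ring

/-- The index has to be positive: a factor t then absorbs the logarithm, whereas index 0 diverges
like log t. -/
theorem tendsto_mM {σ : ℝ} (hσ : |σ| = 1) (c : ℂ) (n : ℕ) :
    Tendsto (mM σ c (n + 1)) (𝓝 0) (𝓝 (bB (-((n + 1 : ℕ) : ℂ)) 0)) := by
  have h0 : Tendsto (fun t : ℂ => t) (𝓝 0) (𝓝 0) := tendsto_id
  have h1 := (((tendsto_mul_lg hσ c).mul ((continuous_bA (n + 1 : ℕ)).tendsto 0)).add
    (h0.mul ((continuous_bB (n + 1 : ℕ)).tendsto 0)))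
  have h2 := ((continuous_bB (-((n + 1 : ℕ) : ℂ))).tendsto 0).add ((h0.pow n).mul h1)
  simp only [zero_mul, add_zero, mul_zero] at h2
  exact h2.congr fun t => (mM_eq σ c n t).symm

theorem mM_sub_isBigO {σ : ℝ} (hσ : |σ| = 1) (c : ℂ) (n : ℕ) :
    (fun t => mM σ c (n + 2) t - bB (-((n + 2 : ℕ) : ℂ)) 0) =O[𝓝 0] fun t => t := by
  have h1 : (fun t => bB (-((n + 2 : ℕ) : ℂ)) t - bB (-((n + 2 : ℕ) : ℂ)) 0) =O[𝓝 0] fun t => t := by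
    simpa using (hasDerivAt_bB (-((n + 2 : ℕ) : ℂ)) 0).isBigO_sub
  have h0 : Tendsto (fun t : ℂ => t) (𝓝 0) (𝓝 0) := tendsto_id
  have h2 := ((h0.pow n).mul (((tendsto_mul_lg hσ c).mul
    ((continuous_bA (n + 2 : ℕ)).tendsto 0)).add (h0.mul ((continuous_bB (n + 2 : ℕ)).tendsto 0))))
  have h3 := (isBigO_refl (fun t : ℂ => t) (𝓝 0)).mul (h2.isBigO_one ℂ)
  simp only [mul_one] at h3
  refine (h1.add h3).congr_left fun t => ?_
  rw [mM_eq, pow_succ]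
  push_cast
  ring_nf

/-- At index 1 no power of t is left over to absorb t log t. This is the only source of the
logarithm in the final error, and it is met only for |ℓ| = 2. -/
theorem mM_one_sub_isBigO {σ : ℝ} (hσ : |σ| = 1) (c : ℂ) :
    (fun t => mM σ c 1 t - bB (-((0 + 1 : ℕ) : ℂ)) 0) =O[𝓝 0]
      fun t => ‖t‖ * (1 + |Real.log ‖t‖|) := by
  have ht : (fun t : ℂ => t) =O[𝓝 0] fun t => ‖t‖ * (1 + |Real.log ‖t‖|) := by
    refine IsBigO.of_bound 1 (Eventually.of_forall fun t => ?_)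
    rw [one_mul, Real.norm_of_nonneg (by positivity)]
    exact le_mul_of_one_le_right (norm_nonneg _) (by linarith [abs_nonneg (Real.log ‖t‖)])
  have h1 : (fun t => bB (-((0 + 1 : ℕ) : ℂ)) t - bB (-((0 + 1 : ℕ) : ℂ)) 0) =O[𝓝 0]
      fun t => t := by
    simpa using (hasDerivAt_bB (-((0 + 1 : ℕ) : ℂ)) 0).isBigO_sub
  have h2 : (fun t => t * lg σ c t) =O[𝓝 0] fun t => ‖t‖ * (1 + |Real.log ‖t‖|) := by
    refine IsBigO.of_bound (1 + (Real.pi + ‖c‖)) (Eventually.of_forall fun t => ?_)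
    rw [norm_mul, Real.norm_of_nonneg (by positivity), mul_left_comm]
    refine mul_le_mul_of_nonneg_left ((norm_lg_le hσ c t).trans ?_) (norm_nonneg t)
    have := Real.pi_pos
    have := norm_nonneg c
    nlinarith [abs_nonneg (Real.log ‖t‖)]
  have h3 := h2.mul (((continuous_bA (0 + 1 : ℕ)).tendsto 0).isBigO_one ℝ)
  have h4 := ht.mul (((continuous_bB (0 + 1 : ℕ)).tendsto 0).isBigO_one ℝ)
  simp only [mul_one] at h3 h4
  refine ((h1.trans ht).add (h3.add h4)).congr_left fun t => ?_
  rw [mM_eq]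
  ring

/-- The recurrences make the derivative vanish on the half plane, which is connected; the constant
is the limit at 0. -/
theorem wronskian_bA_mM {σ : ℝ} (hσ : |σ| = 1) (c : ℂ) (n : ℕ) {t : ℂ} (ht : t ∈ halfPlane σ) :
    bA (n + 1 : ℕ) t * mM σ c (n + 2) t - t * bA (n + 2 : ℕ) t * mM σ c (n + 1) t =
      bA (n + 1 : ℕ) 0 * bB (-((n + 2 : ℕ) : ℂ)) 0 := by
  set w : ℂ → ℂ := fun t => bA (n + 1 : ℕ) t * mM σ c (n + 2) t -
    t * bA (n + 2 : ℕ) t * mM σ c (n + 1) t with hw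
  have hd : ∀ s ∈ halfPlane σ, HasDerivAt w 0 s := fun s hs => by
    have h1 := ((hasDerivAt_bA_nat (n + 1) s).mul (hasDerivAt_mM (c := c) (n + 1) hs)).sub
      (((hasDerivAt_id s).mul (hasDerivAt_bA_nat (n + 2) s)).mul (hasDerivAt_mM (c := c) n hs))
    refine h1.congr_deriv ?_
    have h2 := mM_add_two σ c n s
    have h3 := bA_nat_eq (n + 1) s
    simp only [id, Pi.mul_apply, one_mul]
    rw [h2, h3]
    push_cast
    ring_nf
  have hlim : Tendsto w (𝓝 0) (𝓝 (bA (n + 1 : ℕ) 0 * bB (-((n + 2 : ℕ) : ℂ)) 0)) := by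
    have h0 : Tendsto (fun t : ℂ => t) (𝓝 0) (𝓝 0) := tendsto_id
    have h1 : Tendsto (mM σ c (n + 2)) (𝓝 0) (𝓝 (bB (-((n + 2 : ℕ) : ℂ)) 0)) :=
      tendsto_mM hσ c (n + 1)
    have := (((continuous_bA (n + 1 : ℕ)).tendsto 0).mul h1).sub
      ((h0.mul ((continuous_bA (n + 2 : ℕ)).tendsto 0)).mul (tendsto_mM hσ c n))
    simpa [hw] using this
  have hc : ∀ s ∈ halfPlane σ, w s = w t := fun s hs =>
    (convex_halfPlane σ).is_const_of_fderivWithin_eq_zero (𝕜 := ℂ)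
      (fun z hz => (hd z hz).differentiableAt.differentiableWithinAt)
      (fun z hz => by
        rw [fderivWithin_of_isOpen (isOpen_halfPlane σ) hz]
        simpa using (hd z hz).hasFDerivAt.fderiv) hs ht
  -- The ray through t stays in the half plane and reaches 0 in the limit.
  have hseq : Tendsto (fun a : ℝ => (a : ℂ) * t) (𝓝[>] 0) (𝓝 0) := by
    have : Continuous fun a : ℝ => (a : ℂ) * t := by fun_prop
    simpa using (this.tendsto 0).mono_left nhdsWithin_le_nhds
  refine tendsto_nhds_unique ?_ (hlim.comp hseq)
  refine tendsto_const_nhds.congr' ?_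
  filter_upwards [self_mem_nhdsWithin] with a ha
  refine (hc _ ?_).symm
  simp only [halfPlane, Set.mem_ofPred_eq, Complex.re_ofReal_mul] at ht ⊢
  have : σ * (a * t.re) = a * (σ * t.re) := by ring
  rw [this]; exact mul_pos ha ht

theorem wronskian_const_ne_zero (n : ℕ) :
    bA (n + 1 : ℕ) 0 * bB (-((n + 2 : ℕ) : ℂ)) 0 ≠ 0 := by
  refine mul_ne_zero ?_ (bB_neg_nat_zero_ne_zero (n + 1))
  rw [bA_nat_zero]
  exact inv_ne_zero (by exact_mod_cast (n + 1).factorial_ne_zero)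

/-- Consecutive functions `bA` have no common real zero. -/
theorem bA_succ_ne_zero (n : ℕ) {x : ℝ} (hx : bA (n + 1 : ℕ) x = 0) : bA (n + 2 : ℕ) x ≠ 0 := by
  intro h
  rcases eq_or_ne x 0 with rfl | h0
  · rw [Complex.ofReal_zero, bA_nat_zero] at h
    exact inv_ne_zero (by exact_mod_cast (n + 2).factorial_ne_zero) h
  · have : ∃ σ : ℝ, |σ| = 1 ∧ (x : ℂ) ∈ halfPlane σ := by
      rcases lt_or_gt_of_ne h0 with h0 | h0
      · exact ⟨-1, by simp, by simpa [halfPlane] using h0⟩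
      · exact ⟨1, by simp, by simpa [halfPlane] using h0⟩
    obtain ⟨σ, hσ, hm⟩ := this
    refine wronskian_const_ne_zero n ?_
    rw [← wronskian_bA_mM hσ 0 n hm, hx, h]
    simp

/-! ### The matching equation -/

/-- The inner and the outer solution can be matched at the boundary of the well if and only if
this function of `e = ερ²/4` and `t = -λ²ρ²/4` vanishes. -/
def matchF (σ : ℝ) (c : ℂ) (n : ℕ) (τ e t : ℂ) : ℂ :=
  bA (n + 1 : ℕ) (τ + e + t) * mM σ c (n + 2) t -
    t * bA (n + 2 : ℕ) (τ + e + t) * mM σ c (n + 1) t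

theorem bA_succ_eq (n : ℕ) (t : ℂ) :
    bA (n + 1 : ℕ) t = (n + 2) * bA (n + 2 : ℕ) t + t * bA (n + 3 : ℕ) t := by
  refine (bA_nat_eq (n + 1) t).trans ?_
  congr 2
  push_cast; ring

/-- The recurrences eliminate the second solution of index n, which is logarithmically singular at 0
if n = 0. Only index n + 1 survives, so the derivative has a limit at t = 0. -/
theorem hasDerivAt_matchF {σ : ℝ} {c t : ℂ} (n : ℕ) (τ e : ℂ) (ht : t ∈ halfPlane σ) :
    HasDerivAt (matchF σ c n τ e)
      ((τ + e) * bA (n + 3 : ℕ) (τ + e + t) * mM σ c (n + 1) t) t := by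
  have hA : ∀ k : ℕ, HasDerivAt (fun t => bA k (τ + e + t)) (bA (k + 1 : ℕ) (τ + e + t)) t :=
    fun k => by
      simpa using (hasDerivAt_bA_nat k (τ + e + t)).comp_const_add (τ + e) t
  have hA1 : HasDerivAt (fun t => bA (n + 1 : ℕ) (τ + e + t)) (bA (n + 2 : ℕ) (τ + e + t)) t :=
    hA (n + 1)
  have hA2 : HasDerivAt (fun t => bA (n + 2 : ℕ) (τ + e + t)) (bA (n + 3 : ℕ) (τ + e + t)) t :=
    hA (n + 2)
  have hM1 : HasDerivAt (mM σ c (n + 2)) (mM σ c (n + 1) t) t := hasDerivAt_mM (n + 1) ht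
  have h1 := (hA1.mul hM1).sub (((hasDerivAt_id t).mul hA2).mul (hasDerivAt_mM (c := c) n ht))
  refine h1.congr_deriv ?_
  have h4 : t * mM σ c n t = mM σ c (n + 2) t + (n + 1) * mM σ c (n + 1) t := by
    rw [mM_add_two]; ring
  simp only [id, Pi.mul_apply, one_mul]
  rw [bA_succ_eq n]
  linear_combination (-bA (n + 2 : ℕ) (τ + e + t)) * h4

/-- The derivative of `matchF` in `t` at the origin. -/
def slope (n : ℕ) (τ : ℂ) : ℂ := τ * bA (n + 3 : ℕ) τ * bB (-((n + 1 : ℕ) : ℂ)) 0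

/-- At a zero of bA (n+1) the recurrence gives x bA (n+3) x = -(n+2) bA (n+2) x, and consecutive
functions have no common real zero. -/
theorem slope_ne_zero {n : ℕ} {x : ℝ} (hx : bA (n + 1 : ℕ) x = 0) : slope n x ≠ 0 := by
  have h1 := bA_succ_eq n x
  have h2 : (x : ℂ) * bA (n + 3 : ℕ) x = -((n : ℂ) + 2) * bA (n + 2 : ℕ) x := by
    rw [hx] at h1
    linear_combination (-1 : ℂ) * h1
  rw [slope, h2]
  exact mul_ne_zero (mul_ne_zero (neg_ne_zero.2 (by exact_mod_cast (n + 1).succ_ne_zero))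
    (bA_succ_ne_zero n hx)) (bB_neg_nat_zero_ne_zero n)

/-- On small half discs, `matchF` is close to a linear function of `t`. -/
theorem exists_matchF_approx {σ : ℝ} (hσ : |σ| = 1) (c : ℂ) {n : ℕ} {τ : ℂ}
    (hD : slope n τ ≠ 0) :
    ∃ δ > 0, ∀ e : ℂ, ‖e‖ < δ → ∀ s ∈ halfPlane σ ∩ Metric.ball 0 δ,
      ∀ t ∈ halfPlane σ ∩ Metric.ball 0 δ,
        ‖matchF σ c n τ e s - matchF σ c n τ e t - slope n τ * (s - t)‖ ≤
          ‖slope n τ‖ / 2 * ‖s - t‖ := by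
  have hlim : Tendsto (fun p : ℂ × ℂ =>
      (τ + p.1) * bA (n + 3 : ℕ) (τ + p.1 + p.2) * mM σ c (n + 1) p.2) (𝓝 0 ×ˢ 𝓝 0)
      (𝓝 (slope n τ)) := by
    have h1 : Tendsto (fun p : ℂ × ℂ => (τ + p.1) * bA (n + 3 : ℕ) (τ + p.1 + p.2)) (𝓝 0 ×ˢ 𝓝 0)
        (𝓝 (τ * bA (n + 3 : ℕ) τ)) := by
      have hc : Continuous fun p : ℂ × ℂ => (τ + p.1) * bA (n + 3 : ℕ) (τ + p.1 + p.2) := by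
        have := continuous_bA (n + 3 : ℕ)
        fun_prop
      simpa [nhds_prod_eq] using hc.tendsto (0, 0)
    exact h1.mul ((tendsto_mM hσ c n).comp tendsto_snd)
  have hev := hlim (Metric.closedBall_mem_nhds (slope n τ) (half_pos (norm_pos_iff.2 hD)))
  rw [mem_map, ← nhds_prod_eq, Metric.mem_nhds_iff] at hev
  obtain ⟨δ, hδ, hsub⟩ := hev
  refine ⟨δ, hδ, fun e he s hs t ht => ?_⟩
  have hconv : Convex ℝ (halfPlane σ ∩ Metric.ball 0 δ) :=
    (convex_halfPlane σ).inter (convex_ball 0 δ)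
  have hder : ∀ z ∈ halfPlane σ ∩ Metric.ball 0 δ,
      HasDerivWithinAt (fun z => matchF σ c n τ e z - slope n τ * z)
        ((τ + e) * bA (n + 3 : ℕ) (τ + e + z) * mM σ c (n + 1) z - slope n τ)
        (halfPlane σ ∩ Metric.ball 0 δ) z := fun z hz => by
    have := (hasDerivAt_matchF (c := c) n τ e hz.1).sub
      (hasDerivAt_const_mul (slope n τ))
    exact this.hasDerivWithinAt
  -- Mean value inequality for `matchF` minus its linear part. The origin, where the logarithm is
  -- singular, is not in the convex set.
  have := hconv.norm_image_sub_le_of_norm_hasDerivWithin_le hder (C := ‖slope n τ‖ / 2)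
    (fun z hz => by
      have hm : (e, z) ∈ Metric.ball (0 : ℂ × ℂ) δ := by
        simp only [Metric.mem_ball, dist_zero_right, Prod.norm_def, max_lt_iff]
        exact ⟨he, by simpa using hz.2⟩
      simpa [dist_eq_norm] using hsub hm) ht hs
  refine le_of_eq_of_le ?_ this
  congr 1; ring

/-! ### The linear root and its residual -/

/-- The approximate zero of `matchF`. -/
def approxZero (n : ℕ) (e : ℂ) : ℂ := -((n + 1) / (n + 2) * e)

/-- The size of the residual of the approximate zero. -/
def errScale (n : ℕ) (e : ℝ) : ℝ := e ^ 2 * (1 + (if n = 0 then 1 else 0) * Real.log |e|)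

theorem tendsto_log_abs : Tendsto (fun e : ℝ => Real.log |e|) (𝓝[≠] 0) atBot := by
  simpa using Real.tendsto_log_nhdsNE_zero

/-- The error terms are stated with 1 + log rather than 1 + |log|. As log|e| tends to -∞, the
possible cancellation in 1 + log is harmless near 0. -/
theorem one_add_abs_log_isBigO :
    (fun e : ℝ => 1 + |Real.log (abs e)|) =O[𝓝[≠] 0] fun e => 1 + Real.log |e| := by
  -- For L ≤ -2 one has 1 - L ≤ 3(-1 - L).
  refine IsBigO.of_bound 3 ?_
  filter_upwards [tendsto_log_abs.eventually_le_atBot (-2)] with e he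
  generalize Real.log (abs e) = L at he ⊢
  rw [Real.norm_of_nonneg (by positivity), Real.norm_eq_abs, abs_of_nonpos (by linarith),
    abs_of_nonpos (by linarith)]
  linarith

theorem sq_isBigO_errScale (n : ℕ) : (fun e : ℝ => e ^ 2) =O[𝓝[≠] 0] errScale n := by
  rcases eq_or_ne n 0 with rfl | hn
  · have h1 : (fun _ : ℝ => (1 : ℝ)) =O[𝓝[≠] 0] fun e => 1 + Real.log |e| := by
      refine IsBigO.trans (IsBigO.of_bound 1 (Eventually.of_forall fun e => ?_))
        one_add_abs_log_isBigO
      rw [Real.norm_of_nonneg (by positivity), Real.norm_of_nonneg (by positivity)]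
      linarith [abs_nonneg (Real.log |e|)]
    refine ((isBigO_refl (fun e : ℝ => e ^ 2) (𝓝[≠] 0)).mul h1).congr (fun e => mul_one _)
      fun e => ?_
    simp only [errScale, if_true, one_mul]
  · refine (isBigO_refl _ _).congr_right fun e => ?_
    simp [errScale, hn]

theorem errScale_isLittleO (n : ℕ) : errScale n =o[𝓝[≠] 0] fun e : ℝ => e := by
  have h1 : Tendsto (fun e : ℝ => e * (1 + (if n = 0 then 1 else 0) * Real.log |e|)) (𝓝[≠] 0)
      (𝓝 0) := by
    have hc : Continuous fun e : ℝ => e + (if n = 0 then 1 else 0) * (e * Real.log e) :=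
      continuous_id.add (continuous_const.mul Real.continuous_mul_log)
    have h2 := (hc.tendsto 0).mono_left (nhdsWithin_le_nhds (s := {0}ᶜ))
    simp only [zero_mul, mul_zero, add_zero] at h2
    refine h2.congr fun e => ?_
    rw [Real.log_abs]; ring
  have h3 := (isBigO_refl (fun e : ℝ => e) (𝓝[≠] 0)).mul_isLittleO
    ((isLittleO_one_iff ℝ).2 h1)
  simp only [mul_one] at h3
  refine h3.congr_left fun e => ?_
  rw [errScale]; ring

/-- With t = a e and τ + e + t = τ + b e, the terms linear in e cancel; this is what determines the
ratio (n+1)/(n+2). The rest is quadratic in e, except for t times the increment of the second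
solution of index n + 1, which carries the logarithm when n = 0. -/
theorem matchF_approxZero_isBigO {σ : ℝ} (hσ : |σ| = 1) (c : ℂ) {n : ℕ} {τ : ℂ}
    (hτ : bA (n + 1 : ℕ) τ = 0) :
    (fun e : ℝ => matchF σ c n τ e (approxZero n e)) =O[𝓝[≠] 0] errScale n := by
  have hn2 : ((n : ℂ) + 2) ≠ 0 := by exact_mod_cast (n + 1).succ_ne_zero
  have hlin : ∀ a : ℂ, (fun e : ℝ => a * (e : ℂ)) =O[𝓝[≠] 0] fun e : ℝ => e := fun a =>
    (IsBigO.of_bound ‖a‖ (Eventually.of_forall fun e => by simp))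
  have ht0 : ∀ a : ℂ, Tendsto (fun e : ℝ => a * (e : ℂ)) (𝓝[≠] 0) (𝓝 0) := fun a => by
    have : Continuous fun e : ℝ => a * (e : ℂ) := by fun_prop
    simpa using (this.tendsto 0).mono_left (nhdsWithin_le_nhds (s := {0}ᶜ))
  set a : ℂ := -((n + 1) / (n + 2)) with ha
  set b : ℂ := 1 / (n + 2) with hb
  have hab : ∀ e : ℂ, τ + e + approxZero n e = τ + b * e := fun e => by
    rw [approxZero, hb]; field_simp; ring
  have htz : ∀ e : ℂ, approxZero n e = a * e := fun e => by rw [approxZero, ha]; ring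
  -- remainders
  have hA1 : (fun e : ℝ => bA (n + 2 : ℕ) (τ + b * e) - bA (n + 2 : ℕ) τ) =O[𝓝[≠] 0]
      fun e : ℝ => e := by
    have h1 := (hasDerivAt_bA_nat (n + 2) τ).isBigO_sub
    have h2 : Tendsto (fun e : ℝ => τ + b * e) (𝓝[≠] 0) (𝓝 τ) := by
      simpa using (tendsto_const_nhds (x := τ)).add (ht0 b)
    have h3 := h1.comp_tendsto h2
    simp only [Function.comp_def, add_sub_cancel_left] at h3
    exact h3.trans (hlin b)
  have hA2 : (fun e : ℝ => bA (n + 1 : ℕ) (τ + b * e) - b * e * bA (n + 2 : ℕ) τ) =O[𝓝[≠] 0]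
      fun e : ℝ => e ^ 2 := by
    -- Second-order Taylor remainder: on the ball of radius |x| its derivative is O(|x|), so the
    -- mean value inequality bounds it by O(|x|²).
    obtain ⟨C, hC⟩ := ((hasDerivAt_bA_nat (n + 2) τ).isBigO_sub).bound
    obtain ⟨δ, hδ, hC⟩ := Metric.eventually_nhds_iff_ball.1 hC
    have key : ∀ x : ℂ, ‖x‖ < δ →
        ‖bA (n + 1 : ℕ) (τ + x) - x * bA (n + 2 : ℕ) τ‖ ≤ |C| * ‖x‖ * ‖x‖ := fun x hx => by
      have hder : ∀ z ∈ Metric.closedBall (0 : ℂ) ‖x‖, HasDerivWithinAt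
          (fun z => bA (n + 1 : ℕ) (τ + z) - z * bA (n + 2 : ℕ) τ)
          (bA (n + 2 : ℕ) (τ + z) - bA (n + 2 : ℕ) τ) (Metric.closedBall 0 ‖x‖) z := fun z _ => by
        have h1 := (hasDerivAt_bA_nat (n + 1) (τ + z)).comp_const_add τ z
        exact (h1.sub (hasDerivAt_mul_const (bA (n + 2 : ℕ) τ))).hasDerivWithinAt
      have := (convex_closedBall (0 : ℂ) ‖x‖).norm_image_sub_le_of_norm_hasDerivWithin_le hder
        (C := |C| * ‖x‖) (fun z hz => by
          have hz' : ‖z‖ ≤ ‖x‖ := by simpa using hz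
          have := hC (τ + z) (by simpa using hz'.trans_lt hx)
          simp only [add_sub_cancel_left] at this
          exact this.trans ((mul_le_mul_of_nonneg_right (le_abs_self C) (norm_nonneg _)).trans
            (mul_le_mul_of_nonneg_left hz' (abs_nonneg C))))
        (x := 0) (y := x) (by simp) (by simp)
      simpa only [add_zero, hτ, zero_mul, sub_zero] using this
    refine IsBigO.of_bound (|C| * ‖b‖ * ‖b‖) ?_
    have hev := (ht0 b).eventually (Metric.ball_mem_nhds 0 hδ)
    filter_upwards [hev] with e he
    refine (key (b * e) (by simpa using he)).trans (le_of_eq ?_)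
    simp only [norm_mul, Complex.norm_real, norm_pow]
    ring
  have hM2 : (fun e : ℝ => mM σ c (n + 2) (a * e) - bB (-((n + 2 : ℕ) : ℂ)) 0) =O[𝓝[≠] 0]
      fun e : ℝ => e := by
    have h3 := (mM_sub_isBigO hσ c n).comp_tendsto (ht0 a)
    exact h3.trans (hlin a)
  have hM1 : (fun e : ℝ => a * e * (mM σ c (n + 1) (a * e) - bB (-((n + 1 : ℕ) : ℂ)) 0))
      =O[𝓝[≠] 0] errScale n := by
    rcases n with _ | n
    · have h3 := (mM_one_sub_isBigO hσ c).comp_tendsto (ht0 a)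
      have h4 : (fun e : ℝ => ‖a * (e : ℂ)‖ * (1 + |Real.log ‖a * (e : ℂ)‖|)) =O[𝓝[≠] 0]
          fun e : ℝ => e * (1 + Real.log |e|) := by
        have h5 : (fun e : ℝ => ‖a * (e : ℂ)‖) =O[𝓝[≠] 0] fun e : ℝ => e := (hlin a).norm_left
        refine h5.mul (IsBigO.trans ?_ one_add_abs_log_isBigO)
        have ha0 : ‖a‖ ≠ 0 := by
          rw [ha]; norm_num
        refine IsBigO.of_bound (1 + |Real.log ‖a‖|) ?_
        filter_upwards [self_mem_nhdsWithin] with e he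
        rw [Real.norm_of_nonneg (by positivity), Real.norm_of_nonneg (by positivity), norm_mul,
          Complex.norm_real, Real.norm_eq_abs, Real.log_mul ha0 (abs_ne_zero.2 he)]
        have := abs_add_le (Real.log ‖a‖) (Real.log |e|)
        nlinarith [abs_nonneg (Real.log ‖a‖), abs_nonneg (Real.log |e|)]
      refine ((hlin a).mul (h3.trans h4)).congr_right fun e => ?_
      simp only [errScale, if_true]; ring
    · have h3 := (mM_sub_isBigO hσ c n).comp_tendsto (ht0 a)
      have h4 := (hlin a).mul (h3.trans (hlin a))
      refine (h4.congr_right fun e => ?_).trans (sq_isBigO_errScale (n + 1))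
      ring
  -- boundedness of the factors
  have hBM2 : (fun e : ℝ => mM σ c (n + 2) (a * e)) =O[𝓝[≠] 0] fun _ => (1 : ℝ) :=
    ((tendsto_mM hσ c (n + 1)).comp (ht0 a)).isBigO_one ℝ
  have hBM1 : (fun e : ℝ => mM σ c (n + 1) (a * e)) =O[𝓝[≠] 0] fun _ => (1 : ℝ) :=
    ((tendsto_mM hσ c n).comp (ht0 a)).isBigO_one ℝ
  have e1 := ((hlin (b * bA (n + 2 : ℕ) τ)).mul hM2).congr_right fun e => (sq e).symm
  have e2 := (hA2.mul hBM2).congr_right fun e => mul_one _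
  have e3 := hM1.const_mul_left (bA (n + 2 : ℕ) τ)
  have e4 := ((hA1.mul (hlin a)).mul hBM1).congr_right
    (g₂ := fun e : ℝ => e ^ 2) fun e => by ring
  have sq_le := sq_isBigO_errScale n
  refine ((((e1.trans sq_le).add (e2.trans sq_le)).sub e3).sub (e4.trans sq_le)).congr_left
    fun e => ?_
  rw [matchF, hab, htz]
  -- The coefficients of e coming from the two products agree, since values of (1/Γ)' at consecutive
  -- poles of Γ differ by the factor -(n+1).
  have hm : b * bB (-((n + 2 : ℕ) : ℂ)) 0 = a * bB (-((n + 1 : ℕ) : ℂ)) 0 := by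
    rw [bB_neg_nat_zero_succ, ha, hb]; field_simp
  linear_combination (-(bA (n + 2 : ℕ) τ * e)) * hm

/-- The number `(n+1)/(n+2)`. -/
def ratio (n : ℕ) : ℝ := (n + 1) / (n + 2)

theorem ratio_pos (n : ℕ) : 0 < ratio n := by unfold ratio; positivity

theorem ratio_le_one (n : ℕ) : ratio n ≤ 1 := by
  unfold ratio; rw [div_le_one (by positivity)]; linarith

theorem approxZero_ofReal (n : ℕ) (e : ℝ) : approxZero n e = ((-(ratio n * e) : ℝ) : ℂ) := by
  rw [approxZero, ratio]; push_cast; ring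

theorem norm_approxZero (n : ℕ) (e : ℝ) : ‖approxZero n e‖ = ratio n * |e| := by
  rw [approxZero_ofReal, Complex.norm_real, Real.norm_eq_abs, abs_neg, abs_mul,
    abs_of_pos (ratio_pos n)]

theorem approxZero_mem_halfPlane {σ : ℝ} (n : ℕ) {e : ℝ} (he : σ * e < 0) :
    approxZero n e ∈ halfPlane σ := by
  rw [approxZero_ofReal, halfPlane, Set.mem_ofPred_eq, Complex.ofReal_re]
  nlinarith [ratio_pos n]

theorem closedBall_approxZero_subset {σ : ℝ} (hσ : |σ| = 1) (n : ℕ) {e : ℝ} (he : σ * e < 0) :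
    Metric.closedBall (approxZero n e) (‖approxZero n e‖ / 2) ⊆ halfPlane σ := by
  intro t ht
  rw [Metric.mem_closedBall, dist_eq_norm, norm_approxZero, approxZero_ofReal] at ht
  have h1 := (Complex.abs_re_le_norm _).trans ht
  rw [Complex.sub_re, Complex.ofReal_re] at h1
  have h2 : |σ * (t.re - -(ratio n * e))| ≤ ratio n * |e| / 2 := by rwa [abs_mul, hσ, one_mul]
  have h3 : |e| = -(σ * e) := by rw [← abs_of_neg he, abs_mul, hσ, one_mul]
  rw [h3] at h2
  have h4 := (abs_le.1 h2).1
  rw [halfPlane, Set.mem_ofPred_eq]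
  nlinarith [mul_pos (ratio_pos n) (neg_pos.2 he)]

/-- The linear approximation up to half the slope gives |slope|·|t - z| ≤ |F(z)| + |slope|·|t - z|/2
at a zero t, with z the linear root. This is the uniqueness half; it applies to the zeros supplied
by eigenvalues. -/
theorem exists_norm_sub_approxZero_le {σ : ℝ} (hσ : |σ| = 1) (c : ℂ) {n : ℕ} {τ : ℂ}
    (hD : slope n τ ≠ 0) :
    ∃ δ > 0, ∀ e : ℝ, σ * e < 0 → |e| < δ → ∀ t ∈ halfPlane σ, ‖t‖ < δ →
      matchF σ c n τ e t = 0 →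
      ‖t - approxZero n e‖ ≤ 2 / ‖slope n τ‖ * ‖matchF σ c n τ e (approxZero n e)‖ := by
  obtain ⟨δ, hδ, h⟩ := exists_matchF_approx hσ c hD
  refine ⟨δ, hδ, fun e he heδ t ht htδ h0 => ?_⟩
  have hs : approxZero n e ∈ halfPlane σ ∩ Metric.ball 0 δ := by
    refine ⟨approxZero_mem_halfPlane n he, ?_⟩
    rw [mem_ball_zero_iff, norm_approxZero]
    nlinarith [ratio_le_one n, ratio_pos n, abs_nonneg e]
  have h1 := h e (by simpa using heδ) t ⟨ht, by simpa using htδ⟩ _ hs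
  rw [h0] at h1
  have hD' : 0 < ‖slope n τ‖ := norm_pos_iff.2 hD
  have h2 := norm_add_le (0 - matchF σ c n τ e (approxZero n e) -
    slope n τ * (t - approxZero n e)) (matchF σ c n τ e (approxZero n e))
  have h3 : 0 - matchF σ c n τ e (approxZero n e) - slope n τ * (t - approxZero n e) +
    matchF σ c n τ e (approxZero n e) = -(slope n τ * (t - approxZero n e)) := by ring
  rw [h3, norm_neg, norm_mul] at h2
  rw [div_mul_eq_mul_div, le_div_iff₀ hD']
  linarith

/-- On the closed ball of radius 2|F(z)|/|slope| about the linear root z, F is linear up to half its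
slope. Its image therefore contains the closed ball of radius |F(z)| about F(z), and so 0. The
nonvanishing of the second solution is recorded because it becomes the coefficient of the inner
solution. -/
theorem exists_zero_matchF {σ : ℝ} (hσ : |σ| = 1) (c : ℂ) {n : ℕ} {τ : ℂ}
    (hτ : bA (n + 1 : ℕ) τ = 0) (hD : slope n τ ≠ 0) :
    ∃ δ > 0, ∀ e : ℝ, σ * e < 0 → |e| < δ → ∃ t ∈ halfPlane σ,
      matchF σ c n τ e t = 0 ∧ mM σ c (n + 2) t ≠ 0 ∧
      ‖t - approxZero n e‖ ≤ 2 / ‖slope n τ‖ * ‖matchF σ c n τ e (approxZero n e)‖ := by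
  obtain ⟨δ₁, hδ₁, h⟩ := exists_matchF_approx hσ c hD
  have hD' : 0 < ‖slope n τ‖ := norm_pos_iff.2 hD
  have hM : ∀ᶠ t in 𝓝 (0 : ℂ), mM σ c (n + 2) t ≠ 0 :=
    (tendsto_mM hσ c (n + 1)).eventually_ne (bB_neg_nat_zero_ne_zero (n + 1))
  obtain ⟨δ₂, hδ₂, hM⟩ := Metric.eventually_nhds_iff_ball.1 hM
  -- This constant makes the radius 2|F(z)|/|slope| at most |z|/2, so that the ball stays inside the
  -- half plane.
  have hsmall := ((matchF_approxZero_isBigO hσ c hτ).trans_isLittleO (errScale_isLittleO n)).bound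
    (c := ratio n * ‖slope n τ‖ / 4) (by have := ratio_pos n; positivity)
  rw [eventually_nhdsWithin_iff, Metric.eventually_nhds_iff_ball] at hsmall
  obtain ⟨δ₃, hδ₃, hsmall⟩ := hsmall
  refine ⟨min (min (δ₁ / 2) (δ₂ / 2)) δ₃, by positivity, fun e he heδ => ?_⟩
  simp only [lt_min_iff] at heδ
  obtain ⟨⟨he1, he2⟩, he3⟩ := heδ
  have he0 : e ≠ 0 := by rintro rfl; simp at he
  have hF := hsmall e (by simpa using he3) he0
  set z := approxZero n e with hz
  set ε := 2 / ‖slope n τ‖ * ‖matchF σ c n τ e z‖ with hε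
  have hz' : ‖z‖ = ratio n * |e| := norm_approxZero n e
  have hze : ‖z‖ ≤ |e| := by
    rw [hz']; exact mul_le_of_le_one_left (abs_nonneg e) (ratio_le_one n)
  have hεz : ε ≤ ‖z‖ / 2 := by
    rw [hε, hz', div_mul_eq_mul_div, div_le_iff₀ hD']
    rw [Real.norm_eq_abs] at hF
    linarith
  have hball : Metric.closedBall z ε ⊆ halfPlane σ ∩ Metric.ball 0 δ₁ := by
    intro t ht
    refine ⟨closedBall_approxZero_subset hσ n he (Metric.closedBall_subset_closedBall hεz ht), ?_⟩
    rw [mem_ball_zero_iff]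
    rw [mem_closedBall_iff_norm] at ht
    have := norm_le_norm_add_norm_sub' t z
    have := norm_nonneg z
    linarith
  have happ : ApproximatesLinearOn (matchF σ c n τ e)
      (ContinuousLinearMap.toSpanSingleton ℂ (slope n τ))
      (halfPlane σ ∩ Metric.ball 0 δ₁) (‖slope n τ‖₊ / 2) := by
    intro s hs t ht
    have := h e (by simpa using he1.trans_le (by linarith)) s hs t ht
    simpa [mul_comm (slope n τ)] using this
  let inv : (ContinuousLinearMap.toSpanSingleton ℂ (slope n τ)).NonlinearRightInverse :=
    { toFun := fun y => y / slope n τ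
      nnnorm := ‖slope n τ‖₊⁻¹
      bound' := fun y => by
        rw [norm_div, NNReal.coe_inv, coe_nnnorm, div_eq_mul_inv, mul_comm]
      right_inv' := fun y => by
        simp [hD] }
  have hsurj := happ.surjOn_closedBall_of_nonlinearRightInverse inv (ε := ε) (b := z)
    (by positivity) hball
  have h0 : (0 : ℂ) ∈ Metric.closedBall (matchF σ c n τ e z)
      (((inv.nnnorm : ℝ)⁻¹ - ((‖slope n τ‖₊ / 2 : NNReal) : ℝ)) * ε) := by
    have : (((inv.nnnorm : ℝ)⁻¹ - ((‖slope n τ‖₊ / 2 : NNReal) : ℝ)) * ε) =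
        ‖matchF σ c n τ e z‖ := by
      simp only [inv, NNReal.coe_inv, coe_nnnorm, inv_inv, NNReal.coe_div, NNReal.coe_ofNat, hε]
      field_simp
      ring
    rw [this]
    simp
  obtain ⟨t, ht, htF⟩ := hsurj h0
  refine ⟨t, (hball ht).1, htF, hM t ?_, by simpa [dist_eq_norm] using ht⟩
  rw [mem_ball_zero_iff]
  rw [mem_closedBall_iff_norm] at ht
  have := norm_le_norm_add_norm_sub' t z
  have := norm_nonneg z
  linarith

/-! ### Functions of the form `y(|z|²) (x ± i y)^k` -/

/-- The squared modulus. -/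
def sq (z : ℂ) : ℝ := z.re * z.re + z.im * z.im

/-- The Euclidean inner product. -/
def ip (z v : ℂ) : ℝ := z.re * v.re + z.im * v.im

/-- `x + κ y`. -/
def lin (κ z : ℂ) : ℂ := z.re + κ * z.im

theorem sq_eq_norm_sq (z : ℂ) : sq z = ‖z‖ ^ 2 := by
  rw [sq, Complex.sq_norm, Complex.normSq_apply]

theorem lin_I (z : ℂ) : lin Complex.I z = z := by
  rw [lin, mul_comm]; exact Complex.re_add_im z

@[fun_prop]
theorem contDiff_sq {k : WithTop ℕ∞} : ContDiff ℝ k sq := by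
  have h1 : ContDiff ℝ k Complex.re := Complex.reCLM.contDiff
  have h2 : ContDiff ℝ k Complex.im := Complex.imCLM.contDiff
  exact (h1.mul h1).add (h2.mul h2)

@[fun_prop]
theorem contDiff_lin {k : WithTop ℕ∞} (κ : ℂ) : ContDiff ℝ k (lin κ) := by
  have h1 : ContDiff ℝ k Complex.re := Complex.reCLM.contDiff
  have h2 : ContDiff ℝ k Complex.im := Complex.imCLM.contDiff
  have h3 : ContDiff ℝ k (fun x : ℝ => (x : ℂ)) := Complex.ofRealCLM.contDiff
  exact (h3.comp h1).add (contDiff_const.mul (h3.comp h2))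

@[fun_prop]
theorem continuous_sq : Continuous sq := (contDiff_sq (k := 0)).continuous

@[fun_prop]
theorem continuous_lin (κ : ℂ) : Continuous (lin κ) := (contDiff_lin (k := 0) κ).continuous

@[fun_prop]
theorem continuous_ip (v : ℂ) : Continuous fun z => ip z v := by unfold ip; fun_prop

theorem hasLineDerivAt_ip (z v : ℂ) : HasLineDerivAt ℝ (fun z => ((ip z v : ℝ) : ℂ)) (sq v) z v := by
  have h : HasDerivAt (fun t : ℝ => ip (z + t • v) v) (sq v) 0 := by
    have : (fun t : ℝ => ip (z + t • v) v) = fun t => ip z v + t * sq v := by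
      funext t; simp [ip, sq]; ring
    rw [this]
    simpa using ((hasDerivAt_id (0 : ℝ)).mul_const (sq v)).const_add (ip z v)
  exact h.ofReal_comp

theorem hasDerivAt_sq_line (z v : ℂ) :
    HasDerivAt (fun t : ℝ => sq (z + t • v)) (2 * ip z v) 0 := by
  have : (fun t : ℝ => sq (z + t • v)) = fun t => sq z + t * (2 * ip z v) + t ^ 2 * sq v := by
    funext t; simp [ip, sq]; ring
  rw [this]
  have := (((hasDerivAt_id (0 : ℝ)).mul_const (2 * ip z v)).const_add (sq z)).add
    ((hasDerivAt_pow 2 (0 : ℝ)).mul_const (sq v))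
  simpa using! this

theorem hasLineDerivAt_comp_sq {y : ℝ → ℂ} {y' z : ℂ} (v : ℂ) (hy : HasDerivAt y y' (sq z)) :
    HasLineDerivAt ℝ (fun z => y (sq z)) (y' * (2 * ip z v)) z v := by
  have h1 := hasDerivAt_sq_line z v
  have h2 : HasDerivAt y y' (sq (z + (0 : ℝ) • v)) := by simpa using hy
  have := HasDerivAt.scomp (0 : ℝ) h2 h1
  refine HasDerivAt.congr_deriv this ?_
  rw [Complex.real_smul]; push_cast; ring

theorem hasLineDerivAt_lin_pow (κ z v : ℂ) (k : ℕ) :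
    HasLineDerivAt ℝ (fun z => lin κ z ^ (k + 1)) ((k + 1) * lin κ z ^ k * lin κ v) z v := by
  have h : HasDerivAt (fun t : ℝ => lin κ (z + t • v)) (lin κ v) 0 := by
    have : (fun t : ℝ => lin κ (z + t • v)) = fun t : ℝ => lin κ z + (t : ℂ) * lin κ v := by
      funext t; simp [lin]; ring
    rw [this]
    have h0 : HasDerivAt (fun t : ℝ => (t : ℂ)) 1 0 := Complex.ofRealCLM.hasDerivAt
    simpa using (h0.mul_const (lin κ v)).const_add (lin κ z)
  have := h.pow (k + 1)
  simpa [HasLineDerivAt] using! this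

theorem hasLineDerivAt_mul {f g : ℂ → ℂ} {f' g' z v : ℂ} (hf : HasLineDerivAt ℝ f f' z v)
    (hg : HasLineDerivAt ℝ g g' z v) :
    HasLineDerivAt ℝ (fun z => f z * g z) (f' * g z + f z * g') z v := by
  have := HasDerivAt.mul hf hg
  simpa [HasLineDerivAt] using! this

theorem hasLineDerivAt_add {f g : ℂ → ℂ} {f' g' z v : ℂ} (hf : HasLineDerivAt ℝ f f' z v)
    (hg : HasLineDerivAt ℝ g g' z v) :
    HasLineDerivAt ℝ (fun z => f z + g z) (f' + g') z v := HasDerivAt.add hf hg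

theorem hasLineDerivAt_sub {f g : ℂ → ℂ} {f' g' z v : ℂ} (hf : HasLineDerivAt ℝ f f' z v)
    (hg : HasLineDerivAt ℝ g g' z v) :
    HasLineDerivAt ℝ (fun z => f z - g z) (f' - g') z v := HasDerivAt.sub hf hg

theorem hasLineDerivAt_const_mul {f : ℂ → ℂ} {f' z v : ℂ} (c : ℂ)
    (hf : HasLineDerivAt ℝ f f' z v) :
    HasLineDerivAt ℝ (fun z => c * f z) (c * f') z v := HasDerivAt.const_mul c hf

/-- The function `y(|z|²) (x + κ y)^k`. -/
def modeFun (κ : ℂ) (k : ℕ) (y : ℝ → ℂ) (z : ℂ) : ℂ := y (sq z) * lin κ z ^ k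

/-- The derivative of `modeFun κ (n+2) y` in the direction `v`. -/
def modeD1 (κ : ℂ) (n : ℕ) (y y1 : ℝ → ℂ) (v z : ℂ) : ℂ :=
  2 * ((ip z v : ℂ) * modeFun κ (n + 2) y1 z) + (n + 2) * lin κ v * modeFun κ (n + 1) y z

/-- The second derivative of `modeFun κ (n+2) y` in the direction `v`. -/
def modeD2 (κ : ℂ) (n : ℕ) (y y1 y2 : ℝ → ℂ) (v z : ℂ) : ℂ :=
  4 * (ip z v : ℂ) ^ 2 * modeFun κ (n + 2) y2 z + 2 * sq v * modeFun κ (n + 2) y1 z +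
    4 * (n + 2) * ip z v * lin κ v * modeFun κ (n + 1) y1 z +
    (n + 2) * (n + 1) * lin κ v ^ 2 * modeFun κ n y z

theorem hasLineDerivAt_modeFun (κ : ℂ) (k : ℕ) {y : ℝ → ℂ} {y' z : ℂ} (v : ℂ)
    (hy : HasDerivAt y y' (sq z)) :
    HasLineDerivAt ℝ (modeFun κ (k + 1) y)
      (2 * ip z v * y' * lin κ z ^ (k + 1) + (k + 1) * lin κ v * modeFun κ k y z) z v := by
  have := hasLineDerivAt_mul (hasLineDerivAt_comp_sq v hy) (hasLineDerivAt_lin_pow κ z v k)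
  have h2 : modeFun κ (k + 1) y = fun z => y (sq z) * lin κ z ^ (k + 1) := rfl
  rw [h2]
  convert this using 1
  rw [modeFun]; ring

theorem hasLineDerivAt_modeD0 (κ : ℂ) (n : ℕ) {y y1 : ℝ → ℂ} {z : ℂ} (v : ℂ)
    (hy : HasDerivAt y (y1 (sq z)) (sq z)) :
    HasLineDerivAt ℝ (modeFun κ (n + 2) y) (modeD1 κ n y y1 v z) z v := by
  convert hasLineDerivAt_modeFun κ (n + 1) v hy using 1
  simp only [modeD1, modeFun]
  push_cast; ring

theorem hasLineDerivAt_modeD1 (κ : ℂ) (n : ℕ) {y y1 y2 : ℝ → ℂ} {z : ℂ} (v : ℂ)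
    (hy : HasDerivAt y (y1 (sq z)) (sq z)) (hy1 : HasDerivAt y1 (y2 (sq z)) (sq z)) :
    HasLineDerivAt ℝ (modeD1 κ n y y1 v) (modeD2 κ n y y1 y2 v z) z v := by
  have h1 := hasLineDerivAt_const_mul 2
    (hasLineDerivAt_mul (hasLineDerivAt_ip z v) (hasLineDerivAt_modeFun κ (n + 1) v hy1))
  have h2 := hasLineDerivAt_const_mul ((n + 2) * lin κ v) (hasLineDerivAt_modeFun κ n v hy)
  have h3 := hasLineDerivAt_add h1 h2
  have h4 : modeD1 κ n y y1 v = fun z => 2 * ((ip z v : ℂ) * modeFun κ (n + 1 + 1) y1 z) +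
    (n + 2) * lin κ v * modeFun κ (n + 1) y z := rfl
  rw [h4]
  convert h3 using 1
  simp only [modeD2, modeFun]
  push_cast; ring

/-- As κ² = -1, the powers of x + κy are harmonic. Euler's identity for the cross term contributes n
+ 2 to the coefficient n + 3, and the Laplacian of |z|² the remaining 1. -/
theorem modeD2_add {κ : ℂ} (hκ : κ ^ 2 = -1) (n : ℕ) (y y1 y2 : ℝ → ℂ) (z : ℂ) :
    modeD2 κ n y y1 y2 1 z + modeD2 κ n y y1 y2 Complex.I z =
      4 * (sq z * y2 (sq z) + (n + 3) * y1 (sq z)) * lin κ z ^ (n + 2) := by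
  have e1 : ip z 1 = z.re := by simp [ip]
  have e2 : ip z Complex.I = z.im := by simp [ip]
  have e3 : lin κ 1 = 1 := by simp [lin]
  have e4 : lin κ Complex.I = κ := by simp [lin]
  have e5 : sq 1 = 1 := by simp [sq]
  have e6 : sq Complex.I = 1 := by simp [sq]
  simp only [modeD2, modeFun, e1, e2, e3, e4, e5, e6]
  have e7 : lin κ z = z.re + κ * z.im := rfl
  have e8 : (sq z : ℂ) = z.re ^ 2 + z.im ^ 2 := by rw [sq]; push_cast; ring
  rw [e8, pow_succ (lin κ z) (n + 1)]
  push_cast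
  generalize lin κ z ^ n = p at *
  generalize lin κ z ^ (n + 1) = q at *
  rw [e7]
  linear_combination ((n + 2) * (n + 1) * y (sq z) * p) * hκ

/-! ### The Laplacian in terms of directional derivatives -/

theorem hasLineDerivAt_fderiv {φ : ℂ → ℂ} (hφ : ContDiff ℝ 2 φ) (v z : ℂ) :
    HasLineDerivAt ℝ (fun z => fderiv ℝ φ z v) (fderiv ℝ (fderiv ℝ φ) z v v) z v := by
  have h1 : DifferentiableAt ℝ (fderiv ℝ φ) z :=
    ((hφ.fderiv_right (m := 1) (by norm_num)).differentiable (by norm_num)) z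
  exact (h1.hasFDerivAt.clm_apply (hasFDerivAt_const v z)).hasLineDerivAt v |>.congr_deriv (by simp)

theorem laplacian_eq_fderiv (φ : ℂ → ℂ) (z : ℂ) :
    Laplacian.laplacian φ z = fderiv ℝ (fderiv ℝ φ) z 1 1 +
      fderiv ℝ (fderiv ℝ φ) z Complex.I Complex.I := by
  rw [InnerProductSpace.laplacian_eq_iteratedFDeriv_complexPlane]
  simp [iteratedFDeriv_two_apply]

theorem laplacian_eq_of_hasLineDerivAt {φ : ℂ → ℂ} (hφ : ContDiff ℝ 2 φ) {d1 d2 : ℂ → ℂ → ℂ}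
    (h1 : ∀ v z, HasLineDerivAt ℝ φ (d1 v z) z v)
    (h2 : ∀ v z, HasLineDerivAt ℝ (d1 v) (d2 v z) z v) (z : ℂ) :
    Laplacian.laplacian φ z = d2 1 z + d2 Complex.I z := by
  have key : ∀ v, fderiv ℝ (fderiv ℝ φ) z v v = d2 v z := fun v => by
    have e : (fun z => fderiv ℝ φ z v) = d1 v := funext fun w =>
      (((hφ.differentiable (by norm_num)) w).hasFDerivAt.hasLineDerivAt v).unique (h1 v w)
    have h3 := hasLineDerivAt_fderiv hφ v z
    rw [e] at h3
    exact h3.unique (h2 v z)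
  rw [laplacian_eq_fderiv, key, key]

theorem laplacian_modeFun {κ : ℂ} (hκ : κ ^ 2 = -1) (n : ℕ) {y y1 y2 : ℝ → ℂ}
    (hy : ContDiff ℝ 2 y) (h1 : ∀ s, HasDerivAt y (y1 s) s) (h2 : ∀ s, HasDerivAt y1 (y2 s) s)
    (z : ℂ) :
    Laplacian.laplacian (modeFun κ (n + 2) y) z =
      4 * (sq z * y2 (sq z) + (n + 3) * y1 (sq z)) * lin κ z ^ (n + 2) := by
  rw [← modeD2_add hκ n y]
  refine laplacian_eq_of_hasLineDerivAt (d1 := modeD1 κ n y y1) (d2 := modeD2 κ n y y1 y2)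
    ((hy.comp contDiff_sq).mul ((contDiff_lin κ).pow _))
    (fun v z => hasLineDerivAt_modeD0 κ n v (h1 _))
    (fun v z => hasLineDerivAt_modeD1 κ n v (h1 _) (h2 _)) z

/-! ### Green's identity across a circle -/

theorem integral_eq_zero_of_hasDerivAt_off_countable {f f' : ℝ → ℂ} {s : Set ℝ}
    (hs : s.Countable) (hc : Continuous f) (hsupp : HasCompactSupport f)
    (hd : ∀ x ∉ s, HasDerivAt f (f' x) x) (hi : Integrable f') : ∫ x, f' x = 0 := by
  have h1 : ∀ a : ℝ, ∫ x in -a..a, f' x = f a - f (-a) := fun a =>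
    MeasureTheory.integral_eq_of_hasDerivAt_off_countable f f' hs hc.continuousOn
      (fun x hx => hd x hx.2) hi.intervalIntegrable
  have h2 := intervalIntegral_tendsto_integral hi tendsto_neg_atTop_atBot tendsto_id
  have hb := hsupp.is_zero_at_infty
  rw [cocompact_eq_atBot_atTop] at hb
  have h3 : Tendsto (fun a : ℝ => f a - f (-a)) atTop (𝓝 (0 - 0)) :=
    (hb.mono_left le_sup_right).sub ((hb.mono_left le_sup_left).comp tendsto_neg_atTop_atBot)
  rw [sub_zero] at h3
  refine tendsto_nhds_unique h2 ?_
  simpa [h1] using h3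

/-- Fubini reduces the claim to horizontal lines. Each meets the circle in at most two points, and
the fundamental theorem of calculus tolerates such exceptions for a continuous primitive. -/
theorem integral_lineDeriv_one_eq_zero {G G' : ℂ → ℂ} (R : ℝ) (hc : Continuous G)
    (hsupp : HasCompactSupport G) (hi : Integrable G')
    (hd : ∀ z, sq z ≠ R → HasLineDerivAt ℝ G (G' z) z 1) : ∫ z, G' z = 0 := by
  have hmp := Complex.volume_preserving_equiv_real_prod.symm
  rw [← hmp.integral_comp' (g := G')]
  have hi' : Integrable (fun p : ℝ × ℝ => G' (Complex.measurableEquivRealProd.symm p)) :=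
    (hmp.integrable_comp_emb (MeasurableEquiv.measurableEmbedding _)).2 hi
  rw [Measure.volume_eq_prod] at hi' ⊢
  rw [integral_prod_symm _ hi']
  refine integral_eq_zero_of_ae ?_
  filter_upwards [hi'.prod_left_ae] with y hy
  have hcount : ({x : ℝ | x * x + y * y = R}).Countable := by
    refine Set.Finite.countable (Set.Finite.subset
      (Set.toFinite {√(R - y * y), -√(R - y * y)}) fun x hx => ?_)
    have hx' : x * x = R - y * y := by
      have : x * x + y * y = R := hx
      linarith
    have h2 : |x| = √(R - y * y) := by rw [← hx', Real.sqrt_mul_self_eq_abs]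
    simp only [Set.mem_insert_iff, Set.mem_singleton_iff]
    rw [← h2]
    rcases abs_choice x with h | h
    · left; exact h.symm
    · right; rw [h]; ring
  have hemb : Topology.IsClosedEmbedding fun x : ℝ => (⟨x, y⟩ : ℂ) := by
    have h1 : Topology.IsClosedEmbedding fun x : ℝ => (x, y) :=
      Topology.IsClosedEmbedding.of_continuous_injective_isClosedMap (by fun_prop)
        (fun a b h => by simpa using h)
        (fun s hs => by
          have : (fun x : ℝ => (x, y)) '' s = s ×ˢ {y} := by ext ⟨a, b⟩; simp [and_comm, eq_comm]
          rw [this]; exact hs.prod isClosed_singleton)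
    exact Complex.equivRealProdCLM.symm.toHomeomorph.isClosedEmbedding.comp h1
  refine integral_eq_zero_of_hasDerivAt_off_countable (f := fun x : ℝ => G ⟨x, y⟩) hcount
    (hc.comp hemb.continuous) (hsupp.comp_isClosedEmbedding hemb) (fun x hx => ?_) hy
  have h1 : HasDerivAt (fun t : ℝ => G (⟨x, y⟩ + t • 1)) (G' ⟨x, y⟩) 0 := hd ⟨x, y⟩ hx
  have h2 := HasDerivAt.comp_sub_const (𝕜 := ℝ) x x (by rwa [sub_self])
    (f := fun t : ℝ => G (⟨x, y⟩ + t • 1)) (f' := G' ⟨x, y⟩)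
  have e : (fun x : ℝ => G ⟨x, y⟩) = fun w => G (⟨x, y⟩ + (w - x) • 1) := by
    funext w
    congr 1
    apply Complex.ext <;> simp
  rw [e]
  exact h2

/-- A quarter turn preserves measure and circle and carries the direction 1 to I. -/
theorem integral_lineDeriv_I_eq_zero {G G' : ℂ → ℂ} (R : ℝ) (hc : Continuous G)
    (hsupp : HasCompactSupport G) (hi : Integrable G')
    (hd : ∀ z, sq z ≠ R → HasLineDerivAt ℝ G (G' z) z Complex.I) : ∫ z, G' z = 0 := by
  let ρ : ℂ ≃ₗᵢ[ℝ] ℂ := rotation ⟨Complex.I, by simp [Submonoid.unitSphere]⟩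
  have hρ : ∀ z, ρ z = Complex.I * z := fun z => rfl
  have hmp := ρ.measurePreserving
  have he : MeasurableEmbedding ρ := ρ.toHomeomorph.measurableEmbedding
  rw [← hmp.integral_comp he]
  refine integral_lineDeriv_one_eq_zero (G := fun z => G (ρ z)) R (hc.comp ρ.continuous)
    (hsupp.comp_homeomorph ρ.toHomeomorph) ((hmp.integrable_comp_emb he).2 hi) fun z hz => ?_
  have h1 := hd (ρ z) (by rw [hρ]; simpa [sq, add_comm] using hz)
  unfold HasLineDerivAt at h1 ⊢
  convert h1 using 2
  simp only [hρ]
  congr 1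
  simp [mul_add, mul_comm]

theorem integrable_mul_of_hasCompactSupport {f g : ℂ → ℂ} (hf : Continuous f)
    (hs : HasCompactSupport f) (hg : Measurable g)
    (hb : ∀ K : Set ℂ, IsCompact K → ∃ C : ℝ, ∀ z ∈ K, ‖g z‖ ≤ C) :
    Integrable fun z => f z * g z := by
  obtain ⟨C, hC⟩ := hb _ hs
  refine Integrable.mono' ((hf.integrable_of_hasCompactSupport hs).norm.mul_const C)
    (hf.aestronglyMeasurable.mul hg.aestronglyMeasurable) (Eventually.of_forall fun z => ?_)
  rw [norm_mul]
  by_cases hz : z ∈ tsupport f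
  · exact mul_le_mul_of_nonneg_left (hC z hz) (norm_nonneg _)
  · simp [image_eq_zero_of_notMem_tsupport hz]

/-- The fields u ∂_v φ - φ ∂_v u are continuous across the circle because y is C¹, so a jump of the
second derivative at s = R leaves no boundary term. -/
theorem integral_modeFun_laplacian {n : ℕ} {κ : ℂ} (hκ : κ ^ 2 = -1) {y y1 y2 : ℝ → ℂ} {R : ℝ}
    (hy : ∀ s, HasDerivAt y (y1 s) s) (hy1 : Continuous y1)
    (hy1' : ∀ s, s ≠ R → HasDerivAt y1 (y2 s) s) (hy2 : Measurable y2)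
    (hy2b : ∀ K : Set ℝ, IsCompact K → ∃ C : ℝ, ∀ s ∈ K, ‖y2 s‖ ≤ C)
    {φ : ℂ → ℂ} (hφ : IsTestFunction φ) :
    ∫ z, (modeFun κ (n + 2) y z * Laplacian.laplacian φ z -
      φ z * (4 * (sq z * y2 (sq z) + (n + 3) * y1 (sq z)) * lin κ z ^ (n + 2))) = 0 := by
  have hφ2 : ContDiff ℝ 2 φ := contDiff_infty.1 hφ.1 2
  have hyc : Continuous y := continuous_iff_continuousAt.2 fun s => (hy s).continuousAt
  have hmc : ∀ (k : ℕ) (w : ℝ → ℂ), Continuous w → Continuous (modeFun κ k w) := fun k w hw => by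
    unfold modeFun; fun_prop
  set u := modeFun κ (n + 2) y with hu
  have huc : Continuous u := hmc _ _ hyc
  have hD1c : ∀ v, Continuous (modeD1 κ n y y1 v) := fun v => by
    have h1 := hmc (n + 2) y1 hy1
    have h2 := hmc (n + 1) y hyc
    unfold modeD1; fun_prop
  have hdφ : ContDiff ℝ 1 (fderiv ℝ φ) := hφ2.fderiv_right (by norm_num)
  have hddφ : Continuous (fderiv ℝ (fderiv ℝ φ)) := hdφ.continuous_fderiv (by norm_num)
  have hsd : HasCompactSupport (fderiv ℝ φ) := hφ.2.fderiv (𝕜 := ℝ)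
  have hsdd : HasCompactSupport (fderiv ℝ (fderiv ℝ φ)) := hsd.fderiv (𝕜 := ℝ)
  set G : ℂ → ℂ → ℂ := fun v z => u z * fderiv ℝ φ z v - φ z * modeD1 κ n y y1 v z with hG
  set G' : ℂ → ℂ → ℂ := fun v z => u z * fderiv ℝ (fderiv ℝ φ) z v v -
    φ z * modeD2 κ n y y1 y2 v z with hG'
  have hGc : ∀ v, Continuous (G v) := fun v =>
    (huc.mul (hdφ.continuous.clm_apply continuous_const)).sub (hφ.1.continuous.mul (hD1c v))
  have hGs : ∀ v, HasCompactSupport (G v) := fun v => by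
    have h1 : HasCompactSupport fun z => fderiv ℝ φ z v :=
      hsd.comp_left (g := fun T : ℂ →L[ℝ] ℂ => T v) rfl
    exact (h1.mul_left (f := u)).sub (hφ.2.mul_right (f' := modeD1 κ n y y1 v))
  have hGi : ∀ v, Integrable (G' v) := fun v => by
    have h1 : HasCompactSupport fun z => fderiv ℝ (fderiv ℝ φ) z v v :=
      hsdd.comp_left (g := fun T : ℂ →L[ℝ] ℂ →L[ℝ] ℂ => T v v) rfl
    have h2 : Integrable fun z => u z * fderiv ℝ (fderiv ℝ φ) z v v :=
      (huc.mul ((hddφ.clm_apply continuous_const).clm_apply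
        continuous_const)).integrable_of_hasCompactSupport (h1.mul_left (f := u))
    have h3 : Integrable fun z => φ z * modeD2 κ n y y1 y2 v z := by
      have hm2 := hmc (n + 2) y1 hy1
      have hm1 := hmc (n + 1) y1 hy1
      have hm0 := hmc n y hyc
      refine integrable_mul_of_hasCompactSupport hφ.1.continuous hφ.2 ?_ fun K hK => ?_
      · have hm : Measurable (modeFun κ (n + 2) y2) := by
          unfold modeFun
          exact (hy2.comp continuous_sq.measurable).mul
            ((continuous_lin κ).pow _).measurable
        unfold modeD2
        have := (continuous_ip v).measurable
        have := hm2.measurable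
        have := hm1.measurable
        have := hm0.measurable
        fun_prop
      · obtain ⟨C1, hC1⟩ := hy2b _ (hK.image continuous_sq)
        have hc1 : Continuous fun z => 4 * (ip z v : ℂ) ^ 2 * lin κ z ^ (n + 2) := by fun_prop
        obtain ⟨C2, hC2⟩ := hK.exists_bound_of_continuousOn hc1.continuousOn
        have hc2 : Continuous fun z => 2 * sq v * modeFun κ (n + 2) y1 z +
            4 * (n + 2) * ip z v * lin κ v * modeFun κ (n + 1) y1 z +
            (n + 2) * (n + 1) * lin κ v ^ 2 * modeFun κ n y z := by fun_prop
        obtain ⟨C3, hC3⟩ := hK.exists_bound_of_continuousOn hc2.continuousOn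
        refine ⟨C2 * C1 + C3, fun z hz => ?_⟩
        have e : modeD2 κ n y y1 y2 v z = (4 * (ip z v : ℂ) ^ 2 * lin κ z ^ (n + 2)) * y2 (sq z) +
          (2 * sq v * modeFun κ (n + 2) y1 z +
            4 * (n + 2) * ip z v * lin κ v * modeFun κ (n + 1) y1 z +
            (n + 2) * (n + 1) * lin κ v ^ 2 * modeFun κ n y z) := by
          simp only [modeD2, modeFun]; ring
        rw [e]
        refine (norm_add_le _ _).trans (add_le_add ?_ (hC3 z hz))
        rw [norm_mul]
        exact mul_le_mul (hC2 z hz) (hC1 _ ⟨z, hz, rfl⟩) (norm_nonneg _)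
          ((norm_nonneg _).trans (hC2 z hz))
    exact h2.sub h3
  have hGd : ∀ v z, sq z ≠ R → HasLineDerivAt ℝ (G v) (G' v z) z v := fun v z hz => by
    have h1 := hasLineDerivAt_mul (hasLineDerivAt_modeD0 κ n v (hy (sq z)))
      (hasLineDerivAt_fderiv hφ2 v z)
    have h2 := hasLineDerivAt_mul
      (((hφ2.differentiable (by norm_num)) z).hasFDerivAt.hasLineDerivAt v)
      (hasLineDerivAt_modeD1 κ n v (hy (sq z)) (hy1' (sq z) hz))
    refine (hasLineDerivAt_sub h1 h2).congr_deriv ?_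
    simp only [hG', hu]; ring
  have e1 := integral_lineDeriv_one_eq_zero R (hGc 1) (hGs 1) (hGi 1) (hGd 1)
  have e2 := integral_lineDeriv_I_eq_zero R (hGc Complex.I) (hGs Complex.I) (hGi Complex.I)
    (hGd Complex.I)
  have e3 : ∫ z, (G' 1 z + G' Complex.I z) = 0 := by
    rw [integral_add (hGi 1) (hGi Complex.I), e1, e2, add_zero]
  rw [← e3]
  refine integral_congr_ae (Eventually.of_forall fun z => ?_)
  simp only [hG']
  rw [laplacian_eq_fderiv, ← modeD2_add hκ n y]
  ring

/-! ### Gluing -/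

theorem hasDerivAt_ite {f g : ℝ → ℂ} {f' g' : ℝ → ℂ} {R : ℝ} (hf : ∀ s ≤ R, HasDerivAt f (f' s) s)
    (hg : ∀ s, R ≤ s → HasDerivAt g (g' s) s) (h : f R = g R) (h' : f' R = g' R) (s : ℝ) :
    HasDerivAt (fun s => if s ≤ R then f s else g s) (if s ≤ R then f' s else g' s) s := by
  rcases lt_trichotomy s R with hs | rfl | hs
  · rw [if_pos hs.le]
    refine (hf s hs.le).congr_of_eventuallyEq ?_
    filter_upwards [eventually_lt_nhds hs] with x hx using if_pos hx.le
  · rw [if_pos le_rfl]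
    have h1 : HasDerivWithinAt (fun x => if x ≤ s then f x else g x) (f' s) (Set.Iic s) s :=
      (hf s le_rfl).hasDerivWithinAt.congr (fun x hx => if_pos hx) (if_pos le_rfl)
    have h2 : HasDerivWithinAt (fun x => if x ≤ s then f x else g x) (f' s) (Set.Ici s) s := by
      rw [h']
      refine (hg s le_rfl).hasDerivWithinAt.congr (fun x hx => ?_) (by rw [if_pos le_rfl, h])
      rcases (Set.mem_Ici.1 hx).eq_or_lt with rfl | hx
      · rw [if_pos le_rfl, h]
      · rw [if_neg hx.not_ge]
    have := h1.union h2
    rwa [Set.Iic_union_Ici, hasDerivWithinAt_univ] at this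
  · rw [if_neg hs.not_ge]
    refine (hg s hs.le).congr_of_eventuallyEq ?_
    filter_upwards [eventually_gt_nhds hs] with x hx using if_neg hx.not_ge

/-- Freezing the outer branch below R makes it globally continuous, although it is controlled only
on [R, ∞). -/
theorem ite_eq_ite_max (f g : ℝ → ℂ) (R : ℝ) :
    (fun s => if s ≤ R then f s else g s) = fun s => if s ≤ R then f s else g (max s R) := by
  funext s
  split_ifs with h
  · rfl
  · rw [max_eq_left (not_le.1 h).le]

theorem continuous_comp_max {g : ℝ → ℂ} {R : ℝ} (hg : ContinuousOn g (Set.Ici R)) :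
    Continuous fun s => g (max s R) :=
  hg.comp_continuous (by fun_prop) fun s => le_max_right s R

theorem continuous_ite_of_eq {f g : ℝ → ℂ} {R : ℝ} (hf : Continuous f)
    (hg : ContinuousOn g (Set.Ici R)) (h : f R = g R) :
    Continuous fun s => if s ≤ R then f s else g s := by
  rw [ite_eq_ite_max]
  exact Continuous.if_le hf (continuous_comp_max hg) continuous_id continuous_const
    fun s hs => by subst hs; simpa using h

theorem measurable_ite_le {f g : ℝ → ℂ} {R : ℝ} (hf : Continuous f)
    (hg : ContinuousOn g (Set.Ici R)) : Measurable fun s => if s ≤ R then f s else g s := by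
  rw [ite_eq_ite_max]
  exact Measurable.ite measurableSet_Iic hf.measurable (continuous_comp_max hg).measurable

theorem exists_bound_ite_le {f g : ℝ → ℂ} {R : ℝ} (hf : Continuous f)
    (hg : ContinuousOn g (Set.Ici R)) {K : Set ℝ} (hK : IsCompact K) :
    ∃ C : ℝ, ∀ s ∈ K, ‖if s ≤ R then f s else g s‖ ≤ C := by
  obtain ⟨C1, hC1⟩ := hK.exists_bound_of_continuousOn hf.continuousOn
  obtain ⟨C2, hC2⟩ := hK.exists_bound_of_continuousOn (continuous_comp_max hg).continuousOn
  refine ⟨max C1 C2, fun s hs => ?_⟩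
  split_ifs with h
  · exact (hC1 s hs).trans (le_max_left _ _)
  · have := hC2 s hs
    rw [max_eq_left (not_le.1 h).le] at this
    exact this.trans (le_max_right _ _)

/-! ### Matched solutions are resonances -/

/-- The outer solution with the radial variable `s = r²`, where `L` is the value of the logarithm
at `s = R` and `q = -λ²/4`. -/
def outM (L q : ℂ) (R : ℝ) (k : ℕ) (s : ℝ) : ℂ :=
  bM k (L + Complex.log ((s / R : ℝ) : ℂ)) (q * s)

theorem hasDerivAt_outM {L q : ℂ} {R : ℝ} (hq : q ≠ 0) (hR : 0 < R) (k : ℕ) {s : ℝ} (hs : 0 < s) :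
    HasDerivAt (outM L q R (k + 1)) (q * outM L q R k s) s := by
  have hsR : ((s / R : ℝ) : ℂ) ∈ Complex.slitPlane := by
    left; rw [Complex.ofReal_re]; positivity
  have hR0 : (R : ℂ) ≠ 0 := by exact_mod_cast hR.ne'
  have hs0 : (s : ℂ) ≠ 0 := by exact_mod_cast hs.ne'
  have e : ∀ x : ℝ, q * x / (q * R) = ((x / R : ℝ) : ℂ) := fun x => by
    push_cast; field_simp
  have h1 : HasDerivAt (fun t : ℂ => L + Complex.log (t / (q * R))) (q * s)⁻¹ (q * s) := by
    have h2 : HasDerivAt (fun t : ℂ => t / (q * R)) (1 / (q * R)) (q * s) :=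
      (hasDerivAt_id _).div_const _
    have h3 := (h2.clog (by rw [e]; exact hsR)).const_add L
    refine h3.congr_deriv ?_
    field_simp
  have h2 := hasDerivAt_bM k h1 (mul_ne_zero hq hs0)
  have h3 : HasDerivAt (fun x : ℝ => q * (x : ℂ)) q s := by
    simpa using (Complex.ofRealCLM.hasDerivAt (x := s)).const_mul q
  have h4 := HasDerivAt.scomp s h2 h3
  simp only [Function.comp_def, e, smul_eq_mul] at h4
  exact h4

theorem continuousOn_outM {L q : ℂ} {R : ℝ} (hR : 0 < R) (k : ℕ) :
    ContinuousOn (outM L q R k) (Set.Ici R) := by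
  have h1 : Continuous (bB (-(k : ℂ))) := continuous_bB _
  have h2 : Continuous (bA k) := continuous_bA _
  have h3 : Continuous (bB k) := continuous_bB _
  have h4 : ContinuousOn (fun s : ℝ => Complex.log ((s / R : ℝ) : ℂ)) (Set.Ici R) := by
    refine ContinuousOn.clog (by fun_prop) fun s hs => ?_
    left; rw [Complex.ofReal_re]
    exact div_pos (hR.trans_le hs) hR
  unfold outM bM
  fun_prop

theorem outM_add_two (L q : ℂ) (R : ℝ) (k : ℕ) (s : ℝ) :
    outM L q R (k + 2) s = q * s * outM L q R k s - (k + 1) * outM L q R (k + 1) s :=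
  bM_add_two k _ _

/-- Passing from radius ρ to r multiplies by a positive number, which adds a real number to the
principal logarithm. The branch fixed at r = ρ is thus valid on the whole ray. -/
theorem hankelOne_mul_radius (m : ℕ) {lam : ℂ} (hlam : lam ≠ 0) {ρ r : ℝ} (hρ : 0 < ρ)
    (hr : 0 < r) :
    hankelOne m (lam * r) = Complex.I / Real.pi * (-1) ^ m * ((lam * r / 2) ^ m)⁻¹ *
      outM (2 * Complex.log (lam * ρ / (2 * Complex.I))) (-lam ^ 2 / 4) (ρ ^ 2) m (r ^ 2) := by
  have hr0 : (r : ℂ) ≠ 0 := by exact_mod_cast hr.ne'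
  have hρ0 : (ρ : ℂ) ≠ 0 := by exact_mod_cast hρ.ne'
  rw [hankelOne_nat m (mul_ne_zero hlam hr0), outM]
  congr 2
  · have h1 : lam * r / (2 * Complex.I) = (r / ρ : ℝ) * (lam * ρ / (2 * Complex.I)) := by
      push_cast; field_simp
    have h2 : lam * ρ / (2 * Complex.I) ≠ 0 :=
      div_ne_zero (mul_ne_zero hlam hρ0) (by simp)
    rw [h1, Complex.log_ofReal_mul (div_pos hr hρ) h2, ← div_pow, ← Complex.ofReal_log (by positivity),
      Real.log_pow]
    push_cast; ring
  · push_cast; ring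

/-- Inner and outer solutions are glued with cross-multiplied coefficients: the values then agree
automatically, and the matching equation is the equality of the derivatives. A single mode of order
n + 2 suffices as outgoing solution. -/
theorem isResonance_of_matching {ρ : ℝ} (hρ : 0 < ρ) (A : ℝ) (n : ℕ) {lam : ℂ} (hlam : lam ≠ 0)
    (hcut : ¬ (lam.re = 0 ∧ lam.im < 0)) {L t τ : ℂ}
    (hL : L = 2 * Complex.log (lam * ρ / (2 * Complex.I))) (ht : t = -lam ^ 2 * ρ ^ 2 / 4)
    (hτ : τ = -(A + lam ^ 2) * ρ ^ 2 / 4)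
    (hmatch : bA (n + 1 : ℕ) τ * bM (n + 2) L t - t * bA (n + 2 : ℕ) τ * bM (n + 1) L t = 0)
    (hM : bM (n + 2) L t ≠ 0) : IsResonance (circularWell ρ A) ρ lam := by
  set R : ℝ := ρ ^ 2 with hR
  have hR0 : 0 < R := by positivity
  have hRc : (R : ℂ) ≠ 0 := by exact_mod_cast hR0.ne'
  set p : ℂ := -(A + lam ^ 2) / 4 with hp
  set q : ℂ := -lam ^ 2 / 4 with hq
  have hq0 : q ≠ 0 := div_ne_zero (neg_ne_zero.2 (pow_ne_zero 2 hlam)) (by norm_num)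
  have hpR : p * R = τ := by rw [hp, hτ, hR]; push_cast; ring
  have hqR : q * R = t := by rw [hq, ht, hR]; push_cast; ring
  set M := bM (n + 2) L t with hMdef
  have hMR : ∀ k, outM L q R k R = bM k L t := fun k => by
    rw [outM, div_self hR0.ne', Complex.ofReal_one, Complex.log_one, add_zero, hqR]
  set β : ℂ := R ^ (n + 2) * bA (n + 2 : ℕ) τ with hβ
  -- the inner and the outer solution with two derivatives
  let a : ℕ → ℝ → ℂ := fun k s => M * (p ^ k * bA (n + 2 + k : ℕ) (p * s))
  have ha : ∀ k s, HasDerivAt (a k) (a (k + 1) s) s := fun k s => by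
    have h1 := hasDerivAt_bA_nat (n + 2 + k) (p * s)
    have h3 : HasDerivAt (fun x : ℝ => p * (x : ℂ)) p s := by
      simpa using (Complex.ofRealCLM.hasDerivAt (x := s)).const_mul p
    refine (((HasDerivAt.scomp s h1 h3).const_mul (p ^ k)).const_mul M).congr_deriv ?_
    simp only [a, smul_eq_mul, pow_succ]
    rw [mul_assoc]
    rfl
  have hac : ∀ k, Continuous (a k) := fun k =>
    continuous_iff_continuousAt.2 fun s => (ha k s).continuousAt
  -- Numerator of the first derivative of the outer branch. By the recurrence its own derivative is
  -- a multiple of the index n + 2 term, so the index n never appears.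
  let N : ℝ → ℂ := fun s => -(n + 2) * outM L q R (n + 2) s + s * (q * outM L q R (n + 1) s)
  let b0 : ℝ → ℂ := fun s => β * (outM L q R (n + 2) s / (s : ℂ) ^ (n + 2))
  let b1 : ℝ → ℂ := fun s => β * (N s / (s : ℂ) ^ (n + 3))
  let b2 : ℝ → ℂ := fun s => β * ((s * (q * outM L q R (n + 2) s) - (n + 3) * N s) /
    (s : ℂ) ^ (n + 4))
  have hpow : ∀ k : ℕ, ∀ s : ℝ, HasDerivAt (fun s : ℝ => (s : ℂ) ^ (k + 1)) ((k + 1) * s ^ k) s :=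
    fun k s => by simpa using! ((Complex.ofRealCLM.hasDerivAt (x := s)).pow (k + 1))
  have hb0 : ∀ s, R ≤ s → HasDerivAt b0 (b1 s) s := fun s hs => by
    have hs0 : 0 < s := hR0.trans_le hs
    have hsc : (s : ℂ) ≠ 0 := by exact_mod_cast hs0.ne'
    have h1 := (((hasDerivAt_outM (L := L) hq0 hR0 (n + 1) hs0).div (hpow (n + 1) s)
      (pow_ne_zero _ hsc)).const_mul β)
    refine h1.congr_deriv ?_
    simp only [b1, N]
    push_cast
    field_simp
    ring
  have hN : ∀ s, 0 < s → HasDerivAt N (q * outM L q R (n + 2) s) s := fun s hs0 => by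
    have h0 : HasDerivAt (fun s : ℝ => (s : ℂ)) 1 s := Complex.ofRealCLM.hasDerivAt
    have h1 := ((hasDerivAt_outM (L := L) hq0 hR0 (n + 1) hs0).const_mul (-((n : ℂ) + 2))).add
      (h0.mul ((hasDerivAt_outM (L := L) hq0 hR0 n hs0).const_mul q))
    refine h1.congr_deriv ?_
    have := outM_add_two L q R n s
    linear_combination (-q) * this
  have hb1 : ∀ s, R ≤ s → HasDerivAt b1 (b2 s) s := fun s hs => by
    have hs0 : 0 < s := hR0.trans_le hs
    have hsc : (s : ℂ) ≠ 0 := by exact_mod_cast hs0.ne'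
    have h1 := ((hN s hs0).div (hpow (n + 2) s) (pow_ne_zero _ hsc)).const_mul β
    refine h1.congr_deriv ?_
    simp only [b2]
    push_cast
    field_simp
    ring
  have hg0 : a 0 R = b0 R := by
    simp only [a, b0, hβ, hMR, add_zero, pow_zero, one_mul, hpR]
    field_simp
    rw [mul_comm]
  have hg1 : a 1 R = b1 R := by
    have h1 := bA_succ_eq n τ
    simp only [a, b1, N, hβ, hMR, hpR, pow_one]
    rw [h1] at hmatch
    rw [eq_comm, ← mul_right_inj' hRc]
    have h2 : (R : ℂ) * (q * bM (n + 1) L t) = t * bM (n + 1) L t := by rw [← hqR]; ring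
    have h3 : (R : ℂ) * (M * (p * bA (n + 2 + 1 : ℕ) τ)) = τ * (M * bA (n + 3 : ℕ) τ) := by
      rw [← hpR]; ring
    rw [h3, h2]
    field_simp
    linear_combination (-(R : ℂ) ^ (n + 3)) * hmatch
  set y : ℝ → ℂ := fun s => if s ≤ R then a 0 s else b0 s with hy
  set y1 : ℝ → ℂ := fun s => if s ≤ R then a 1 s else b1 s with hy1
  set y2 : ℝ → ℂ := fun s => if s ≤ R then a 2 s else b2 s with hy2
  have hb1c : ContinuousOn b1 (Set.Ici R) := fun s hs =>
    (hb1 s hs).continuousAt.continuousWithinAt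
  have hb2c : ContinuousOn b2 (Set.Ici R) := by
    have h1 := continuousOn_outM (L := L) (q := q) hR0 (n + 2)
    have h2 := continuousOn_outM (L := L) (q := q) hR0 (n + 1)
    refine ContinuousOn.mul continuousOn_const (ContinuousOn.div (by fun_prop) (by fun_prop)
      fun s hs => ?_)
    have hs0 : 0 < s := hR0.trans_le hs
    exact pow_ne_zero _ (by exact_mod_cast hs0.ne')
  have hyd : ∀ s, HasDerivAt y (y1 s) s :=
    hasDerivAt_ite (fun s _ => ha 0 s) hb0 hg0 hg1
  have hy1d : ∀ s, s ≠ R → HasDerivAt y1 (y2 s) s := fun s hs => by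
    rcases lt_or_gt_of_ne hs with h | h
    · rw [hy2]; simp only [if_pos h.le]
      refine (ha 1 s).congr_of_eventuallyEq ?_
      filter_upwards [eventually_lt_nhds h] with x hx using if_pos hx.le
    · rw [hy2]; simp only [if_neg h.not_ge]
      refine (hb1 s h.le).congr_of_eventuallyEq ?_
      filter_upwards [eventually_gt_nhds h] with x hx using if_neg hx.not_ge
  have hode : ∀ z : ℂ, 4 * (sq z * y2 (sq z) + (n + 3) * y1 (sq z)) =
      (circularWell ρ A z - lam ^ 2) * y (sq z) := fun z => by
    have hiff : sq z ≤ R ↔ ‖z‖ ≤ ρ := by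
      rw [sq_eq_norm_sq, hR, sq_le_sq₀ (norm_nonneg z) hρ.le]
    simp only [hy, hy1, hy2, circularWell]
    by_cases h : sq z ≤ R
    · rw [if_pos h, if_pos h, if_pos h, if_pos (hiff.1 h)]
      have h1 := bA_succ_eq (n + 1) (p * sq z)
      have h2 : bA (n + 2 : ℕ) (p * sq z) = (n + 3) * bA (n + 3 : ℕ) (p * sq z) +
          p * sq z * bA (n + 4 : ℕ) (p * sq z) := by
        refine h1.trans ?_
        push_cast; ring_nf
      have h3 : ((-A : ℝ) : ℂ) - lam ^ 2 = 4 * p := by rw [hp]; push_cast; ring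
      have e3 : bA ((n + 2 + 1 : ℕ) : ℂ) (p * sq z) = bA (n + 3 : ℕ) (p * sq z) := rfl
      have e4 : bA ((n + 2 + 2 : ℕ) : ℂ) (p * sq z) = bA (n + 4 : ℕ) (p * sq z) := rfl
      simp only [a, pow_zero, pow_one, add_zero, one_mul]
      rw [h3, h2, e3, e4]
      ring
    · rw [if_neg h, if_neg h, if_neg h, if_neg (fun h' => h (hiff.2 h'))]
      have hs0 : 0 < sq z := hR0.trans (not_le.1 h)
      have hsc : (sq z : ℂ) ≠ 0 := by exact_mod_cast hs0.ne'
      have h3 : ((0 : ℝ) : ℂ) - lam ^ 2 = 4 * q := by rw [hq]; push_cast; ring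
      rw [h3]
      simp only [b0, b1, b2]
      field_simp
      ring
  have hyc : Continuous y := continuous_iff_continuousAt.2 fun s => (hyd s).continuousAt
  set u : ℂ → ℂ := modeFun Complex.I (n + 2) y with hu
  have huc : Continuous u := by
    rw [hu]; unfold modeFun; fun_prop
  refine ⟨hcut, u, fun h0 => ?_, ⟨fun K hK => ?_, fun φ hφ => ?_⟩, ?_⟩
  · have h1 : u = 0 := (Continuous.ae_eq_iff_eq volume huc continuous_const).1 h0
    have h2 : ∀ x : ℝ, 0 < x → y (x ^ 2) = 0 := fun x hx => by
      have h3 := congrFun h1 (x : ℂ)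
      simp only [hu, modeFun, lin_I, Pi.zero_apply] at h3
      have h4 : sq (x : ℂ) = x ^ 2 := by simp [sq, pow_two]
      rw [h4] at h3
      exact (mul_eq_zero.1 h3).resolve_right (pow_ne_zero _ (by exact_mod_cast hx.ne'))
    -- The factor z^(n+2) hides y(0) from u; it is recovered as a limit and equals M/(n+2)!, which
    -- is nonzero.
    have h3 : Tendsto (fun x : ℝ => y (x ^ 2)) (𝓝[>] 0) (𝓝 (y 0)) := by
      have : Continuous fun x : ℝ => y (x ^ 2) := by fun_prop
      simpa using (this.tendsto 0).mono_left nhdsWithin_le_nhds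
    have h4 : y 0 = 0 := by
      refine tendsto_nhds_unique h3 (tendsto_const_nhds.congr' ?_)
      filter_upwards [self_mem_nhdsWithin] with x hx using (h2 x hx).symm
    simp only [hy, if_pos hR0.le, a, pow_zero, one_mul, add_zero, Complex.ofReal_zero, mul_zero,
      bA_nat_zero] at h4
    exact mul_ne_zero hM (inv_ne_zero (by exact_mod_cast (n + 2).factorial_ne_zero)) h4
  · obtain ⟨C, hC⟩ := hK.exists_bound_of_continuousOn huc.continuousOn
    have : IsFiniteMeasure (volume.restrict K) := ⟨by simpa using hK.measure_lt_top⟩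
    refine MemLp.of_bound huc.aestronglyMeasurable C ?_
    filter_upwards [ae_restrict_mem hK.measurableSet] with z hz using hC z hz
  · have h1 := integral_modeFun_laplacian (n := n) (κ := Complex.I) Complex.I_sq hyd
      (continuous_ite_of_eq (hac 1) hb1c hg1) hy1d (measurable_ite_le (hac 2) hb2c)
      (fun K hK => exists_bound_ite_le (hac 2) hb2c hK) hφ
    rw [← neg_zero, ← h1, ← integral_neg]
    refine integral_congr_ae (Eventually.of_forall fun z => ?_)
    have h2 := hode z
    simp only at h2 ⊢
    rw [h2]
    simp only [hu, modeFun]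
    ring
  -- This constant inverts the normalization in `hankelOne_mul_radius`.
  · set cf : ℂ := β * (Real.pi / Complex.I * (-1) ^ (n + 2) * (lam / 2) ^ (n + 2)) with hcf
    refine ⟨fun k => if k = ((n + 2 : ℕ) : ℤ) then cf else 0, Eventually.of_forall fun z hz => ?_⟩
    have hz0 : 0 < ‖z‖ := hρ.trans hz
    have hzc : ((‖z‖ : ℝ) : ℂ) ≠ 0 := by exact_mod_cast hz0.ne'
    have hval : u z = cf * outgoingFactor lam ((n + 2 : ℕ) : ℤ) ‖z‖ *
        (z / (‖z‖ : ℂ)) ^ ((n + 2 : ℕ) : ℤ) := by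
      have hs : ¬ sq z ≤ R := by
        rw [sq_eq_norm_sq, hR, not_le]
        exact pow_lt_pow_left₀ hz hρ.le two_ne_zero
      have hpi : (Real.pi : ℂ) ≠ 0 := by exact_mod_cast Real.pi_ne_zero
      have hone : ((-1 : ℂ) ^ (n + 2)) * (-1) ^ (n + 2) = 1 := by rw [← mul_pow]; simp
      rw [outgoingFactor, if_neg hlam, hankelOne_mul_radius (n + 2) hlam hρ hz0, zpow_natCast]
      simp only [hu, modeFun, lin_I, hy, if_neg hs, b0, hcf]
      rw [sq_eq_norm_sq, ← hL, ← hq, ← hR]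
      simp only [div_pow, mul_pow]
      push_cast
      generalize outM L q R (n + 2) (‖z‖ ^ 2) = X
      generalize (-1 : ℂ) ^ (n + 2) = S at *
      have hlam' : lam ^ (n + 2) ≠ 0 := pow_ne_zero _ hlam
      obtain ⟨r, hr⟩ : ∃ r : ℂ, r = ‖z‖ := ⟨_, rfl⟩
      rw [← hr] at hzc ⊢
      field_simp
      rw [show S ^ 2 = 1 by rw [pow_two, hone]]
      ring
    rw [hval]
    convert hasSum_single ((n + 2 : ℕ) : ℤ) (f := fun k : ℤ =>
      (if k = ((n + 2 : ℕ) : ℤ) then cf else 0) * outgoingFactor lam k ‖z‖ *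
        (z / (‖z‖ : ℂ)) ^ k) (fun k hk => by simp only [if_neg hk, zero_mul]) using 1
    simp

/-! ### Existence and asymptotics of the resonance -/

/-- The value `τ` at the threshold. -/
def tauZero (ρ a : ℝ) : ℂ := ((-(a ^ 2 * ρ ^ 2 / 4) : ℝ) : ℂ)

/-- The square root of `-4 t / ρ²` obtained from the branch `log (σ t) + 2 θ i` of the logarithm. -/
def rootLam (ρ σ θ : ℝ) (t : ℂ) : ℂ :=
  2 * Complex.I / ρ * Complex.exp (Complex.log (σ * t) / 2 + θ * Complex.I)

/-- The admissible pairs of a half plane and an angle. -/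
def IsBranch (σ θ : ℝ) : Prop := (σ = 1 ∧ θ = 0) ∨ (σ = -1 ∧ θ = -(Real.pi / 2))

theorem IsBranch.abs_eq_one {σ θ : ℝ} (h : IsBranch σ θ) : |σ| = 1 := by
  rcases h with ⟨rfl, _⟩ | ⟨rfl, _⟩ <;> simp

theorem IsBranch.exp_eq {σ θ : ℝ} (h : IsBranch σ θ) :
    Complex.exp (2 * (θ * Complex.I)) = σ := by
  rcases h with ⟨rfl, rfl⟩ | ⟨rfl, rfl⟩
  · simp
  · rw [show (2 * (((-(Real.pi / 2) : ℝ) : ℂ) * Complex.I)) = -(Real.pi * Complex.I) by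
      push_cast; ring, Complex.exp_neg, Complex.exp_pi_mul_I]
    norm_num

theorem log_im_bounds {σ : ℝ} {t : ℂ} (ht : t ∈ halfPlane σ) :
    |(Complex.log (σ * t)).im| < Real.pi / 2 := by
  rw [Complex.log_im]
  exact Complex.abs_arg_lt_pi_div_two_iff.2 (Or.inl (by simpa [halfPlane] using ht))

theorem rootLam_sq {ρ σ θ : ℝ} (h : IsBranch σ θ) {t : ℂ} (ht : t ∈ halfPlane σ) :
    rootLam ρ σ θ t ^ 2 = -4 * t / ρ ^ 2 := by
  have hσt : (σ : ℂ) * t ≠ 0 := by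
    intro h0
    have := ht
    rw [halfPlane, Set.mem_ofPred_eq, ← Complex.re_ofReal_mul, h0] at this
    simp at this
  have h2 : (σ : ℂ) * σ = 1 := by
    rcases h with ⟨rfl, _⟩ | ⟨rfl, _⟩ <;> simp
  have h3 : Complex.exp (Complex.log (σ * t) / 2 + θ * Complex.I) ^ 2 = t := by
    rw [← Complex.exp_nat_mul]
    rw [show ((2 : ℕ) : ℂ) * (Complex.log (σ * t) / 2 + θ * Complex.I) =
      Complex.log (σ * t) + 2 * (θ * Complex.I) by push_cast; ring, Complex.exp_add,
      Complex.exp_log hσt, h.exp_eq]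
    linear_combination t * h2
  rw [rootLam, mul_pow, h3, div_pow, mul_pow, Complex.I_sq]
  ring

/-- The exponent has imaginary part in (-π/4, π/4) + θ, which lies within (-π, π), so log undoes
exp. Hence the branch `lg` with c = 2θi is the one the Hankel function uses at this λ. -/
theorem rootLam_log {ρ σ θ : ℝ} (hρ : 0 < ρ) (h : IsBranch σ θ) {t : ℂ} (ht : t ∈ halfPlane σ) :
    2 * Complex.log (rootLam ρ σ θ t * ρ / (2 * Complex.I)) = lg σ (2 * (θ * Complex.I)) t := by
  have hρ0 : (ρ : ℂ) ≠ 0 := by exact_mod_cast hρ.ne'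
  have h1 : rootLam ρ σ θ t * ρ / (2 * Complex.I) =
      Complex.exp (Complex.log (σ * t) / 2 + θ * Complex.I) := by
    rw [rootLam]; field_simp
  have hb := abs_lt.1 (log_im_bounds ht)
  have him : (Complex.log (σ * t) / 2 + θ * Complex.I).im = (Complex.log (σ * t)).im / 2 + θ := by
    simp
  have hpi := Real.pi_pos
  rw [h1, Complex.log_exp, lg]
  · ring
  · rw [him]; rcases h with ⟨_, rfl⟩ | ⟨_, rfl⟩ <;> linarith
  · rw [him]; rcases h with ⟨_, rfl⟩ | ⟨_, rfl⟩ <;> linarith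

theorem rootLam_ne_zero {ρ σ θ : ℝ} (hρ : 0 < ρ) (t : ℂ) : rootLam ρ σ θ t ≠ 0 := by
  have hρ0 : (ρ : ℂ) ≠ 0 := by exact_mod_cast hρ.ne'
  exact mul_ne_zero (div_ne_zero (mul_ne_zero two_ne_zero Complex.I_ne_zero) hρ0)
    (Complex.exp_ne_zero _)

theorem exp_half_log_re_pos {σ : ℝ} {t : ℂ} (ht : t ∈ halfPlane σ) :
    0 < (Complex.exp (Complex.log (σ * t) / 2)).re := by
  have hb := abs_lt.1 (log_im_bounds ht)
  have hpi := Real.pi_pos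
  rw [Complex.exp_re]
  refine mul_pos (Real.exp_pos _) (Real.cos_pos_of_mem_Ioo ⟨?_, ?_⟩)
  · simp; linarith
  · simp; linarith

/-- The square root w of σt has positive real part, and λ is a positive multiple of i w for σ = 1
and of w for σ = -1. -/
theorem rootLam_not_mem_cut {ρ σ θ : ℝ} (hρ : 0 < ρ) (h : IsBranch σ θ) {t : ℂ}
    (ht : t ∈ halfPlane σ) :
    ¬ ((rootLam ρ σ θ t).re = 0 ∧ (rootLam ρ σ θ t).im < 0) := by
  have hpos := exp_half_log_re_pos ht
  rintro ⟨h1, h2⟩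
  rw [rootLam, Complex.exp_add] at h1 h2
  set w := Complex.exp (Complex.log (σ * t) / 2)
  rcases h with ⟨rfl, rfl⟩ | ⟨rfl, rfl⟩
  · have e : 2 * Complex.I / ρ * (w * Complex.exp ((0 : ℝ) * Complex.I)) =
        ((2 / ρ : ℝ) : ℂ) * (Complex.I * w) := by
      simp; ring
    rw [e, Complex.im_ofReal_mul] at h2
    simp only [Complex.I_mul_im] at h2
    have : 0 < 2 / ρ * w.re := by positivity
    linarith
  · have e : 2 * Complex.I / ρ * (w * Complex.exp ((-(Real.pi / 2) : ℝ) * Complex.I)) =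
        ((2 / ρ : ℝ) : ℂ) * w := by
      rw [show ((-(Real.pi / 2) : ℝ) : ℂ) * Complex.I = -(Real.pi / 2 * Complex.I) by
        push_cast; ring, Complex.exp_neg, Complex.exp_pi_div_two_mul_I]
      push_cast
      field_simp
    rw [e, Complex.re_ofReal_mul] at h1
    have : 0 < 2 / ρ * w.re := by positivity
    linarith

theorem rootLam_ofReal {ρ σ θ : ℝ} (hρ : 0 < ρ) (h : IsBranch σ θ) {μ : ℝ} (hμ : σ * μ < 0) :
    rootLam ρ σ θ ((-(μ * ρ ^ 2 / 4) : ℝ) : ℂ) = (μ : ℂ) ^ (1 / 2 : ℂ) := by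
  have hρ0 : (ρ : ℂ) ≠ 0 := by exact_mod_cast hρ.ne'
  have hμ0 : μ ≠ 0 := by rintro rfl; simp at hμ
  have habs : |μ| = -(σ * μ) := by rw [← abs_of_neg hμ, abs_mul, h.abs_eq_one, one_mul]
  have hμp : 0 < |μ| := abs_pos.2 hμ0
  have h1 : (σ : ℂ) * ((-(μ * ρ ^ 2 / 4) : ℝ) : ℂ) = ((|μ| * (ρ / 2) ^ 2 : ℝ) : ℂ) := by
    rw [habs]; push_cast; ring
  have h2 : Complex.log (σ * ((-(μ * ρ ^ 2 / 4) : ℝ) : ℂ)) =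
      ((Real.log |μ| + 2 * Real.log (ρ / 2) : ℝ) : ℂ) := by
    rw [h1, ← Complex.ofReal_log (by positivity), Real.log_mul hμp.ne' (by positivity),
      Real.log_pow]
    push_cast; ring_nf
  have h3 : Complex.exp ((Real.log (ρ / 2) : ℝ) : ℂ) = ρ / 2 := by
    rw [← Complex.ofReal_exp, Real.exp_log (by positivity)]; push_cast; ring
  rw [rootLam, h2, show (((Real.log |μ| + 2 * Real.log (ρ / 2) : ℝ) : ℂ) / 2 + θ * Complex.I) =
    (Real.log |μ| : ℂ) / 2 + (Real.log (ρ / 2) : ℂ) + θ * Complex.I by push_cast; ring,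
    Complex.exp_add, Complex.exp_add, h3, Complex.cpow_def_of_ne_zero (by exact_mod_cast hμ0)]
  have h4 : Complex.log μ = (Real.log |μ| : ℂ) + (if μ < 0 then Real.pi * Complex.I else 0) := by
    split_ifs with hneg
    · rw [abs_of_neg hneg, Complex.log]
      rw [Complex.arg_ofReal_of_neg hneg, Complex.norm_real, Real.norm_eq_abs, abs_of_neg hneg]
    · rw [abs_of_nonneg (not_lt.1 hneg), add_zero, Complex.ofReal_log (not_lt.1 hneg)]
  rcases h with ⟨rfl, rfl⟩ | ⟨rfl, rfl⟩
  · have hneg : μ < 0 := by linarith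
    rw [h4, if_pos hneg, show ((Real.log |μ| : ℂ) + Real.pi * Complex.I) * (1 / 2) =
      (Real.log |μ| : ℂ) / 2 + Real.pi / 2 * Complex.I by ring, Complex.exp_add,
      Complex.exp_pi_div_two_mul_I]
    simp only [Complex.ofReal_zero, zero_mul, Complex.exp_zero, mul_one]
    field_simp
  · have hneg : ¬ μ < 0 := by linarith
    rw [h4, if_neg hneg, show ((-(Real.pi / 2) : ℝ) : ℂ) * Complex.I = -(Real.pi / 2 * Complex.I) by
        push_cast; ring, Complex.exp_neg, Complex.exp_pi_div_two_mul_I, add_zero, mul_one_div]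
    field_simp

/-- Difference of squares: the square roots satisfy |w + v| ≥ v = √(σx) because Re w > 0. -/
theorem norm_rootLam_sub_le {ρ σ θ : ℝ} (hρ : 0 < ρ) {t : ℂ}
    (ht : t ∈ halfPlane σ) {x : ℝ} (hx : 0 < σ * x) :
    ‖rootLam ρ σ θ t - rootLam ρ σ θ x‖ ≤ 2 / ρ * (|σ| * ‖t - x‖ / √(σ * x)) := by
  have hxm : (x : ℂ) ∈ halfPlane σ := by simpa [halfPlane] using hx
  have hsq : ∀ {t : ℂ}, t ∈ halfPlane σ → Complex.exp (Complex.log (σ * t) / 2) ^ 2 = σ * t := by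
    intro t ht
    have hσt : (σ : ℂ) * t ≠ 0 := by
      intro h0
      have := ht
      rw [halfPlane, Set.mem_ofPred_eq, ← Complex.re_ofReal_mul, h0] at this
      simp at this
    rw [← Complex.exp_nat_mul, show ((2 : ℕ) : ℂ) * (Complex.log (σ * t) / 2) =
      Complex.log (σ * t) by push_cast; ring, Complex.exp_log hσt]
  set w := Complex.exp (Complex.log (σ * t) / 2) with hw
  set v := Complex.exp (Complex.log (σ * x) / 2) with hv
  have hvr : v = ((√(σ * x) : ℝ) : ℂ) := by
    rw [hv, ← Complex.ofReal_mul, ← Complex.ofReal_log hx.le, Real.sqrt_eq_rpow,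
      Real.rpow_def_of_pos hx, Complex.ofReal_exp]
    congr 1; push_cast; ring
  have hsum : √(σ * x) ≤ ‖w + v‖ := by
    refine le_trans ?_ (Complex.re_le_norm _)
    rw [Complex.add_re, hvr, Complex.ofReal_re]
    linarith [exp_half_log_re_pos ht]
  have hspos : 0 < √(σ * x) := Real.sqrt_pos.2 hx
  have hprod : ‖w - v‖ * ‖w + v‖ = |σ| * ‖t - x‖ := by
    rw [← norm_mul, ← Real.norm_eq_abs, ← Complex.norm_real, ← norm_mul]
    congr 1
    linear_combination (hsq ht) - (hsq hxm)
  have hdiff : ‖w - v‖ ≤ |σ| * ‖t - x‖ / √(σ * x) := by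
    rw [le_div_iff₀ hspos, ← hprod]
    exact mul_le_mul_of_nonneg_left hsum (norm_nonneg _)
  have e : rootLam ρ σ θ t - rootLam ρ σ θ x =
      2 * Complex.I / ρ * Complex.exp (θ * Complex.I) * (w - v) := by
    rw [rootLam, rootLam, Complex.exp_add, Complex.exp_add]; ring
  rw [e, norm_mul, norm_mul, Complex.norm_exp_ofReal_mul_I, norm_div, norm_mul, Complex.norm_I,
    Complex.norm_real, Real.norm_of_nonneg hρ.le]
  simp only [Complex.norm_ofNat, mul_one]
  exact mul_le_mul_of_nonneg_left hdiff (by positivity)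

/-- Taking square roots at a point of size comparable to |ε| divides the error in t by √|ε|; this
turns ε² into |ε|^(3/2). -/
theorem exists_resonance {ρ : ℝ} (hρ : 0 < ρ) (a : ℝ) {n : ℕ}
    (hτ : bA (n + 1 : ℕ) (tauZero ρ a) = 0) {σ θ : ℝ} (h : IsBranch σ θ) :
    ∃ ε₀ > 0, ∃ C : ℝ, ∀ ε : ℝ, σ * ε < 0 → |ε| < ε₀ → ∃ lam : ℂ,
      IsResonance (circularWell ρ (a ^ 2 - ε)) ρ lam ∧
      ‖lam - ((ε * ratio n : ℝ) : ℂ) ^ (1 / 2 : ℂ)‖ ≤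
        C * (‖matchF σ (2 * (θ * Complex.I)) n (tauZero ρ a) ((ε * ρ ^ 2 / 4 : ℝ) : ℂ)
          (approxZero n ((ε * ρ ^ 2 / 4 : ℝ) : ℂ))‖ / √|ε|) := by
  have hσ := h.abs_eq_one
  have hρ0 : (ρ : ℂ) ≠ 0 := by exact_mod_cast hρ.ne'
  have hD : slope n (tauZero ρ a) ≠ 0 := slope_ne_zero hτ
  set c : ℂ := 2 * (θ * Complex.I) with hc
  obtain ⟨δ, hδ, hz⟩ := exists_zero_matchF hσ c hτ hD
  refine ⟨δ / (ρ ^ 2 / 4), by positivity,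
    2 / ρ * (2 / ‖slope n (tauZero ρ a)‖ / √(ratio n * (ρ ^ 2 / 4))), fun ε hε hεδ => ?_⟩
  set e : ℝ := ε * ρ ^ 2 / 4 with he
  have hk : 0 < ρ ^ 2 / 4 := by positivity
  have he' : e = ε * (ρ ^ 2 / 4) := by rw [he]; ring
  have hσe : σ * e < 0 := by rw [he', ← mul_assoc]; exact mul_neg_of_neg_of_pos hε hk
  have heδ : |e| < δ := by
    rw [he', abs_mul, abs_of_pos hk]; exact (lt_div_iff₀ hk).1 hεδ
  obtain ⟨t, ht, hF, hM, hle⟩ := hz e hσe heδ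
  have hsq := rootLam_sq (ρ := ρ) h ht
  refine ⟨rootLam ρ σ θ t, isResonance_of_matching hρ _ n (rootLam_ne_zero hρ t)
    (rootLam_not_mem_cut hρ h ht) (L := lg σ c t) (t := t) (τ := tauZero ρ a + e + t)
    (rootLam_log hρ h ht).symm ?_ ?_ hF hM, ?_⟩
  · rw [hsq]; field_simp
  · rw [hsq, tauZero, he]; push_cast; field_simp; ring
  · have hx : approxZero n e = ((-(ratio n * e) : ℝ) : ℂ) := approxZero_ofReal n e
    have hx' : -(ratio n * e) = -(ε * ratio n * ρ ^ 2 / 4) := by rw [he]; ring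
    have habs : |ε| = -(σ * ε) := by rw [← abs_of_neg hε, abs_mul, hσ, one_mul]
    have hσx : σ * -(ratio n * e) = ratio n * (ρ ^ 2 / 4) * |ε| := by rw [habs, he]; ring
    have hpos : 0 < σ * -(ratio n * e) := by
      rw [hσx]
      have := ratio_pos n
      have : 0 < |ε| := by rw [habs]; linarith
      positivity
    have h1 := norm_rootLam_sub_le (θ := θ) hρ ht hpos
    have h2 : rootLam ρ σ θ ((-(ratio n * e) : ℝ) : ℂ) = ((ε * ratio n : ℝ) : ℂ) ^ (1 / 2 : ℂ) := by
      rw [hx']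
      refine rootLam_ofReal hρ h ?_
      rw [← mul_assoc]
      exact mul_neg_of_neg_of_pos hε (ratio_pos n)
    rw [h2, hσ, one_mul, ← hx, hσx, Real.sqrt_mul (by have := ratio_pos n; positivity)] at h1
    refine h1.trans ?_
    rw [mul_assoc]
    refine mul_le_mul_of_nonneg_left ?_ (by positivity)
    rw [div_mul_div_comm]
    exact div_le_div_of_nonneg_right hle (by positivity)

/-! ### Functions with an angular mode -/

theorem isTestFunction_comp_mul {φ : ℂ → ℂ} (hφ : IsTestFunction φ) (w : Circle) :
    IsTestFunction fun z => φ (w * z) := by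
  have e : (fun z => φ (w * z)) = φ ∘ rotation w := by funext z; simp [rotation_apply]
  rw [e]
  exact ⟨hφ.1.comp (rotation w).contDiff, hφ.2.comp_homeomorph (rotation w).toHomeomorph⟩

theorem integrableOn_of_memLp {ψ : ℂ → ℂ} (hψ : MemLp ψ 2 volume) {K : Set ℂ} (hK : IsCompact K) :
    IntegrableOn ψ K :=
  (hψ.locallyIntegrable (by norm_num)).integrableOn_isCompact hK

/-- The derivative of a test function along the rotation flow. -/
theorem hasDerivAt_rotate {φ : ℂ → ℂ} (hφ : IsTestFunction φ) (z : ℂ) (α : ℝ) :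
    HasDerivAt (fun α : ℝ => φ (Complex.exp (α * Complex.I) * z))
      (fderiv ℝ φ (Complex.exp (α * Complex.I) * z)
        (Complex.I * (Complex.exp (α * Complex.I) * z))) α := by
  have h1 : HasDerivAt (fun α : ℝ => Complex.exp (α * Complex.I) * z)
      (Complex.I * (Complex.exp (α * Complex.I) * z)) α := by
    have h0 : HasDerivAt (fun α : ℝ => (α : ℂ) * Complex.I) Complex.I α := by
      simpa using (Complex.ofRealCLM.hasDerivAt (x := α)).mul_const Complex.I
    refine (h0.cexp.mul_const z).congr_deriv ?_
    ring
  have h2 : DifferentiableAt ℝ φ (Complex.exp (α * Complex.I) * z) :=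
    (hφ.1.differentiable (by simp)) _
  exact h2.hasFDerivAt.comp_hasDerivAt α h1

/-- The left side is constant in α: testing the mode equation against the rotated φ shows that the
integral has logarithmic derivative -iℓ. -/
theorem integral_rotate_of_mode {ℓ : ℤ} {ψ : ℂ → ℂ} (hψ : MemLp ψ 2 volume)
    (hm : HasAngularMode ℓ ψ) {φ : ℂ → ℂ} (hφ : IsTestFunction φ) (α : ℝ) :
    Complex.exp (ℓ * α * Complex.I) * ∫ z, ψ z * φ (Complex.exp (α * Complex.I) * z) =
      ∫ z, ψ z * φ z := by
  obtain ⟨r, hr⟩ := hφ.2.isCompact.isBounded.subset_closedBall (0 : ℂ)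
  have hzero : ∀ z : ℂ, z ∉ Metric.closedBall 0 r → φ z = 0 := fun z hz =>
    image_eq_zero_of_notMem_tsupport fun h => hz (hr h)
  have hnorm : ∀ (β : ℝ) (z : ℂ), ‖Complex.exp (β * Complex.I) * z‖ = ‖z‖ := fun β z => by
    rw [norm_mul, Complex.norm_exp_ofReal_mul_I, one_mul]
  have hzero' : ∀ z : ℂ, z ∉ Metric.closedBall 0 r → fderiv ℝ φ z = 0 := fun z hz =>
    image_eq_zero_of_notMem_tsupport fun h => hz (hr (tsupport_fderiv_subset ℝ h))
  have hdc : Continuous (fderiv ℝ φ) := hφ.1.continuous_fderiv (by simp)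
  obtain ⟨C, hC⟩ := (isCompact_closedBall (0 : ℂ) r).exists_bound_of_continuousOn hdc.continuousOn
  obtain ⟨C', hC'⟩ := (isCompact_closedBall (0 : ℂ) r).exists_bound_of_continuousOn
    hφ.1.continuous.continuousOn
  have hψi : Integrable (Set.indicator (Metric.closedBall (0 : ℂ) r) ψ) :=
    (integrableOn_of_memLp hψ (isCompact_closedBall 0 r)).integrable_indicator
      measurableSet_closedBall
  have hFm : ∀ β : ℝ, AEStronglyMeasurable (fun z => ψ z * φ (Complex.exp (β * Complex.I) * z)) :=
    fun β => hψ.aestronglyMeasurable.mul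
      (hφ.1.continuous.comp (by fun_prop)).aestronglyMeasurable
  have hFi : ∀ β : ℝ, Integrable (fun z => ψ z * φ (Complex.exp (β * Complex.I) * z)) := fun β => by
    refine Integrable.mono' (hψi.norm.mul_const C') (hFm β) (Eventually.of_forall fun z => ?_)
    rw [norm_mul]
    by_cases hz : z ∈ Metric.closedBall (0 : ℂ) r
    · rw [Set.indicator_of_mem hz]
      refine mul_le_mul_of_nonneg_left (hC' _ ?_) (norm_nonneg _)
      rw [mem_closedBall_zero_iff, hnorm]; simpa using hz
    · rw [hzero _ (by rw [mem_closedBall_zero_iff, hnorm]; simpa using hz),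
        Set.indicator_of_notMem hz]
      simp
  have hd : ∀ β : ℝ, HasDerivAt
      (fun β : ℝ => ∫ z, ψ z * φ (Complex.exp (β * Complex.I) * z))
      (∫ z, ψ z * fderiv ℝ φ (Complex.exp (β * Complex.I) * z)
        (Complex.I * (Complex.exp (β * Complex.I) * z))) β := fun β => by
    refine (hasDerivAt_integral_of_dominated_loc_of_deriv_le (s := Set.univ)
      (F := fun (β : ℝ) z => ψ z * φ (Complex.exp (β * Complex.I) * z))
      (F' := fun (β : ℝ) z => ψ z * fderiv ℝ φ (Complex.exp (β * Complex.I) * z)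
        (Complex.I * (Complex.exp (β * Complex.I) * z)))
      (bound := fun z => ‖Set.indicator (Metric.closedBall (0 : ℂ) r) ψ z‖ * (C * r))
      univ_mem (Eventually.of_forall hFm) (hFi β) ?_ (Eventually.of_forall fun z γ _ => ?_)
      (hψi.norm.mul_const _) (Eventually.of_forall fun z γ _ => ?_)).2
    · refine hψ.aestronglyMeasurable.mul (Continuous.aestronglyMeasurable ?_)
      exact (hdc.comp (by fun_prop)).clm_apply (by fun_prop)
    · rw [norm_mul]
      by_cases hz : z ∈ Metric.closedBall (0 : ℂ) r
      · rw [Set.indicator_of_mem hz]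
        refine mul_le_mul_of_nonneg_left ?_ (norm_nonneg _)
        have hzr : ‖z‖ ≤ r := by simpa using hz
        have h1 := hC (Complex.exp (γ * Complex.I) * z)
          (by rw [mem_closedBall_zero_iff, hnorm]; exact hzr)
        refine (ContinuousLinearMap.le_opNorm _ _).trans ?_
        rw [norm_mul, Complex.norm_I, one_mul, hnorm]
        exact mul_le_mul h1 hzr (norm_nonneg _) ((norm_nonneg _).trans h1)
      · rw [hzero' _ (by rw [mem_closedBall_zero_iff, hnorm]; simpa using hz),
          Set.indicator_of_notMem hz]
        simp
    · exact (hasDerivAt_rotate hφ z γ).const_mul (ψ z)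
  have hmode : ∀ β : ℝ, ∫ z, ψ z * fderiv ℝ φ (Complex.exp (β * Complex.I) * z)
        (Complex.I * (Complex.exp (β * Complex.I) * z)) =
      -(ℓ * Complex.I) * ∫ z, ψ z * φ (Complex.exp (β * Complex.I) * z) := fun β => by
    have h1 := hm _ (isTestFunction_comp_mul hφ (Circle.exp β))
    simp only [Circle.coe_exp] at h1
    have h2 : ∀ z, fderiv ℝ (fun z => φ (Complex.exp (β * Complex.I) * z)) z (Complex.I * z) =
        fderiv ℝ φ (Complex.exp (β * Complex.I) * z)
          (Complex.I * (Complex.exp (β * Complex.I) * z)) := fun z => by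
      have h3 : DifferentiableAt ℝ φ (Complex.exp (β * Complex.I) * z) :=
        (hφ.1.differentiable (by simp)) _
      have h4 : HasFDerivAt (fun z : ℂ => Complex.exp (β * Complex.I) * z)
          (Complex.exp (β * Complex.I) • ContinuousLinearMap.id ℝ ℂ) z :=
        (hasFDerivAt_id z).const_mul _
      have h5 := (h3.hasFDerivAt.comp z h4).fderiv
      simp only [Function.comp_def] at h5
      rw [h5]
      simp only [ContinuousLinearMap.comp_apply, _root_.smul_apply,
        ContinuousLinearMap.id_apply, smul_eq_mul]
      congr 1; ring
    simp only [h2] at h1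
    rw [h1, ← integral_const_mul, ← integral_neg]
    refine integral_congr_ae (Eventually.of_forall fun z => ?_)
    simp only; ring
  have hconst : ∀ β : ℝ, HasDerivAt (fun β : ℝ => Complex.exp (ℓ * β * Complex.I) *
      ∫ z, ψ z * φ (Complex.exp (β * Complex.I) * z)) 0 β := fun β => by
    have h0 : HasDerivAt (fun β : ℝ => (ℓ : ℂ) * β * Complex.I) (ℓ * Complex.I) β := by
      simpa using ((Complex.ofRealCLM.hasDerivAt (x := β)).const_mul (ℓ : ℂ)).mul_const Complex.I
    refine (h0.cexp.mul (hd β)).congr_deriv ?_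
    rw [hmode]; ring
  have := is_const_of_deriv_eq_zero (fun β => (hconst β).differentiableAt)
    (fun β => (hconst β).deriv) α 0
  simpa using this

theorem ae_rotate_of_mode {ℓ : ℤ} {ψ : ℂ → ℂ} (hψ : MemLp ψ 2 volume)
    (hm : HasAngularMode ℓ ψ) (α : ℝ) :
    ∀ᵐ z, ψ (Complex.exp (α * Complex.I) * z) = Complex.exp (ℓ * α * Complex.I) * ψ z := by
  set w : Circle := Circle.exp α with hw
  have hwc : (w : ℂ) = Complex.exp (α * Complex.I) := Circle.coe_exp α
  have hrot : ∀ z, rotation w z = Complex.exp (α * Complex.I) * z := fun z => by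
    rw [rotation_apply, hwc]
  have hmp := (rotation w).measurePreserving
  have he : MeasurableEmbedding (rotation w) := (rotation w).toHomeomorph.measurableEmbedding
  have hψr : MemLp (fun z => ψ (Complex.exp (α * Complex.I) * z)) 2 volume := by
    have := hψ.comp_measurePreserving hmp
    simpa [Function.comp_def, hrot] using this
  refine ae_eq_of_integral_contDiff_smul_eq (hψr.locallyIntegrable (by norm_num))
    ((hψ.const_mul _).locallyIntegrable (by norm_num)) fun g hg hgs => ?_
  have hφ : IsTestFunction fun z => (g z : ℂ) :=
    ⟨Complex.ofRealCLM.contDiff.comp hg, hgs.comp_left (g := fun x : ℝ => (x : ℂ)) rfl⟩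
  have hφr := isTestFunction_comp_mul hφ w⁻¹
  have h1 := integral_rotate_of_mode hψ hm hφr α
  have hcancel : ∀ z, (w⁻¹ : Circle) * (Complex.exp (α * Complex.I) * z) = z := fun z => by
    rw [← hwc, ← mul_assoc, ← Circle.coe_mul, inv_mul_cancel, Circle.coe_one, one_mul]
  simp only [hcancel] at h1
  have h2 : ∫ z, ψ z * (g ((w⁻¹ : Circle) * z) : ℂ) =
      ∫ z, ψ (Complex.exp (α * Complex.I) * z) * (g z : ℂ) := by
    rw [← hmp.integral_comp he]
    simp only [hrot, hcancel]
  rw [h2] at h1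
  calc ∫ z, g z • ψ (Complex.exp (α * Complex.I) * z)
      = ∫ z, ψ (Complex.exp (α * Complex.I) * z) * (g z : ℂ) := by
        refine integral_congr_ae (Eventually.of_forall fun z => ?_)
        simp [mul_comm]
    _ = Complex.exp (ℓ * α * Complex.I) * ∫ z, ψ z * (g z : ℂ) := h1.symm
    _ = ∫ z, g z • (Complex.exp (ℓ * α * Complex.I) * ψ z) := by
        rw [← integral_const_mul]
        refine integral_congr_ae (Eventually.of_forall fun z => ?_)
        simp only [Complex.real_smul]; ring

/-- A measurable function that is invariant under every rotation almost everywhere is radial. -/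
theorem exists_radial_of_ae_rotate {ζ : ℂ → ℂ} (hζ : StronglyMeasurable ζ)
    (h : ∀ α : ℝ, ∀ᵐ z, ζ (Complex.exp (α * Complex.I) * z) = ζ z) :
    ∃ g : ℝ → ℂ, ∀ᵐ z, ζ z = g (sq z) := by
  have hms : MeasurableSet {p : ℝ × ℂ | ζ (Complex.exp (p.1 * Complex.I) * p.2) = ζ p.2} := by
    refine measurableSet_eq_fun (hζ.measurable.comp ?_) (hζ.measurable.comp measurable_snd)
    exact Continuous.measurable (by fun_prop)
  -- The exceptional set depends on α. Fubini exchanges the quantifiers, after which ζ(z) equals its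
  -- mean over the circle through z for almost every z.
  have h1 : ∀ᵐ z : ℂ, ∀ᵐ α : ℝ, ζ (Complex.exp (α * Complex.I) * z) = ζ z :=
    (Measure.ae_ae_comm hms).1 (Eventually.of_forall h)
  refine ⟨fun s => (2 * Real.pi : ℂ)⁻¹ *
    ∫ α in (0 : ℝ)..2 * Real.pi, ζ (Complex.exp (α * Complex.I) * (√s : ℝ)), ?_⟩
  filter_upwards [h1] with z hz
  have hper : Function.Periodic (fun α : ℝ => ζ (Complex.exp (α * Complex.I) * (‖z‖ : ℝ)))
      (2 * Real.pi) := fun α => by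
    simp only
    congr 2
    rw [show (((α + 2 * Real.pi : ℝ) : ℂ) * Complex.I) =
      α * Complex.I + 2 * Real.pi * Complex.I by push_cast; ring, Complex.exp_add,
      Complex.exp_two_pi_mul_I, mul_one]
  have h2 : √(sq z) = ‖z‖ := by rw [sq_eq_norm_sq, Real.sqrt_sq (norm_nonneg z)]
  have h3 : ∀ α : ℝ, ζ (Complex.exp (α * Complex.I) * z) =
      ζ (Complex.exp (((α + z.arg : ℝ) : ℂ) * Complex.I) * (‖z‖ : ℝ)) := fun α => by
    congr 1
    conv_lhs => rw [← Complex.norm_mul_exp_arg_mul_I z]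
    push_cast
    rw [add_mul, Complex.exp_add]
    ring
  have h4 : ∫ α in (0 : ℝ)..2 * Real.pi, ζ (Complex.exp (α * Complex.I) * z) =
      ∫ α in (0 : ℝ)..2 * Real.pi, ζ (Complex.exp (α * Complex.I) * (‖z‖ : ℝ)) := by
    simp only [h3]
    rw [intervalIntegral.integral_comp_add_right
      (fun α : ℝ => ζ (Complex.exp (α * Complex.I) * (‖z‖ : ℝ)))]
    have := hper.intervalIntegral_add_eq z.arg 0
    rw [zero_add] at this
    rw [← this]
    congr 1 <;> ring
  have h5 : ∫ α in (0 : ℝ)..2 * Real.pi, ζ (Complex.exp (α * Complex.I) * z) =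
      2 * Real.pi * ζ z := by
    rw [intervalIntegral.integral_congr_ae (g := fun _ => ζ z) (hz.mono fun α hα _ => hα)]
    simp
  have hpi : (Real.pi : ℂ) ≠ 0 := by exact_mod_cast Real.pi_ne_zero
  rw [h2, ← h4, h5]
  field_simp

/-! ### Integrals of radial functions -/

/-- With s = r² one has r dr = ds/2, so area becomes a constant multiple of ds, without weight. -/
theorem integrable_comp_sq_iff {E : Type*} [NormedAddCommGroup E] [NormedSpace ℝ E] (F : ℝ → E) :
    Integrable (fun z : ℂ => F (sq z)) ↔ IntegrableOn F (Set.Ioi 0) := by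
  have h1 := integrable_fun_norm_addHaar (E := ℂ) (μ := volume) (f := fun r => F (r ^ 2))
  rw [Complex.finrank_real_complex] at h1
  simp only [sq_eq_norm_sq]
  rw [h1, ← integrableOn_Ioi_comp_rpow_iff' F (p := 2) two_ne_zero]
  refine integrableOn_congr_fun (fun x _ => ?_) measurableSet_Ioi
  norm_num

theorem integral_comp_sq {E : Type*} [NormedAddCommGroup E] [NormedSpace ℝ E] (F : ℝ → E) :
    ∫ z : ℂ, F (sq z) = (volume.real (Metric.ball (0 : ℂ) 1)) • ∫ s in Set.Ioi 0, F s := by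
  have h1 := integral_fun_norm_addHaar (E := ℂ) volume (fun r => F (r ^ 2))
  rw [Complex.finrank_real_complex] at h1
  simp only [sq_eq_norm_sq]
  rw [h1, ← integral_comp_rpow_Ioi_of_pos (g := F) (p := 2) two_pos]
  have e : ∀ x : ℝ, (2 * x ^ ((2 : ℝ) - 1)) • F (x ^ (2 : ℝ)) =
      (2 : ℝ) • (x ^ (2 - 1) • F (x ^ 2)) := fun x => by
    rw [mul_smul]; norm_num
  simp only [e]
  rw [integral_smul, smul_comm]
  congr 1
  rw [← Nat.cast_smul_eq_nsmul ℝ]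
  norm_num

/-! ### Weak derivatives on the half line -/

/-- Smooth functions with compact support in `(0, ∞)`. -/
def IsHalfLineTest (h : ℝ → ℝ) : Prop :=
  ContDiff ℝ ∞ h ∧ ∃ a > 0, ∃ b, ∀ s ∉ Set.Icc a b, h s = 0

/-- Integrability on `(0, b]` for every `b`. -/
def IntegrableNearZero (f : ℝ → ℂ) : Prop := ∀ b : ℝ, IntegrableOn f (Set.Ioc 0 b)

theorem IsHalfLineTest.deriv {h : ℝ → ℝ} (hh : IsHalfLineTest h) : IsHalfLineTest (deriv h) := by
  obtain ⟨h1, a, ha, b, hb⟩ := hh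
  refine ⟨(contDiff_infty_iff_deriv.1 h1).2, a, ha, b, fun s hs => ?_⟩
  have : h =ᶠ[𝓝 s] fun _ => 0 := by
    filter_upwards [isClosed_Icc.isOpen_compl.mem_nhds hs] with x hx using hb x hx
  rw [this.deriv_eq]; simp

theorem IsHalfLineTest.hasDerivAt {h : ℝ → ℝ} (hh : IsHalfLineTest h) (s : ℝ) :
    HasDerivAt h (_root_.deriv h s) s :=
  ((hh.1.differentiable (by simp)) s).hasDerivAt

theorem IsHalfLineTest.sub_smul {h k : ℝ → ℝ} (hh : IsHalfLineTest h) (hk : IsHalfLineTest k)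
    (c : ℝ) : IsHalfLineTest fun s => h s - c * k s := by
  obtain ⟨h1, a, ha, b, hb⟩ := hh
  obtain ⟨k1, a', ha', b', hb'⟩ := hk
  refine ⟨h1.sub (contDiff_const.mul k1), min a a', lt_min ha ha', max b b', fun s hs => ?_⟩
  simp only
  rw [hb s fun h => hs ⟨(min_le_left _ _).trans h.1, h.2.trans (le_max_left _ _)⟩,
    hb' s fun h => hs ⟨(min_le_right _ _).trans h.1, h.2.trans (le_max_right _ _)⟩]
  ring

theorem integrable_mul_of_halfLineTest {h : ℝ → ℝ} (hh : IsHalfLineTest h) {f : ℝ → ℂ}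
    (hf : IntegrableNearZero f) : Integrable fun s => (h s : ℂ) * f s := by
  obtain ⟨h1, a, ha, b, hb⟩ := hh
  have hsub : Set.Icc a b ⊆ Set.Ioc 0 b := fun s hs => ⟨ha.trans_le hs.1, hs.2⟩
  rw [← integrableOn_iff_integrable_of_support_subset (s := Set.Icc a b)]
  · refine ((hf b).mono_set hsub).continuousOn_mul ?_ isCompact_Icc
    exact (Complex.continuous_ofReal.comp h1.continuous).continuousOn
  · intro s hs
    by_contra hc
    exact hs (by simp [hb s hc])

theorem integrable_of_halfLineTest {h : ℝ → ℝ} (hh : IsHalfLineTest h) : Integrable h := by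
  obtain ⟨h1, a, ha, b, hb⟩ := hh
  refine h1.continuous.integrable_of_hasCompactSupport
    (HasCompactSupport.intro isCompact_Icc hb)

/-- The primitive from 0 vanishes to the left of the support, and to the right because the total
integral is zero. -/
theorem exists_antideriv_halfLineTest {k : ℝ → ℝ} (hk : IsHalfLineTest k) (h0 : ∫ s, k s = 0) :
    ∃ h, IsHalfLineTest h ∧ deriv h = k := by
  obtain ⟨k1, a, ha, b, hb⟩ := hk
  have hd : ∀ s, HasDerivAt (fun s => ∫ t in (0 : ℝ)..s, k t) (k s) s := fun s =>
    k1.continuous.integral_hasStrictDerivAt 0 s |>.hasDerivAt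
  have hde : deriv (fun s => ∫ t in (0 : ℝ)..s, k t) = k := funext fun s => (hd s).deriv
  refine ⟨fun s => ∫ t in (0 : ℝ)..s, k t, ⟨contDiff_infty_iff_deriv.2
    ⟨fun s => (hd s).differentiableAt, by rw [hde]; exact k1⟩, a, ha, b, fun s hs => ?_⟩, hde⟩
  simp only
  rcases lt_or_ge s a with h | h
  · rw [intervalIntegral.integral_congr (g := fun _ => 0), intervalIntegral.integral_zero]
    intro t ht
    refine hb t fun hc => ?_
    have := (Set.mem_uIcc.1 ht)
    rcases this with h' | h' <;> linarith [h'.1, h'.2, hc.1]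
  · have hbs : b < s := not_le.1 fun hc => hs ⟨h, hc⟩
    have hs0 : 0 ≤ s := ha.le.trans h
    rw [intervalIntegral.integral_of_le hs0, setIntegral_eq_integral_of_forall_compl_eq_zero, h0]
    intro t ht
    refine hb t fun hc => ht ⟨ha.trans_le hc.1, hc.2.trans hbs.le⟩

theorem exists_halfLineTest_integral_one : ∃ χ, IsHalfLineTest χ ∧ ∫ s, χ s = 1 := by
  let f : ContDiffBump (1 : ℝ) := ⟨1 / 4, 1 / 2, by norm_num, by norm_num⟩
  refine ⟨f.normed volume, ⟨f.contDiff_normed, 1 / 2, by norm_num, 3 / 2, fun s hs => ?_⟩,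
    f.integral_normed⟩
  by_contra hc
  have h1 : s ∈ Function.support (f.normed volume) := hc
  rw [f.support_normed_eq, Real.ball_eq_Ioo] at h1
  apply hs
  have h2 : f.rOut = 1 / 2 := rfl
  rw [h2] at h1
  exact ⟨by linarith [h1.1], by linarith [h1.2]⟩

theorem isHalfLineTest_of_tsupport {g : ℝ → ℝ} (hg : ContDiff ℝ ∞ g) (hgs : HasCompactSupport g)
    (hsub : tsupport g ⊆ Set.Ioi 0) : IsHalfLineTest g := by
  rcases (tsupport g).eq_empty_or_nonempty with he | hne
  · refine ⟨hg, 1, one_pos, 1, fun s _ => image_eq_zero_of_notMem_tsupport ?_⟩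
    rw [he]; simp
  · obtain ⟨a, ha, hmin⟩ := hgs.isCompact.exists_isLeast hne
    obtain ⟨b, hb, hmax⟩ := hgs.isCompact.exists_isGreatest hne
    exact ⟨hg, a, hsub ha, b, fun s hs => image_eq_zero_of_notMem_tsupport fun h =>
      hs ⟨hmin h, hmax h⟩⟩

theorem IntegrableNearZero.locallyIntegrableOn {f : ℝ → ℂ} (hf : IntegrableNearZero f) :
    LocallyIntegrableOn f (Set.Ioi 0) := fun x _ =>
  ⟨Set.Ioc 0 (x + 1), by
    rw [mem_nhdsWithin_iff_exists_mem_nhds_inter]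
    exact ⟨Set.Iic (x + 1), Iic_mem_nhds (by linarith), fun y hy => ⟨hy.2, hy.1⟩⟩, hf _⟩

theorem integrableNearZero_of_continuousOn {f : ℝ → ℂ} (hf : ContinuousOn f (Set.Ici 0)) :
    IntegrableNearZero f := fun b =>
  ((hf.mono (fun _ hs => hs.1)).integrableOn_compact (isCompact_Icc (a := 0) (b := b))).mono_set
    Set.Ioc_subset_Icc_self

/-- The lemma of du Bois-Reymond. -/
theorem ae_const_of_integral_deriv_mul {f : ℝ → ℂ} (hf : IntegrableNearZero f)
    (h : ∀ k, IsHalfLineTest k → ∫ s, ((deriv k s : ℝ) : ℂ) * f s = 0) :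
    ∃ c : ℂ, ∀ᵐ s, s ∈ Set.Ioi (0 : ℝ) → f s = c := by
  obtain ⟨χ, hχ, hχ1⟩ := exists_halfLineTest_integral_one
  refine ⟨∫ s, (χ s : ℂ) * f s, ?_⟩
  set c := ∫ s, (χ s : ℂ) * f s with hc
  have hcint : IntegrableNearZero fun _ => c := integrableNearZero_of_continuousOn (by fun_prop)
  have key := isOpen_Ioi.ae_eq_zero_of_integral_contDiff_smul_eq_zero (U := Set.Ioi (0 : ℝ))
    (f := fun s => f s - c) (μ := volume)
    (hf.locallyIntegrableOn.sub hcint.locallyIntegrableOn) fun g hg hgs hsub => ?_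
  · filter_upwards [key] with s hs h0 using sub_eq_zero.1 (hs h0)
  · have hgt := isHalfLineTest_of_tsupport hg hgs hsub
    obtain ⟨k, hk, hkd⟩ := exists_antideriv_halfLineTest (hgt.sub_smul hχ (∫ s, g s)) (by
      rw [integral_sub (integrable_of_halfLineTest hgt)
        ((integrable_of_halfLineTest hχ).const_mul _), integral_const_mul, hχ1, mul_one, sub_self])
    have h1 := h k hk
    rw [hkd] at h1
    have e1 : ∀ s, ((g s - (∫ s, g s) * χ s : ℝ) : ℂ) * f s =
        (g s : ℂ) * f s - ((∫ s, g s : ℝ) : ℂ) * ((χ s : ℂ) * f s) := fun s => by push_cast; ring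
    simp only [e1] at h1
    rw [integral_sub (integrable_mul_of_halfLineTest hgt hf)
      ((integrable_mul_of_halfLineTest hχ hf).const_mul _), integral_const_mul, ← hc] at h1
    have e2 : ∀ s, g s • (f s - c) = (g s : ℂ) * f s - (g s : ℂ) * c := fun s => by
      rw [Complex.real_smul]; ring
    simp only [e2]
    rw [integral_sub (integrable_mul_of_halfLineTest hgt hf)
      (integrable_mul_of_halfLineTest hgt hcint), integral_mul_const, integral_complex_ofReal]
    exact h1

/-- Integration by parts for f that is only integrable: Fubini on the triangle t ≤ s. -/
theorem integral_deriv_mul_primitive {f : ℝ → ℂ} (hf : IntegrableNearZero f) {h : ℝ → ℝ}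
    (hh : IsHalfLineTest h) :
    ∫ s, ((deriv h s : ℝ) : ℂ) * ∫ t in (0 : ℝ)..s, f t = -∫ s, (h s : ℂ) * f s := by
  have hhd := hh.deriv
  obtain ⟨h1, a, ha, b₀, hb₀⟩ := id hh
  obtain ⟨b, hbdef, hb0⟩ : ∃ b, b₀ < b ∧ 0 < b :=
    ⟨max b₀ 0 + 1, by linarith [le_max_left b₀ 0], by linarith [le_max_right b₀ 0]⟩
  have hb : ∀ s ∉ Set.Ioc 0 b, h s = 0 := fun s hs => hb₀ s fun hc =>
    hs ⟨ha.trans_le hc.1, hc.2.trans hbdef.le⟩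
  have hdb : ∀ s ∉ Set.Ioc 0 b, deriv h s = 0 := by
    have hfar : ∀ s ∉ Set.Icc a b₀, deriv h s = 0 := fun s hs => by
      have : h =ᶠ[𝓝 s] fun _ => 0 := by
        filter_upwards [isClosed_Icc.isOpen_compl.mem_nhds hs] with x hx using hb₀ x hx
      rw [this.deriv_eq]; simp
    exact fun s hs => hfar s fun hc => hs ⟨ha.trans_le hc.1, hc.2.trans hbdef.le⟩
  have hhb : h b = 0 := hb₀ b fun hc => absurd hc.2 (not_le.2 hbdef)
  set μ := volume.restrict (Set.Ioc 0 b) with hμ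
  have hfi : Integrable f μ := hf b
  have hki : Integrable (fun s => ((deriv h s : ℝ) : ℂ)) μ :=
    ((integrable_of_halfLineTest hhd).ofReal).restrict
  have e1 : ∫ s, ((deriv h s : ℝ) : ℂ) * ∫ t in (0 : ℝ)..s, f t =
      ∫ s, ((deriv h s : ℝ) : ℂ) * (∫ t in (0 : ℝ)..s, f t) ∂μ := by
    rw [hμ, setIntegral_eq_integral_of_forall_compl_eq_zero]
    intro s hs
    rw [hdb s hs]; simp
  have e2 : ∫ s, (h s : ℂ) * f s = ∫ s, (h s : ℂ) * f s ∂μ := by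
    rw [hμ, setIntegral_eq_integral_of_forall_compl_eq_zero]
    intro s hs
    rw [hb s hs]; simp
  have hset : MeasurableSet {p : ℝ × ℝ | p.2 ≤ p.1} := measurableSet_le measurable_snd measurable_fst
  have hprod : Integrable (fun p : ℝ × ℝ => Set.indicator {p : ℝ × ℝ | p.2 ≤ p.1}
      (fun p => ((deriv h p.1 : ℝ) : ℂ) * f p.2) p) (μ.prod μ) :=
    (hki.mul_prod hfi).indicator hset
  have e3 : ∫ s, ((deriv h s : ℝ) : ℂ) * (∫ t in (0 : ℝ)..s, f t) ∂μ =
      ∫ s, ∫ t, Set.indicator {p : ℝ × ℝ | p.2 ≤ p.1}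
        (fun p => ((deriv h p.1 : ℝ) : ℂ) * f p.2) (s, t) ∂μ ∂μ := by
    refine integral_congr_ae ?_
    filter_upwards [ae_restrict_mem measurableSet_Ioc] with s hs
    have : ∀ t, Set.indicator {p : ℝ × ℝ | p.2 ≤ p.1} (fun p => ((deriv h p.1 : ℝ) : ℂ) * f p.2) (s, t) =
        ((deriv h s : ℝ) : ℂ) * Set.indicator (Set.Iic s) f t := fun t => by
      by_cases ht : t ≤ s
      · rw [Set.indicator_of_mem (by exact ht), Set.indicator_of_mem (by exact ht)]
      · rw [Set.indicator_of_notMem (by exact ht), Set.indicator_of_notMem (by exact ht), mul_zero]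
    simp only [this]
    rw [integral_const_mul, integral_indicator measurableSet_Iic, hμ,
      Measure.restrict_restrict measurableSet_Iic, intervalIntegral.integral_of_le hs.1.le]
    congr 3
    ext t
    simp only [Set.mem_Ioc, Set.mem_inter_iff, Set.mem_Iic]
    exact ⟨fun h => ⟨h.2, h.1, h.2.trans hs.2⟩, fun h => ⟨h.2.1, h.1⟩⟩
  rw [e1, e2, e3, integral_integral_swap hprod, ← integral_neg]
  refine integral_congr_ae ?_
  filter_upwards [ae_restrict_mem measurableSet_Ioc] with t ht
  have : ∀ s, Set.indicator {p : ℝ × ℝ | p.2 ≤ p.1} (fun p => ((deriv h p.1 : ℝ) : ℂ) * f p.2) (s, t) =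
      Set.indicator (Set.Ici t) (fun s => ((deriv h s : ℝ) : ℂ)) s * f t := fun s => by
    by_cases hst : t ≤ s
    · rw [Set.indicator_of_mem (by exact hst), Set.indicator_of_mem (by exact hst)]
    · rw [Set.indicator_of_notMem (by exact hst), Set.indicator_of_notMem (by exact hst), zero_mul]
  simp only [this]
  rw [integral_mul_const, integral_indicator measurableSet_Ici, hμ,
    Measure.restrict_restrict measurableSet_Ici]
  have hI : Set.Ici t ∩ Set.Ioc 0 b = Set.Icc t b := by
    ext s
    simp only [Set.mem_Ioc, Set.mem_inter_iff, Set.mem_Ici, Set.mem_Icc]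
    exact ⟨fun h => ⟨h.1, h.2.2⟩, fun h => ⟨h.1, ht.1.trans_le h.1, h.2⟩⟩
  rw [hI, integral_Icc_eq_integral_Ioc, ← intervalIntegral.integral_of_le ht.2,
    intervalIntegral.integral_ofReal,
    intervalIntegral.integral_deriv_eq_sub (fun s _ => (hh.hasDerivAt s).differentiableAt)
      (hhd.1.continuous.intervalIntegrable _ _), hhb]
  push_cast; ring

/-- Functions with vanishing second weak derivative are affine. -/
theorem ae_affine_of_integral_deriv_deriv_mul {f : ℝ → ℂ} (hf : IntegrableNearZero f)
    (h : ∀ k, IsHalfLineTest k → ∫ s, ((deriv (deriv k) s : ℝ) : ℂ) * f s = 0) :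
    ∃ c₀ c₁ : ℂ, ∀ᵐ s, s ∈ Set.Ioi (0 : ℝ) → f s = c₀ + c₁ * s := by
  obtain ⟨χ, hχ, hχ1⟩ := exists_halfLineTest_integral_one
  -- Adding βs to f makes its first weak derivative vanish. Indeed k - (∫k)χ has a test function m
  -- as primitive, and testing f against m'' gives ∫k'f = β∫k, while ∫k's = -∫k.
  set β := ∫ s, ((deriv χ s : ℝ) : ℂ) * f s with hβ
  have hlin : ∀ c : ℂ, IntegrableNearZero fun s : ℝ => c * s := fun c =>
    integrableNearZero_of_continuousOn (by fun_prop)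
  have hone : IntegrableNearZero fun _ : ℝ => (1 : ℂ) :=
    integrableNearZero_of_continuousOn (by fun_prop)
  have hg : IntegrableNearZero fun s : ℝ => f s + β * s := fun b => (hf b).add (hlin β b)
  obtain ⟨c, hc⟩ := ae_const_of_integral_deriv_mul hg fun k hk => by
    obtain ⟨m, hm, hmd⟩ := exists_antideriv_halfLineTest (hk.sub_smul hχ (∫ s, k s)) (by
      rw [integral_sub (integrable_of_halfLineTest hk)
        ((integrable_of_halfLineTest hχ).const_mul _), integral_const_mul, hχ1, mul_one, sub_self])
    have h1 := h m hm
    have e0 : ∀ s, deriv (deriv m) s = deriv k s - (∫ s, k s) * deriv χ s := fun s => by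
      rw [hmd]
      exact ((hk.hasDerivAt s).sub ((hχ.hasDerivAt s).const_mul _)).deriv
    have e1 : ∀ s, ((deriv (deriv m) s : ℝ) : ℂ) * f s =
        ((deriv k s : ℝ) : ℂ) * f s - ((∫ s, k s : ℝ) : ℂ) * (((deriv χ s : ℝ) : ℂ) * f s) := fun s => by
      rw [e0]; push_cast; ring
    simp only [e1] at h1
    rw [integral_sub (integrable_mul_of_halfLineTest hk.deriv hf)
      ((integrable_mul_of_halfLineTest hχ.deriv hf).const_mul _), integral_const_mul, ← hβ] at h1
    have h2 := integral_deriv_mul_primitive hone hk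
    have e2 : ∀ s : ℝ, ∫ t in (0 : ℝ)..s, (1 : ℂ) = s := fun s => by simp
    simp only [e2, mul_one] at h2
    rw [integral_complex_ofReal] at h2
    have e3 : ∀ s : ℝ, ((deriv k s : ℝ) : ℂ) * (f s + β * s) =
        ((deriv k s : ℝ) : ℂ) * f s + β * (((deriv k s : ℝ) : ℂ) * s) := fun s => by ring
    simp only [e3]
    have hid : IntegrableNearZero fun s : ℝ => (s : ℂ) :=
      integrableNearZero_of_continuousOn (by fun_prop)
    rw [integral_add (integrable_mul_of_halfLineTest hk.deriv hf)
      ((integrable_mul_of_halfLineTest hk.deriv hid).const_mul _), integral_const_mul, h2]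
    linear_combination h1
  refine ⟨c, -β, ?_⟩
  filter_upwards [hc] with s hs h0
  linear_combination hs h0

/-! ### The radial equation of a mode -/

theorem lin_neg_I (z : ℂ) : lin (-Complex.I) z = (starRingEnd ℂ) z := by
  apply Complex.ext <;> simp [lin]

/-- The factor (x + κy)^(n+2) cancels the rotation of the mode: κ = -i (the conjugate of z) for ℓ >
0 and κ = i for ℓ < 0. -/
theorem exists_lin_mode {ℓ : ℤ} {n : ℕ} (hℓ : |ℓ| = ((n + 2 : ℕ) : ℤ)) :
    ∃ κ : ℂ, κ ^ 2 = -1 ∧ (∀ z, ‖lin κ z‖ ^ 2 = sq z) ∧ ∀ (α : ℝ) (z : ℂ),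
      Complex.exp (ℓ * α * Complex.I) * lin κ (Complex.exp (α * Complex.I) * z) ^ (n + 2) =
        lin κ z ^ (n + 2) := by
  rcases abs_choice ℓ with h | h
  · have hl : ℓ = ((n + 2 : ℕ) : ℤ) := h.symm.trans hℓ
    refine ⟨-Complex.I, by simp, fun z => ?_, fun α z => ?_⟩
    · rw [lin_neg_I, Complex.norm_conj, sq_eq_norm_sq]
    · have hc : ((ℓ : ℤ) : ℂ) = ((n + 2 : ℕ) : ℂ) := by rw [hl]; norm_cast
      rw [lin_neg_I, lin_neg_I, map_mul, ← Complex.exp_conj, mul_pow, ← Complex.exp_nat_mul,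
        ← mul_assoc, ← Complex.exp_add, hc, map_mul, Complex.conj_ofReal, Complex.conj_I]
      rw [show ((n + 2 : ℕ) : ℂ) * α * Complex.I + ((n + 2 : ℕ) : ℂ) * (α * -Complex.I) = 0 by ring,
        Complex.exp_zero, one_mul]
  · have hl : ℓ = -((n + 2 : ℕ) : ℤ) := by rw [← hℓ, h, neg_neg]
    refine ⟨Complex.I, by simp, fun z => ?_, fun α z => ?_⟩
    · rw [lin_I, sq_eq_norm_sq]
    · have hc : ((ℓ : ℤ) : ℂ) = -((n + 2 : ℕ) : ℂ) := by rw [hl]; norm_cast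
      rw [lin_I, lin_I, mul_pow, ← Complex.exp_nat_mul, ← mul_assoc, ← Complex.exp_add, hc]
      rw [show -((n + 2 : ℕ) : ℂ) * α * Complex.I + ((n + 2 : ℕ) : ℂ) * (α * Complex.I) = 0 by ring,
        Complex.exp_zero, one_mul]

theorem exists_radial_of_mode {ℓ : ℤ} {n : ℕ} {κ : ℂ} {ψ : ℂ → ℂ} (hψ : MemLp ψ 2 volume)
    (hm : HasAngularMode ℓ ψ) (hκ : ∀ (α : ℝ) (z : ℂ),
      Complex.exp (ℓ * α * Complex.I) * lin κ (Complex.exp (α * Complex.I) * z) ^ (n + 2) =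
        lin κ z ^ (n + 2)) :
    ∃ g : ℝ → ℂ, ∀ᵐ z, ψ z * lin κ z ^ (n + 2) = g (sq z) := by
  have hae := hψ.1.ae_eq_mk
  set ψ' := hψ.1.mk ψ with hψ'
  have hsm : StronglyMeasurable fun z => ψ' z * lin κ z ^ (n + 2) :=
    hψ.1.stronglyMeasurable_mk.mul ((continuous_lin κ).pow _).stronglyMeasurable
  obtain ⟨g, hg⟩ := exists_radial_of_ae_rotate hsm fun α => by
    have hmp := (rotation (Circle.exp α)).measurePreserving
    have hrot : ∀ z, rotation (Circle.exp α) z = Complex.exp (α * Complex.I) * z := fun z => by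
      rw [rotation_apply, Circle.coe_exp]
    have h1 := hmp.quasiMeasurePreserving.ae hae
    filter_upwards [h1, hae, ae_rotate_of_mode hψ hm α] with z hz1 hz2 hz3
    rw [hrot] at hz1
    rw [← hz1, ← hz2, hz3, ← hκ α z]
    ring
  refine ⟨g, ?_⟩
  filter_upwards [hg, hae] with z hz1 hz2
  rw [hz2, hz1]

/-- The profile is g(|z|²) = ψ·(x + κy)^(n+2), whence the weight s^(-(n+2)) in |ψ|². Testing against
h(|z|²)(x + κy)^(n+2) turns ψφ into g h and the Laplacian into the displayed operator on h. -/
theorem exists_radial_profile {ρ A E : ℝ} {ℓ : ℤ} {n : ℕ} (hρ : 0 < ρ)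
    (hℓ : |ℓ| = ((n + 2 : ℕ) : ℤ)) {ψ : ℂ → ℂ}
    (hψ : MemLp ψ 2 volume) (hne : ¬ ψ =ᵐ[volume] 0) (hm : HasAngularMode ℓ ψ)
    (hs : IsSolution (circularWell ρ A) (E : ℂ) ψ) :
    ∃ g : ℝ → ℂ, IntegrableOn (fun s => ‖g s‖ ^ 2 * (s ^ (n + 2))⁻¹) (Set.Ioi 0) ∧
      IntegrableNearZero g ∧ ¬ (∀ᵐ s, s ∈ Set.Ioi (0 : ℝ) → g s = 0) ∧
      ∀ h, IsHalfLineTest h → ∫ s, g s * ((-(4 * (s * deriv (deriv h) s + (n + 3) * deriv h s)) +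
        ((if s ≤ ρ ^ 2 then -A else 0) - E) * h s : ℝ) : ℂ) = 0 := by
  obtain ⟨κ, hκ, hκn, hκr⟩ := exists_lin_mode hℓ
  obtain ⟨g, hg⟩ := exists_radial_of_mode hψ hm hκr
  have hκn' : ∀ z, ‖lin κ z ^ (n + 2)‖ ^ 2 = sq z ^ (n + 2) := fun z => by
    rw [norm_pow, ← pow_mul, mul_comm, pow_mul, hκn]
  have hz0 : ∀ᵐ z : ℂ, z ≠ 0 := (Set.countable_singleton (0 : ℂ)).ae_notMem volume
  have hsq : ∀ᵐ z : ℂ, ‖ψ z‖ ^ 2 = ‖g (sq z)‖ ^ 2 * (sq z ^ (n + 2))⁻¹ := by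
    filter_upwards [hg, hz0] with z hz hz0
    have h0 : sq z ≠ 0 := by rw [sq_eq_norm_sq]; exact pow_ne_zero _ (norm_ne_zero_iff.2 hz0)
    rw [← hz, norm_mul, mul_pow, hκn', mul_assoc, mul_inv_cancel₀ (pow_ne_zero _ h0), mul_one]
  have hint : Integrable fun z => ‖ψ z‖ ^ 2 := (memLp_two_iff_integrable_sq_norm hψ.1).1 hψ
  refine ⟨g, (integrable_comp_sq_iff fun s => ‖g s‖ ^ 2 * (s ^ (n + 2))⁻¹).1 (hint.congr hsq),
    fun b => ?_, fun h0 => hne ?_, fun h hh => ?_⟩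
  · have h1 : Integrable (fun z : ℂ => Set.indicator (Set.Iic b) g (sq z)) := by
      have hS : {z : ℂ | sq z ≤ b} ⊆ Metric.closedBall 0 √b := fun z hz => by
        rw [mem_closedBall_zero_iff]
        exact Real.le_sqrt_of_sq_le (by rw [← sq_eq_norm_sq]; exact hz)
      have hSm : MeasurableSet {z : ℂ | sq z ≤ b} := (isClosed_le continuous_sq continuous_const).measurableSet
      have h2 : IntegrableOn (fun z => ψ z * lin κ z ^ (n + 2)) (Metric.closedBall 0 √b) :=
        (integrableOn_of_memLp hψ (isCompact_closedBall 0 _)).mul_continuousOn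
          ((continuous_lin κ).pow _).continuousOn (isCompact_closedBall 0 _)
      refine ((h2.mono_set hS).integrable_indicator hSm).congr ?_
      filter_upwards [hg] with z hz
      by_cases hzb : sq z ≤ b
      · rw [Set.indicator_of_mem (by exact hzb), Set.indicator_of_mem (by exact hzb), hz]
      · rw [Set.indicator_of_notMem (by exact hzb), Set.indicator_of_notMem (by exact hzb)]
    have h3 := (integrable_comp_sq_iff _).1 h1
    refine (h3.mono_set (Set.Ioc_subset_Ioi_self)).congr_fun (fun s hs => ?_)
      measurableSet_Ioc
    exact Set.indicator_of_mem (by exact hs.2) g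
  · have h1 : ∫ z, ‖ψ z‖ ^ 2 = 0 := by
      rw [integral_congr_ae hsq, integral_comp_sq fun s => ‖g s‖ ^ 2 * (s ^ (n + 2))⁻¹,
        setIntegral_eq_zero_of_ae_eq_zero, smul_zero]
      filter_upwards [h0] with s hs hs0
      rw [hs hs0]; simp
    have h2 := (integral_eq_zero_iff_of_nonneg (fun z => by positivity) hint).1 h1
    filter_upwards [h2] with z hz
    simpa using hz
  · obtain ⟨hh1, a, ha, b, hb⟩ := id hh
    have hh2 := hh.deriv
    have hh3 := hh2.deriv
    set K : ℝ → ℝ := fun s => -(4 * (s * deriv (deriv h) s + (n + 3) * deriv h s)) +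
        ((if s ≤ ρ ^ 2 then -A else 0) - E) * h s with hK
    have hofReal : ∀ {k : ℝ → ℝ}, IsHalfLineTest k → ∀ s, HasDerivAt (fun s => ((k s : ℝ) : ℂ))
        ((deriv k s : ℝ) : ℂ) s := fun hk s => (hk.hasDerivAt s).ofReal_comp
    have hφc : ContDiff ℝ ∞ fun s => ((h s : ℝ) : ℂ) := Complex.ofRealCLM.contDiff.comp hh1
    have hφ : IsTestFunction (modeFun κ (n + 2) fun s => ((h s : ℝ) : ℂ)) := by
      refine ⟨(hφc.comp contDiff_sq).mul ((contDiff_lin κ).pow _), ?_⟩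
      refine HasCompactSupport.intro (isCompact_closedBall (0 : ℂ) √b) fun z hz => ?_
      have : h (sq z) = 0 := hb _ fun hc => hz <| by
        rw [mem_closedBall_zero_iff]
        exact Real.le_sqrt_of_sq_le (by rw [← sq_eq_norm_sq]; exact hc.2)
      simp [modeFun, this]
    have h1 := hs.2 _ hφ
    have h2 : ∀ᵐ z, ψ z * (-(Laplacian.laplacian (modeFun κ (n + 2) fun s => ((h s : ℝ) : ℂ)) z) +
        ((circularWell ρ A z : ℂ) - E) * modeFun κ (n + 2) (fun s => ((h s : ℝ) : ℂ)) z) =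
        (fun s => g s * ((K s : ℝ) : ℂ)) (sq z) := by
      filter_upwards [hg] with z hz
      rw [laplacian_modeFun hκ n (contDiff_infty.1 hφc 2) (hofReal hh) (hofReal hh2)]
      have hW : circularWell ρ A z = if sq z ≤ ρ ^ 2 then -A else 0 := by
        unfold circularWell
        congr 1
        rw [sq_eq_norm_sq, sq_le_sq₀ (norm_nonneg z) hρ.le]
      simp only [← hz, hW, hK, modeFun]
      push_cast
      ring
    rw [integral_congr_ae h2, integral_comp_sq fun s => g s * ((K s : ℝ) : ℂ)] at h1
    have hvol : volume.real (Metric.ball (0 : ℂ) 1) ≠ 0 :=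
      (ENNReal.toReal_pos (Metric.measure_ball_pos _ _ one_pos).ne' measure_ball_lt_top.ne).ne'
    have h3 := (smul_eq_zero.1 h1).resolve_left hvol
    rw [← h3, setIntegral_eq_integral_of_forall_compl_eq_zero]
    intro s hs
    have hzero : ∀ {k : ℝ → ℝ}, IsHalfLineTest k → k s = 0 := fun ⟨_, a, ha, b, hb⟩ =>
      hb s fun hc => hs (ha.trans_le hc.1)
    simp only [hK, hzero hh, hzero hh2, hzero hh3]
    simp

/-! ### Regularity of weak solutions of the radial equation -/

theorem IntegrableNearZero.intervalIntegrable {f : ℝ → ℂ} (hf : IntegrableNearZero f) {s : ℝ}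
    (hs : 0 ≤ s) : IntervalIntegrable f volume 0 s :=
  (intervalIntegrable_iff_integrableOn_Ioc_of_le hs).2 (hf s)

theorem IntegrableNearZero.congr {f g : ℝ → ℂ} (hf : IntegrableNearZero f)
    (h : ∀ᵐ s, s ∈ Set.Ioi (0 : ℝ) → f s = g s) : IntegrableNearZero g := fun b =>
  (hf b).congr_fun_ae <| (ae_restrict_iff' measurableSet_Ioc).2 <| by
    filter_upwards [h] with s hs hsb using hs hsb.1

theorem IntegrableNearZero.hasDerivAt_primitive {f fc : ℝ → ℂ} (hf : IntegrableNearZero f)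
    (h : ∀ᵐ s, s ∈ Set.Ioi (0 : ℝ) → f s = fc s) {s : ℝ} (hs : 0 < s) (hc : ContinuousAt fc s) :
    HasDerivAt (fun s => ∫ t in (0 : ℝ)..s, f t) (fc s) s := by
  have hfc := hf.congr h
  have h1 := intervalIntegral.integral_hasDerivAt_right (hfc.intervalIntegrable hs.le)
    ⟨Set.Ioc 0 (s + 1), Ioc_mem_nhds hs (by linarith), (hfc (s + 1)).1⟩ hc
  refine h1.congr_of_eventuallyEq ?_
  filter_upwards [Ioi_mem_nhds hs] with x hx
  refine intervalIntegral.integral_congr_ae ?_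
  filter_upwards [h] with t ht htx
  rw [Set.uIoc_of_le (le_of_lt hx)] at htx
  exact ht htx.1

theorem IntegrableNearZero.continuousOn_primitive {f : ℝ → ℂ} (hf : IntegrableNearZero f) :
    ContinuousOn (fun s => ∫ t in (0 : ℝ)..s, f t) (Set.Ici 0) := by
  intro s hs
  have hs0 : (0 : ℝ) ≤ s := hs
  have h1 := intervalIntegral.continuousOn_primitive_interval' (a := 0) (b₁ := 0) (b₂ := s + 1)
    (hf.intervalIntegrable (by linarith)) (by simp)
  rw [Set.uIcc_of_le (by linarith)] at h1
  refine (h1 s ⟨hs0, by linarith⟩).mono_of_mem_nhdsWithin ?_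
  rw [mem_nhdsWithin_iff_exists_mem_nhds_inter]
  exact ⟨Set.Iic (s + 1), Iic_mem_nhds (by linarith), fun y hy => ⟨hy.2, hy.1⟩⟩

theorem IntegrableNearZero.ite_mul {f : ℝ → ℂ} (hf : IntegrableNearZero f) (R : ℝ) (a b : ℂ) :
    IntegrableNearZero fun s => (if s ≤ R then a else b) * f s := fun c => by
  refine (hf c).bdd_mul (c := ‖a‖ + ‖b‖) ?_ (Eventually.of_forall fun s => ?_)
  · exact (Measurable.ite measurableSet_Iic measurable_const
      measurable_const).aestronglyMeasurable
  · split_ifs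
    · linarith [norm_nonneg b]
    · linarith [norm_nonneg a]

theorem continuousAt_ite_le {R : ℝ} (a b : ℂ) {s : ℝ} (hs : s ≠ R) :
    ContinuousAt (fun s => if s ≤ R then a else b) s := by
  rcases lt_or_gt_of_ne hs with h | h
  · refine (continuousAt_const : ContinuousAt (fun _ => a) s).congr ?_
    filter_upwards [Iio_mem_nhds h] with x hx
    rw [if_pos (le_of_lt hx)]
  · refine (continuousAt_const : ContinuousAt (fun _ => b) s).congr ?_
    filter_upwards [Ioi_mem_nhds h] with x hx
    rw [if_neg (not_le.2 hx)]

/-- Weak solutions of `4 s y'' = 4 (n + 1) y' + W y`, with `W = a` on `s ≤ R` and `W = b` elsewhere,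
are `C¹` and solve the equation off `s = R`. -/
theorem exists_regular_of_weak {n : ℕ} {R : ℝ} {a b : ℝ} {g : ℝ → ℂ}
    (hg : IntegrableNearZero g)
    (hw : ∀ h, IsHalfLineTest h → ∫ s, g s *
      ((-(4 * (s * deriv (deriv h) s + (n + 3) * deriv h s)) +
        (if s ≤ R then a else b) * h s : ℝ) : ℂ) = 0) :
    ∃ G G1 : ℝ → ℂ, (∀ᵐ s, s ∈ Set.Ioi (0 : ℝ) → g s = G s) ∧
      (∀ s > 0, HasDerivAt G (G1 s) s) ∧ ContinuousOn G1 (Set.Ioi 0) ∧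
      ∀ s > 0, s ≠ R → HasDerivAt G1
        ((4 * (n + 1) * G1 s + (if s ≤ R then (a : ℂ) else b) * G s) / (4 * s)) s := by
  set f : ℝ → ℂ := fun s => (if s ≤ R then (a : ℂ) else b) * g s with hf
  have hfi : IntegrableNearZero f := hg.ite_mul R a b
  set P : ℝ → ℂ := fun s => ∫ t in (0 : ℝ)..s, f t with hP
  have hPc : ContinuousOn P (Set.Ici 0) := hfi.continuousOn_primitive
  have hPi : IntegrableNearZero P := integrableNearZero_of_continuousOn hPc
  have hf2 : IntegrableNearZero fun s => 4 * (n + 3) * g s + P s := fun c =>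
    ((hg c).const_mul _).add (hPi c)
  set Q : ℝ → ℂ := fun s => ∫ t in (0 : ℝ)..s, (4 * (n + 3) * g t + P t) with hQ
  have hQc : ContinuousOn Q (Set.Ici 0) := hf2.continuousOn_primitive
  have hQi : IntegrableNearZero Q := integrableNearZero_of_continuousOn hQc
  have hsg : IntegrableNearZero fun s => 4 * (s * g s) := fun c => by
    have h1 : IntegrableOn (fun s : ℝ => (s : ℂ) * g s) (Set.Ioc 0 c) := by
      refine (hg c).bdd_mul (c := c) (by fun_prop) ?_
      filter_upwards [ae_restrict_mem measurableSet_Ioc] with s hs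
      rw [Complex.norm_real, Real.norm_of_nonneg hs.1.le]
      exact hs.2
    exact h1.const_mul 4
  -- Two integrations by parts move every derivative onto h'': the weak equation says that Q - 4 s g
  -- has vanishing second weak derivative.
  obtain ⟨c₀, c₁, hc⟩ := ae_affine_of_integral_deriv_deriv_mul
      (f := fun s => Q s - 4 * (s * g s)) (fun c => (hQi c).sub (hsg c)) fun h hh => by
    have hh1 := hh.deriv
    have hh2 := hh1.deriv
    have h0 := hw h hh
    have i1 := integral_deriv_mul_primitive hfi hh
    have i2 := integral_deriv_mul_primitive hf2 hh1
    have e0 : ∀ s, g s * ((-(4 * (s * deriv (deriv h) s + (n + 3) * deriv h s)) +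
        (if s ≤ R then a else b) * h s : ℝ) : ℂ) =
        (((h s : ℝ) : ℂ) * f s + (-1) * (((deriv h s : ℝ) : ℂ) * (4 * (n + 3) * g s))) -
          ((deriv (deriv h) s : ℝ) : ℂ) * (4 * (s * g s)) := fun s => by
      simp only [hf]; split_ifs <;> push_cast <;> ring
    have hgi : IntegrableNearZero fun s => 4 * (n + 3) * g s := fun c => (hg c).const_mul _
    have j1 := integrable_mul_of_halfLineTest hh hfi
    have j2 := (integrable_mul_of_halfLineTest hh1 hgi).const_mul (-1)
    have j3 := integrable_mul_of_halfLineTest hh2 hsg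
    have j4 := integrable_mul_of_halfLineTest hh2 hQi
    have j5 := integrable_mul_of_halfLineTest hh1 hPi
    simp only [e0] at h0
    have j12 : Integrable fun s => ((h s : ℝ) : ℂ) * f s +
        (-1) * (((deriv h s : ℝ) : ℂ) * (4 * (n + 3) * g s)) := j1.add j2
    rw [integral_sub j12 j3, integral_add j1 j2, integral_const_mul] at h0
    have e1 : ∀ s, ((deriv (deriv h) s : ℝ) : ℂ) * (Q s - 4 * (s * g s)) =
      ((deriv (deriv h) s : ℝ) : ℂ) * Q s - ((deriv (deriv h) s : ℝ) : ℂ) * (4 * (s * g s)) :=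
      fun s => by ring
    have e2 : ∀ s, ((deriv h s : ℝ) : ℂ) * (4 * (n + 3) * g s + P s) =
      ((deriv h s : ℝ) : ℂ) * (4 * (n + 3) * g s) + ((deriv h s : ℝ) : ℂ) * P s :=
      fun s => by ring
    simp only [e2] at i2
    rw [integral_add (integrable_mul_of_halfLineTest hh1 hgi) j5] at i2
    simp only [e1]
    rw [integral_sub j4 j3]
    linear_combination h0 - i1 + i2
  -- Solving for g gives a continuous representative. Then Q and P are differentiable with known
  -- derivatives, which bootstraps the regularity.
  set G : ℝ → ℂ := fun s => (Q s - c₀ - c₁ * s) / (4 * s) with hG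
  have hgG : ∀ᵐ s, s ∈ Set.Ioi (0 : ℝ) → g s = G s := by
    filter_upwards [hc] with s hs h0
    have hs0 : (s : ℂ) ≠ 0 := by exact_mod_cast (ne_of_gt (show (0 : ℝ) < s from h0))
    simp only [hG]
    rw [eq_div_iff (by simpa using hs0)]
    linear_combination -(hs h0)
  have hQat : ∀ s > 0, ContinuousAt Q s := fun s hs => hQc.continuousAt (Ici_mem_nhds hs)
  have hPat : ∀ s > 0, ContinuousAt P s := fun s hs => hPc.continuousAt (Ici_mem_nhds hs)
  have hne : ∀ s : ℝ, s > 0 → (4 * s : ℂ) ≠ 0 := fun s hs => by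
    simpa using (ne_of_gt hs)
  have hGc : ∀ s > 0, ContinuousAt G s := fun s hs =>
    (((hQat s hs).sub continuousAt_const).sub (by fun_prop)).div (by fun_prop) (hne s hs)
  set G1 : ℝ → ℂ := fun s => (4 * (n + 2) * G s + P s - c₁) / (4 * s) with hG1
  have hof : ∀ (c : ℂ) (s : ℝ), HasDerivAt (fun s : ℝ => c * (s : ℂ)) c s := fun c s => by
    simpa using (Complex.ofRealCLM.hasDerivAt (x := s)).const_mul c
  have hGd : ∀ s > 0, HasDerivAt G (G1 s) s := fun s hs => by
    have hQd : HasDerivAt Q (4 * (n + 3) * G s + P s) s :=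
      hf2.hasDerivAt_primitive (fc := fun s => 4 * (n + 3) * G s + P s)
        (by filter_upwards [hgG] with t ht h0; rw [ht h0]) hs
        ((continuousAt_const.mul (hGc s hs)).add (hPat s hs))
    refine (((hQd.sub_const c₀).sub (hof c₁ s)).div (hof 4 s) (hne s hs)).congr_deriv ?_
    have h4 := hne s hs
    have hs0 : (s : ℂ) ≠ 0 := by simpa using (ne_of_gt hs)
    have hGs : Q s - c₀ - c₁ * s = G s * (4 * s) := by simp only [hG]; field_simp
    simp only [hG1, Pi.sub_apply]
    rw [hGs]
    field_simp
    ring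
  have hG1at : ∀ s > 0, ContinuousAt G1 s := fun s hs =>
    (((continuousAt_const.mul (hGc s hs)).add (hPat s hs)).sub continuousAt_const).div
      (by fun_prop) (hne s hs)
  refine ⟨G, G1, hgG, hGd, fun s hs => (hG1at s hs).continuousWithinAt, fun s hs hsR => ?_⟩
  have hPd : HasDerivAt P ((if s ≤ R then (a : ℂ) else b) * G s) s :=
    hfi.hasDerivAt_primitive (fc := fun s => (if s ≤ R then (a : ℂ) else b) * G s)
      (by filter_upwards [hgG] with t ht h0; simp only [hf]; rw [ht h0]) hs
      ((continuousAt_ite_le _ _ hsR).mul (hGc s hs))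
  refine (((((hGd s hs).const_mul (4 * (n + 2) : ℂ)).add hPd).sub_const c₁).div (hof 4 s)
    (hne s hs)).congr_deriv ?_
  have hs0 : (s : ℂ) ≠ 0 := by simpa using (ne_of_gt hs)
  have hGs : 4 * (n + 2) * G s + P s - c₁ = G1 s * (4 * s) := by simp only [hG1]; field_simp
  simp only [Pi.add_apply]
  rw [hGs]
  field_simp
  ring

/-! ### Solutions of the radial equation -/

/-- `f` solves `s f'' = (n + 1) f' + q f` on `I`, with `f₁ = f'`. -/
def IsRadialSol (n : ℕ) (q : ℂ) (I : Set ℝ) (f f₁ : ℝ → ℂ) : Prop :=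
  ∀ s ∈ I, HasDerivAt f (f₁ s) s ∧ HasDerivAt f₁ (((n + 1) * f₁ s + q * f s) / s) s

/-- Abel's formula. -/
theorem IsRadialSol.exists_wronskian {n : ℕ} {q : ℂ} {I : Set ℝ} (hI : IsOpen I)
    (hI' : IsPreconnected I) (hpos : ∀ s ∈ I, 0 < s) {f f₁ k k₁ : ℝ → ℂ}
    (hf : IsRadialSol n q I f f₁) (hk : IsRadialSol n q I k k₁) :
    ∃ C : ℂ, ∀ s ∈ I, f₁ s * k s - f s * k₁ s = C * (s : ℂ) ^ (n + 1) := by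
  have hd : ∀ s ∈ I, HasDerivAt (fun s : ℝ => (f₁ s * k s - f s * k₁ s) / (s : ℂ) ^ (n + 1)) 0 s :=
    fun s hs => by
    have hs0 : (s : ℂ) ≠ 0 := by exact_mod_cast (hpos s hs).ne'
    have hp : HasDerivAt (fun s : ℝ => (s : ℂ) ^ (n + 1)) (((n + 1 : ℕ) : ℂ) * (s : ℂ) ^ n) s := by
      simpa using (hasDerivAt_pow (n + 1) (s : ℂ)).comp_ofReal
    have hn : HasDerivAt (fun s : ℝ => f₁ s * k s - f s * k₁ s) _ s :=
      ((hf s hs).2.mul (hk s hs).1).sub ((hf s hs).1.mul (hk s hs).2)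
    refine (hn.div hp (pow_ne_zero _ hs0)).congr_deriv ?_
    push_cast
    field_simp
    ring
  obtain ⟨C, hC⟩ := hI.exists_is_const_of_deriv_eq_zero hI'
    (fun s hs => (hd s hs).differentiableAt.differentiableWithinAt) (fun s hs => (hd s hs).deriv)
  refine ⟨C, fun s hs => ?_⟩
  have hs0 : (s : ℂ) ≠ 0 := by exact_mod_cast (hpos s hs).ne'
  rw [← hC s hs, div_mul_cancel₀ _ (pow_ne_zero _ hs0)]

/-- Cramer's rule: all Wronskians are multiples of the same power s^(n+1), so their quotients are
constants. -/
theorem IsRadialSol.exists_coeff {n : ℕ} {q : ℂ} {I : Set ℝ} (hI : IsOpen I)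
    (hI' : IsPreconnected I) (hpos : ∀ s ∈ I, 0 < s) {f f₁ k k₁ l l₁ : ℝ → ℂ}
    (hf : IsRadialSol n q I f f₁) (hk : IsRadialSol n q I k k₁) (hl : IsRadialSol n q I l l₁)
    {C : ℂ} (hC0 : C ≠ 0) (hC : ∀ s ∈ I, k₁ s * l s - k s * l₁ s = C * (s : ℂ) ^ (n + 1)) :
    ∃ α β : ℂ, ∀ s ∈ I, f s = α * k s + β * l s ∧ f₁ s = α * k₁ s + β * l₁ s := by
  obtain ⟨C₁, h1⟩ := hf.exists_wronskian hI hI' hpos hl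
  obtain ⟨C₂, h2⟩ := hk.exists_wronskian hI hI' hpos hf
  refine ⟨C₁ / C, C₂ / C, fun s hs => ?_⟩
  have hs0 : (s : ℂ) ^ (n + 1) ≠ 0 := pow_ne_zero _ (by exact_mod_cast (hpos s hs).ne')
  have e1 := h1 s hs
  have e2 := h2 s hs
  have e := hC s hs
  constructor
  · have : (C * (s : ℂ) ^ (n + 1)) * f s = (C₁ * k s + C₂ * l s) * (s : ℂ) ^ (n + 1) := by
      linear_combination -f s * e + k s * e1 + l s * e2
    field_simp
    refine mul_right_cancel₀ hs0 ?_
    linear_combination this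
  · have : (C * (s : ℂ) ^ (n + 1)) * f₁ s = (C₁ * k₁ s + C₂ * l₁ s) * (s : ℂ) ^ (n + 1) := by
      linear_combination -f₁ s * e + k₁ s * e1 + l₁ s * e2
    field_simp
    refine mul_right_cancel₀ hs0 ?_
    linear_combination this

theorem hasDerivAt_comp_mul {F : ℂ → ℂ} {F' : ℂ} {q s : ℝ}
    (hF : HasDerivAt F F' ((q * s : ℝ) : ℂ)) :
    HasDerivAt (fun s : ℝ => F ((q * s : ℝ) : ℂ)) (q * F') s := by
  have h1 : HasDerivAt (fun s : ℝ => ((q * s : ℝ) : ℂ)) (q : ℂ) s := by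
    simpa using ((hasDerivAt_id s).const_mul q).ofReal_comp
  have h2 := hF.scomp s h1
  rwa [smul_eq_mul] at h2

/-- The solution that is regular at the origin, and its derivatives. -/
def solA (k : ℕ) (t : ℂ) : ℂ := t ^ k * bA k t

theorem hasDerivAt_solA (k : ℕ) (t : ℂ) : HasDerivAt (solA (k + 1)) (solA k t) t :=
  hasDerivAt_pow_mul_bA k t

theorem solA_add_two (k : ℕ) (t : ℂ) : solA (k + 2) t = t * solA k t - (k + 1) * solA (k + 1) t := by
  simp only [solA]
  rw [bA_nat_eq k t]
  ring

theorem continuous_solA (k : ℕ) : Continuous (solA k) := by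
  unfold solA
  exact (continuous_id.pow k).mul (continuous_bA _)

/-- If lowering the index is differentiation, the three-term recurrence at index n is itself the
radial equation for the member of index n + 2. -/
theorem isRadialSol_of_recurrence {n : ℕ} {q : ℝ} {I : Set ℝ}
    (hpos : ∀ s ∈ I, 0 < s) {S : ℕ → ℂ → ℂ}
    (hS : ∀ k, ∀ s ∈ I, HasDerivAt (S (k + 1)) (S k ((q * s : ℝ) : ℂ)) ((q * s : ℝ) : ℂ))
    (hrec : ∀ k t, S (k + 2) t = t * S k t - (k + 1) * S (k + 1) t) :
    IsRadialSol n q I (fun s => S (n + 2) ((q * s : ℝ) : ℂ))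
      (fun s => q * S (n + 1) ((q * s : ℝ) : ℂ)) := fun s hs => by
  refine ⟨hasDerivAt_comp_mul (hS _ s hs),
    ((hasDerivAt_comp_mul (hS _ s hs)).const_mul _).congr_deriv ?_⟩
  have hs0 : (s : ℂ) ≠ 0 := by exact_mod_cast (hpos s hs).ne'
  beta_reduce
  rw [hrec]
  push_cast
  field_simp
  ring

theorem mem_halfPlane_ofReal {σ x : ℝ} : (x : ℂ) ∈ halfPlane σ ↔ 0 < σ * x := by
  simp [halfPlane]

/-- Every solution is a combination of the two model solutions. -/
theorem IsRadialSol.exists_eq {n : ℕ} {q σ : ℝ} (hσ : |σ| = 1) (hq : 0 < σ * q) {I : Set ℝ}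
    (hI : IsOpen I) (hI' : IsPreconnected I) (hpos : ∀ s ∈ I, 0 < s) {f f₁ : ℝ → ℂ}
    (hf : IsRadialSol n q I f f₁) :
    ∃ α β : ℂ, ∀ s ∈ I,
      f s = α * solA (n + 2) ((q * s : ℝ) : ℂ) + β * mM σ 0 (n + 2) ((q * s : ℝ) : ℂ) ∧
      f₁ s = α * (q * solA (n + 1) ((q * s : ℝ) : ℂ)) +
        β * (q * mM σ 0 (n + 1) ((q * s : ℝ) : ℂ)) := by
  have hq0 : q ≠ 0 := by rintro rfl; simp at hq
  have hmem : ∀ s ∈ I, ((q * s : ℝ) : ℂ) ∈ halfPlane σ := fun s hs => by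
    rw [mem_halfPlane_ofReal, ← mul_assoc]; exact mul_pos hq (hpos s hs)
  refine hf.exists_coeff hI hI' hpos
    (isRadialSol_of_recurrence hpos (fun k s _ => hasDerivAt_solA k _) solA_add_two)
    (isRadialSol_of_recurrence hpos (fun k s hs => hasDerivAt_mM k (hmem s hs))
      fun k t => mM_add_two ..)
    (C := (q : ℂ) ^ (n + 2) * (bA (n + 1 : ℕ) 0 * bB (-((n + 2 : ℕ) : ℂ)) 0)) ?_ fun s hs => ?_
  · exact mul_ne_zero (pow_ne_zero _ (by exact_mod_cast hq0)) (wronskian_const_ne_zero n)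
  · have h := wronskian_bA_mM hσ 0 n (hmem s hs)
    rw [← h]
    simp only [solA]
    push_cast
    ring

/-! ### Square integrability at infinity and at the origin -/

theorem solA_not_integrable (n : ℕ) (T : ℝ) :
    ¬ IntegrableOn (fun t : ℝ => ‖solA (n + 2) t‖ ^ 2 * (t ^ (n + 2))⁻¹) (Set.Ioi T) := by
  intro h
  set δ : ℝ := (((n + 2).factorial : ℝ)⁻¹) ^ 2 with hδ
  have hδ0 : 0 < δ := by positivity
  have h1 := h.mono_set (Set.Ioi_subset_Ioi (le_max_left T 1))
  refine not_integrableOn_Ioi_inv (a := max T 1) ?_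
  have h2 : IntegrableOn (fun t : ℝ => δ⁻¹ * (‖solA (n + 2) t‖ ^ 2 * (t ^ (n + 2))⁻¹))
    (Set.Ioi (max T 1)) := h1.const_mul _
  refine Integrable.mono' h2 (by fun_prop) ?_
  filter_upwards [ae_restrict_mem measurableSet_Ioi] with t ht
  have ht1 : 1 < t := (le_max_right T 1).trans_lt ht
  have ht0 : 0 < t := by linarith
  obtain ⟨a, ha, ha'⟩ := bA_nat_ofReal (n + 2) t
  -- The series has nonnegative terms for t ≥ 0, so it is bounded below by its first term 1/(n+2)!.
  have hb : δ * t ^ (n + 2) ≤ ‖solA (n + 2) t‖ ^ 2 * (t ^ (n + 2))⁻¹ := by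
    have ha0 := ha' ht0.le
    have e : ‖solA (n + 2) t‖ = t ^ (n + 2) * |a| := by
      rw [solA, ha, norm_mul, norm_pow, Complex.norm_real, Complex.norm_real, Real.norm_eq_abs,
        Real.norm_eq_abs, abs_of_pos ht0]
    have e2 : (t ^ (n + 2) * |a|) ^ 2 * (t ^ (n + 2))⁻¹ = a ^ 2 * t ^ (n + 2) := by
      rw [mul_pow, sq_abs]
      field_simp
    rw [e, e2, hδ]
    gcongr
  have h3 : t⁻¹ ≤ t ^ (n + 2) :=
    (inv_le_one_of_one_le₀ ht1.le).trans (one_le_pow₀ ht1.le)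
  rw [Real.norm_of_nonneg (by positivity), inv_mul_eq_div, le_div_iff₀ hδ0]
  calc t⁻¹ * δ ≤ t ^ (n + 2) * δ := by gcongr
    _ ≤ _ := by rw [mul_comm]; exact hb

/-- The solutions of the outer equation that are square integrable at infinity. -/
def IsDecaying (n : ℕ) (a b : ℂ) : Prop :=
  ∃ T > 0, IntegrableOn (fun t : ℝ => ‖a * solA (n + 2) t + b * mM 1 0 (n + 2) t‖ ^ 2 *
    (t ^ (n + 2))⁻¹) (Set.Ioi T)

/-- If two decaying combinations were not proportional, eliminating the second solution would make
the regular one square integrable at infinity, but it grows. -/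
theorem IsDecaying.cross {n : ℕ} {a b a' b' : ℂ} (h : IsDecaying n a b) (h' : IsDecaying n a' b') :
    b' * a = b * a' := by
  obtain ⟨T, hT, h⟩ := h
  obtain ⟨T', hT', h'⟩ := h'
  by_contra hne
  have hd : b' * a - b * a' ≠ 0 := sub_ne_zero.2 hne
  set d := b' * a - b * a'
  set S := max T T'
  have hS : 0 < S := hT.trans_le (le_max_left _ _)
  have h1 := (h.mono_set (Set.Ioi_subset_Ioi (le_max_left T T'))).const_mul (2 * ‖b'‖ ^ 2)
  have h2 := (h'.mono_set (Set.Ioi_subset_Ioi (le_max_right T T'))).const_mul (2 * ‖b‖ ^ 2)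
  refine solA_not_integrable n S ?_
  have h3 := (h1.add h2).const_mul ((‖d‖ ^ 2)⁻¹)
  refine Integrable.mono' h3 ?_ ?_
  · refine (ContinuousOn.aestronglyMeasurable ?_ measurableSet_Ioi)
    refine ContinuousOn.mul ?_ ?_
    · have := continuous_solA (n + 2)
      exact (by fun_prop : Continuous fun t : ℝ => ‖solA (n + 2) t‖ ^ 2).continuousOn
    · refine ContinuousOn.inv₀ (by fun_prop) fun t ht => pow_ne_zero _ ?_
      exact (hS.trans ht).ne'
  · filter_upwards [ae_restrict_mem measurableSet_Ioi] with t ht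
    have ht0 : 0 < t := hS.trans ht
    have hd0 : 0 < ‖d‖ ^ 2 := by positivity
    rw [Real.norm_of_nonneg (by positivity), inv_mul_eq_div, le_div_iff₀ hd0]
    set u := a * solA (n + 2) t + b * mM 1 0 (n + 2) t
    set v := a' * solA (n + 2) t + b' * mM 1 0 (n + 2) t
    have e : d * solA (n + 2) t = b' * u - b * v := by simp only [d, u, v]; ring
    have e2 : ‖d‖ * ‖solA (n + 2) t‖ ≤ ‖b'‖ * ‖u‖ + ‖b‖ * ‖v‖ := by
      rw [← norm_mul, e, ← norm_mul, ← norm_mul]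
      exact norm_sub_le _ _
    have e3 : (‖d‖ * ‖solA (n + 2) t‖) ^ 2 ≤ 2 * ‖b'‖ ^ 2 * ‖u‖ ^ 2 + 2 * ‖b‖ ^ 2 * ‖v‖ ^ 2 := by
      have := pow_le_pow_left₀ (by positivity) e2 2
      nlinarith [sq_nonneg (‖b'‖ * ‖u‖ - ‖b‖ * ‖v‖)]
    have ht' : 0 ≤ (t ^ (n + 2))⁻¹ := by positivity
    have := mul_le_mul_of_nonneg_right e3 ht'
    simp only [Pi.add_apply]
    nlinarith [this]

theorem isDecaying_zero_right {n : ℕ} {a : ℂ} (h : IsDecaying n a 0) : a = 0 := by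
  obtain ⟨T, hT, h⟩ := h
  by_contra ha
  refine solA_not_integrable n T ?_
  refine (h.const_mul ((‖a‖ ^ 2)⁻¹)).congr (Eventually.of_forall fun t => ?_)
  have : ‖a‖ ^ 2 ≠ 0 := by positivity
  simp only [zero_mul, add_zero, norm_mul]
  field_simp

/-- Decaying pairs lie on one line, on which b = 0 forces a = 0. If there is no pair with b ≠ 0,
then c = 0 serves. -/
theorem exists_decaying_ratio (n : ℕ) : ∃ c : ℂ, ∀ a b, IsDecaying n a b → a = b * c := by
  by_cases h : ∃ a b, IsDecaying n a b ∧ b ≠ 0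
  · obtain ⟨a, b, h1, hb⟩ := h
    refine ⟨a / b, fun a' b' h' => ?_⟩
    have := h1.cross h'
    field_simp
    linear_combination -this
  · push Not at h
    refine ⟨0, fun a b hab => ?_⟩
    obtain rfl := h a b hab
    rw [isDecaying_zero_right hab]; simp

/-! ### The matching condition at a negative eigenvalue -/

theorem mM_eq_add (σ : ℝ) (c : ℂ) (k : ℕ) (t : ℂ) :
    mM σ c k t = mM σ 0 k t + c * solA k t := by
  simp only [mM, solA, lg, add_zero]
  exact bM_add k _ c t

/-- Rescaling to t = qs removes the energy, so that a single constant c works for all negative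
energies. -/
theorem isDecaying_of_integrable {n : ℕ} {q R : ℝ} (hq : 0 < q) (hR : 0 < R) {a b : ℂ} {G : ℝ → ℂ}
    (hG : ∀ s ∈ Set.Ioi R, G s =
      a * solA (n + 2) ((q * s : ℝ) : ℂ) + b * mM 1 0 (n + 2) ((q * s : ℝ) : ℂ))
    (hi : IntegrableOn (fun s => ‖G s‖ ^ 2 * (s ^ (n + 2))⁻¹) (Set.Ioi R)) :
    IsDecaying n a b := by
  refine ⟨q * R, mul_pos hq hR, ?_⟩
  rw [← integrableOn_Ioi_comp_mul_left_iff _ R hq]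
  refine IntegrableOn.congr_fun (hi.const_mul ((q ^ (n + 2))⁻¹)) (fun s hs => ?_) measurableSet_Ioi
  have hs0 : s ≠ 0 := (hR.trans hs).ne'
  rw [hG s hs, mul_pow]
  have := hq.ne'
  field_simp

/-- The second solution has a nonzero limit at 0, whereas the weight s^(-(n+2)) is not integrable
there. -/
theorem coeff_eq_zero_of_integrable {n : ℕ} {q R : ℝ} (hR : 0 < R) {a b : ℂ}
    {G : ℝ → ℂ} (hG : ∀ s ∈ Set.Ioo 0 R, G s =
      a * solA (n + 2) ((q * s : ℝ) : ℂ) + b * mM (-1) 0 (n + 2) ((q * s : ℝ) : ℂ))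
    (hi : IntegrableOn (fun s => ‖G s‖ ^ 2 * (s ^ (n + 2))⁻¹) (Set.Ioo 0 R)) :
    b = 0 := by
  by_contra hb
  have h0 : Tendsto (fun s : ℝ => ((q * s : ℝ) : ℂ)) (𝓝 0) (𝓝 0) := by
    have : Continuous fun s : ℝ => ((q * s : ℝ) : ℂ) := by fun_prop
    simpa using this.tendsto 0
  have h1 : Tendsto (fun s : ℝ => solA (n + 2) ((q * s : ℝ) : ℂ)) (𝓝 0) (𝓝 0) := by
    have := ((continuous_solA (n + 2)).tendsto 0).comp h0
    simpa [solA, Function.comp_def] using this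
  have h2 := (tendsto_mM (σ := -1) (by simp) 0 (n + 1)).comp h0
  have h3 : Tendsto (fun s : ℝ => ‖a * solA (n + 2) ((q * s : ℝ) : ℂ) +
      b * mM (-1) 0 (n + 2) ((q * s : ℝ) : ℂ)‖) (𝓝 0)
      (𝓝 ‖a * 0 + b * bB (-((n + 1 + 1 : ℕ) : ℂ)) 0‖) :=
    ((h1.const_mul a).add (h2.const_mul b)).norm
  set L := ‖a * 0 + b * bB (-((n + 1 + 1 : ℕ) : ℂ)) 0‖ with hL
  have hL0 : 0 < L := by
    rw [hL, mul_zero, zero_add]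
    exact norm_pos_iff.2 (mul_ne_zero hb (bB_neg_nat_zero_ne_zero (n + 1)))
  obtain ⟨d, hd, hd'⟩ := Metric.eventually_nhds_iff.1 (h3.eventually (lt_mem_nhds (half_lt_self hL0)))
  obtain ⟨r, hr0, hrd, hrR, hr1⟩ : ∃ r > 0, r ≤ d ∧ r ≤ R ∧ r ≤ 1 :=
    ⟨min d (min R 1), by positivity, min_le_left _ _, (min_le_right _ _).trans (min_le_left _ _),
      (min_le_right _ _).trans (min_le_right _ _)⟩
  have hni : ¬ IntegrableOn (fun s : ℝ => s⁻¹) (Set.Ioo 0 r) := by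
    rw [← integrableOn_Ioc_iff_integrableOn_Ioo, ← intervalIntegrable_iff_integrableOn_Ioc_of_le
      hr0.le, intervalIntegrable_inv_iff]
    simp [hr0.ne, hr0.le]
  apply hni
  have h4 := (hi.mono_set (Set.Ioo_subset_Ioo_right hrR)).const_mul (((L / 2) ^ 2)⁻¹)
  refine Integrable.mono' h4 (by fun_prop) ?_
  filter_upwards [ae_restrict_mem measurableSet_Ioo] with s hs
  have hs0 : 0 < s := hs.1
  have h5 : L / 2 < ‖G s‖ := by
    rw [hG s ⟨hs.1, hs.2.trans_le hrR⟩]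
    exact hd' (by rw [Real.dist_eq, sub_zero, abs_of_pos hs0]; exact hs.2.trans_le hrd)
  have hL2 : 0 < (L / 2) ^ 2 := by positivity
  rw [Real.norm_of_nonneg (by positivity), inv_mul_eq_div, le_div_iff₀ hL2, mul_comm]
  have h6 : s⁻¹ ≤ (s ^ (n + 2))⁻¹ := by
    refine inv_anti₀ (by positivity) ?_
    calc s ^ (n + 2) ≤ s ^ 1 := pow_le_pow_of_le_one hs0.le (hs.2.le.trans hr1) (by omega)
      _ = s := pow_one s
  gcongr

/-- The square integrable modes of negative energy satisfy the matching condition of resonances,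
with the same branch of the logarithm for all of them. -/
theorem exists_matching_of_mode (n : ℕ) : ∃ c : ℂ, ∀ {ρ A E : ℝ} {ℓ : ℤ} {ψ : ℂ → ℂ}, 0 < ρ →
    |ℓ| = ((n + 2 : ℕ) : ℤ) → 0 < A + E → E < 0 → MemLp ψ 2 volume → ¬ ψ =ᵐ[volume] 0 →
    HasAngularMode ℓ ψ → IsSolution (circularWell ρ A) (E : ℂ) ψ →
    bA (n + 1 : ℕ) ((-((A + E) / 4) * ρ ^ 2 : ℝ) : ℂ) * mM 1 c (n + 2) ((-(E / 4) * ρ ^ 2 : ℝ) : ℂ) -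
      ((-(E / 4) * ρ ^ 2 : ℝ) : ℂ) * bA (n + 2 : ℕ) ((-((A + E) / 4) * ρ ^ 2 : ℝ) : ℂ) *
        mM 1 c (n + 1) ((-(E / 4) * ρ ^ 2 : ℝ) : ℂ) = 0 := by
  obtain ⟨c, hc⟩ := exists_decaying_ratio n
  refine ⟨c, fun {ρ A E ℓ ψ} hρ hℓ hw hE hψ hne hm hs => ?_⟩
  obtain ⟨g, hg2, hgi, hg0, hgw⟩ := exists_radial_profile hρ hℓ hψ hne hm hs
  obtain ⟨R, hRdef⟩ : ∃ R, R = ρ ^ 2 := ⟨_, rfl⟩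
  rw [← hRdef] at hgw ⊢
  have hR : 0 < R := by rw [hRdef]; positivity
  obtain ⟨G, G1, hgG, hGd, hG1c, hG1d⟩ := exists_regular_of_weak (R := R) (a := -A - E) (b := 0 - E)
    hgi fun h hh => by
      rw [← hgw h hh]
      refine integral_congr_ae (Eventually.of_forall fun s => ?_)
      simp only
      split_ifs <;> rfl
  have hGi : IntegrableOn (fun s => ‖G s‖ ^ 2 * (s ^ (n + 2))⁻¹) (Set.Ioi 0) :=
    hg2.congr_fun_ae <| (ae_restrict_iff' measurableSet_Ioi).2 <| by
      filter_upwards [hgG] with s hs h0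
      rw [hs h0]
  set p : ℝ := -((A + E) / 4) with hp
  set q : ℝ := -(E / 4) with hq
  have hp0 : p < 0 := by rw [hp]; linarith
  have hq0 : 0 < q := by rw [hq]; linarith
  have hin : IsRadialSol n p (Set.Ioo 0 R) G G1 := fun s hs => by
    have hs0 : (s : ℂ) ≠ 0 := by exact_mod_cast hs.1.ne'
    refine ⟨hGd s hs.1, (hG1d s hs.1 hs.2.ne).congr_deriv ?_⟩
    rw [if_pos hs.2.le, hp]
    push_cast
    field_simp
    ring
  have hout : IsRadialSol n q (Set.Ioi R) G G1 := fun s hs => by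
    have hs1 : R < s := hs
    have hs0 : (s : ℂ) ≠ 0 := by exact_mod_cast (hR.trans hs1).ne'
    refine ⟨hGd s (hR.trans hs1), (hG1d s (hR.trans hs1) hs1.ne').congr_deriv ?_⟩
    rw [if_neg (not_le.2 hs1), hq]
    push_cast
    field_simp
    ring
  obtain ⟨α, β, h1⟩ := hin.exists_eq (σ := -1) (by simp) (by linarith) isOpen_Ioo
    isPreconnected_Ioo fun s hs => hs.1
  obtain ⟨a, b, h2⟩ := hout.exists_eq (σ := 1) (by simp) (by linarith) isOpen_Ioi
    isPreconnected_Ioi fun s hs => hR.trans hs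
  obtain rfl : β = 0 := coeff_eq_zero_of_integrable hR (fun s hs => (h1 s hs).1)
    (hGi.mono_set fun s hs => hs.1)
  have hab := hc a b (isDecaying_of_integrable hq0 hR (fun s hs => (h2 s hs).1)
    (hGi.mono_set fun s hs => hR.trans hs))
  have hGc : ContinuousAt G R := (hGd R hR).continuousAt
  have hG1c' : ContinuousAt G1 R := hG1c.continuousAt (Ioi_mem_nhds hR)
  have hL : ∀ᶠ s in 𝓝[<] R, s ∈ Set.Ioo 0 R := Ioo_mem_nhdsLT hR
  have hcont : ∀ (u : ℝ) (k : ℕ), Continuous fun s : ℝ => solA k ((u * s : ℝ) : ℂ) := fun u k =>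
    (continuous_solA k).comp (by fun_prop)
  have hmc : ∀ k, ContinuousAt (fun s : ℝ => mM 1 0 (k + 1) ((q * s : ℝ) : ℂ)) R := fun k => by
    have := (hasDerivAt_mM (σ := 1) (c := 0) k
      (mem_halfPlane_ofReal.2 (by positivity : 0 < 1 * (q * R)))).continuousAt
    exact ContinuousAt.comp (f := fun s : ℝ => ((q * s : ℝ) : ℂ)) this (by fun_prop)
  have e1 : G R = α * solA (n + 2) ((p * R : ℝ) : ℂ) := by
    refine tendsto_nhds_unique (hGc.mono_left (nhdsWithin_le_nhds (s := Set.Iio R))) ?_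
    refine (((hcont p (n + 2)).const_mul α).continuousAt.mono_left nhdsWithin_le_nhds).congr' ?_
    filter_upwards [hL] with s hs
    rw [(h1 s hs).1]; ring
  have e2 : G1 R = α * (p * solA (n + 1) ((p * R : ℝ) : ℂ)) := by
    refine tendsto_nhds_unique (hG1c'.mono_left (nhdsWithin_le_nhds (s := Set.Iio R))) ?_
    refine ((((hcont p (n + 1)).const_mul (p : ℂ)).const_mul α).continuousAt.mono_left
      nhdsWithin_le_nhds).congr' ?_
    filter_upwards [hL] with s hs
    rw [(h1 s hs).2]; ring
  have e3 : G R = b * mM 1 c (n + 2) ((q * R : ℝ) : ℂ) := by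
    rw [mM_eq_add, mul_add, ← mul_assoc b c, ← hab]
    refine tendsto_nhds_unique (hGc.mono_left (nhdsWithin_le_nhds (s := Set.Ioi R))) ?_
    refine (((continuousAt_const.mul (hmc (n + 1))).add
      ((hcont q (n + 2)).const_mul a).continuousAt).mono_left nhdsWithin_le_nhds).congr' ?_
    filter_upwards [self_mem_nhdsWithin] with s hs
    rw [(h2 s hs).1]; simp only [Pi.add_apply, Pi.mul_apply]; ring
  have e4 : G1 R = b * (q * mM 1 c (n + 1) ((q * R : ℝ) : ℂ)) := by
    have : b * (q * mM 1 c (n + 1) ((q * R : ℝ) : ℂ)) = b * (q * mM 1 0 (n + 1) ((q * R : ℝ) : ℂ)) +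
        a * (q * solA (n + 1) ((q * R : ℝ) : ℂ)) := by
      rw [mM_eq_add 1 c, hab]; ring
    rw [this]
    refine tendsto_nhds_unique (hG1c'.mono_left (nhdsWithin_le_nhds (s := Set.Ioi R))) ?_
    refine (((continuousAt_const.mul (continuousAt_const.mul (hmc n))).add
      (((hcont q (n + 1)).const_mul (q : ℂ)).const_mul a).continuousAt).mono_left
      nhdsWithin_le_nhds).congr' ?_
    filter_upwards [self_mem_nhdsWithin] with s hs
    rw [(h2 s hs).2]; simp only [Pi.add_apply, Pi.mul_apply]; ring
  have hpR : ((p * R : ℝ) : ℂ) ≠ 0 := by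
    exact_mod_cast (mul_neg_of_neg_of_pos hp0 hR).ne
  -- If b = 0, the outer solution vanishes, and so do the data of the inner one at R. As consecutive
  -- `bA` have no common real zero, α = 0 as well, and the mode is trivial.
  have hb : b ≠ 0 := by
    rintro rfl
    have ha : a = 0 := by rw [hab, zero_mul]
    rw [zero_mul] at e3 e4
    have hα : α = 0 := by
      by_contra hα
      rw [e3] at e1
      rw [e4] at e2
      have hp' : (p : ℂ) ≠ 0 := by exact_mod_cast hp0.ne
      have f1 := (mul_eq_zero.1 e1.symm).resolve_left hα
      have f2 := (mul_eq_zero.1 ((mul_eq_zero.1 e2.symm).resolve_left hα)).resolve_left hp'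
      have f1' := (mul_eq_zero.1 f1).resolve_left (pow_ne_zero _ hpR)
      have f2' := (mul_eq_zero.1 f2).resolve_left (pow_ne_zero _ hpR)
      exact bA_succ_ne_zero n f2' f1'
    refine hg0 ?_
    filter_upwards [hgG] with s hs h0
    rw [hs h0]
    rcases lt_trichotomy s R with h | h | h
    · rw [(h1 s ⟨h0, h⟩).1, hα]; ring
    · rw [h, e3]
    · rw [(h2 s h).1, ha]; ring
  have k1 : b * mM 1 c (n + 2) ((q * R : ℝ) : ℂ) = α * solA (n + 2) ((p * R : ℝ) : ℂ) :=
    e3.symm.trans e1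
  have k2 : b * (q * mM 1 c (n + 1) ((q * R : ℝ) : ℂ)) =
      α * (p * solA (n + 1) ((p * R : ℝ) : ℂ)) := e4.symm.trans e2
  refine (mul_eq_zero.1 (?_ : b * _ = 0)).resolve_left hb
  simp only [solA] at k1 k2
  obtain ⟨x, hx⟩ : ∃ x, x = bA (n + 1 : ℕ) ((p * R : ℝ) : ℂ) := ⟨_, rfl⟩
  obtain ⟨y, hy⟩ : ∃ y, y = bA (n + 2 : ℕ) ((p * R : ℝ) : ℂ) := ⟨_, rfl⟩
  obtain ⟨u, hu⟩ : ∃ u, u = mM 1 c (n + 1) ((q * R : ℝ) : ℂ) := ⟨_, rfl⟩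
  obtain ⟨v, hv⟩ : ∃ v, v = mM 1 c (n + 2) ((q * R : ℝ) : ℂ) := ⟨_, rfl⟩
  rw [← hx, ← hu] at k2
  rw [← hy, ← hv] at k1
  rw [← hx, ← hy, ← hu, ← hv]
  push_cast at k1 k2 ⊢
  -- Both right-hand sides become α(pR)^(n+2) x y, which eliminates α.
  linear_combination x * k1 - R * y * k2

/-! ### The asymptotics of the resonances and of the eigenvalue -/

/-- Since log|εk| = log|ε| + log k, the rescaling costs only a multiple of ε². -/
theorem errScale_comp_mul_isBigO (n : ℕ) {k : ℝ} (hk : 0 < k) :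
    (fun ε : ℝ => errScale n (ε * k)) =O[𝓝[≠] 0] errScale n := by
  have h1 : (fun ε : ℝ => k ^ 2 * errScale n ε +
      k ^ 2 * (if n = 0 then 1 else 0) * Real.log k * ε ^ 2) =O[𝓝[≠] 0] errScale n :=
    ((isBigO_refl _ _).const_mul_left _).add ((sq_isBigO_errScale n).const_mul_left _)
  refine h1.congr' ?_ EventuallyEq.rfl
  filter_upwards [self_mem_nhdsWithin] with ε hε
  have hε0 : |ε| ≠ 0 := abs_ne_zero.2 hε
  simp only [errScale]
  rw [abs_mul, abs_of_pos hk, Real.log_mul hε0 hk.ne']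
  ring

theorem tendsto_mul_nhdsNE {k : ℝ} (hk : 0 < k) :
    Tendsto (fun ε : ℝ => ε * k) (𝓝[≠] 0) (𝓝[≠] 0) := by
  refine tendsto_nhdsWithin_iff.2 ⟨?_, ?_⟩
  · have : Continuous fun ε : ℝ => ε * k := by fun_prop
    simpa using (this.tendsto 0).mono_left nhdsWithin_le_nhds
  · filter_upwards [self_mem_nhdsWithin] with ε hε
    exact mul_ne_zero hε hk.ne'

theorem residual_isBigO {σ : ℝ} (hσ : |σ| = 1) (c : ℂ) {n : ℕ} {τ : ℂ}
    (hτ : bA (n + 1 : ℕ) τ = 0) {ρ : ℝ} (hρ : 0 < ρ) :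
    (fun ε : ℝ => matchF σ c n τ ((ε * ρ ^ 2 / 4 : ℝ) : ℂ)
      (approxZero n ((ε * ρ ^ 2 / 4 : ℝ) : ℂ))) =O[𝓝[≠] 0] errScale n := by
  have hk : 0 < ρ ^ 2 / 4 := by positivity
  have h1 := (matchF_approxZero_isBigO hσ c hτ).comp_tendsto (tendsto_mul_nhdsNE hk)
  refine (h1.trans (errScale_comp_mul_isBigO n hk)).congr_left fun ε => ?_
  simp only [Function.comp_def]
  rw [show ε * (ρ ^ 2 / 4) = ε * ρ ^ 2 / 4 by ring]

theorem exists_resonance_family {ρ : ℝ} (hρ : 0 < ρ) (a : ℝ) {n : ℕ}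
    (hτ : bA (n + 1 : ℕ) (tauZero ρ a) = 0) :
    ∃ ε₀ > 0, ∃ lam : ℝ → ℂ,
      (∀ ε : ℝ, 0 < |ε| → |ε| < ε₀ → IsResonance (circularWell ρ (a ^ 2 - ε)) ρ (lam ε)) ∧
      (fun ε : ℝ => lam ε - ((ε * ratio n : ℝ) : ℂ) ^ (1 / 2 : ℂ)) =O[𝓝[≠] 0]
        fun ε : ℝ => |ε| ^ (3 / 2 : ℝ) * (1 + (if n = 0 then 1 else 0) * Real.log |ε|) := by
  obtain ⟨δ₁, hδ₁, C₁, h₁⟩ := exists_resonance hρ a hτ (σ := 1) (θ := 0) (Or.inl ⟨rfl, rfl⟩)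
  obtain ⟨δ₂, hδ₂, C₂, h₂⟩ := exists_resonance hρ a hτ (σ := -1) (θ := -(Real.pi / 2))
    (Or.inr ⟨rfl, rfl⟩)
  set F : ℝ → ℝ → ℝ → ℝ := fun σ θ ε => ‖matchF σ (2 * (θ * Complex.I)) n (tauZero ρ a)
    ((ε * ρ ^ 2 / 4 : ℝ) : ℂ) (approxZero n ((ε * ρ ^ 2 / 4 : ℝ) : ℂ))‖ with hF
  have hF0 : ∀ σ θ ε, 0 ≤ F σ θ ε := fun _ _ _ => norm_nonneg _
  -- The branch depends on the sign of ε; the sum of the residuals of both branches bounds the error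
  -- for either sign.
  have key : ∀ ε : ℝ, 0 < |ε| ∧ |ε| < min δ₁ δ₂ → ∃ lam : ℂ,
      IsResonance (circularWell ρ (a ^ 2 - ε)) ρ lam ∧
      ‖lam - ((ε * ratio n : ℝ) : ℂ) ^ (1 / 2 : ℂ)‖ ≤
        (|C₁| + |C₂|) * ((F 1 0 ε + F (-1) (-(Real.pi / 2)) ε) / √|ε|) := by
    rintro ε ⟨h0, hε⟩
    have hcomp : ∀ {C u v : ℝ}, |C| ≤ |C₁| + |C₂| → 0 ≤ u → u ≤ v →
        C * (u / √|ε|) ≤ (|C₁| + |C₂|) * (v / √|ε|) := fun {C u v} hC hu huv =>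
      calc C * (u / √|ε|) ≤ |C| * (u / √|ε|) := by gcongr; exact le_abs_self C
        _ ≤ _ := by gcongr
    rcases lt_or_gt_of_ne (abs_pos.1 h0) with h | h
    · obtain ⟨lam, hl, hb⟩ := h₁ ε (by linarith) (hε.trans_le (min_le_left _ _))
      exact ⟨lam, hl, hb.trans (hcomp (by linarith [abs_nonneg C₂]) (hF0 _ _ _)
        (by linarith [hF0 (-1) (-(Real.pi / 2)) ε]))⟩
    · obtain ⟨lam, hl, hb⟩ := h₂ ε (by linarith) (hε.trans_le (min_le_right _ _))
      exact ⟨lam, hl, hb.trans (hcomp (by linarith [abs_nonneg C₁]) (hF0 _ _ _)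
        (by linarith [hF0 1 0 ε]))⟩
  choose! lam hlam hbd using key
  refine ⟨min δ₁ δ₂, lt_min hδ₁ hδ₂, lam, fun ε h0 hε => hlam ε ⟨h0, hε⟩, ?_⟩
  have hsum : (fun ε : ℝ => F 1 0 ε + F (-1) (-(Real.pi / 2)) ε) =O[𝓝[≠] 0] errScale n :=
    (residual_isBigO (by simp) _ hτ hρ).norm_left.add (residual_isBigO (by simp) _ hτ hρ).norm_left
  have hmain : (fun ε : ℝ => (F 1 0 ε + F (-1) (-(Real.pi / 2)) ε) / √|ε|) =O[𝓝[≠] 0]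
      fun ε : ℝ => |ε| ^ (3 / 2 : ℝ) * (1 + (if n = 0 then 1 else 0) * Real.log |ε|) := by
    refine (hsum.mul (isBigO_refl (fun ε : ℝ => (√|ε|)⁻¹) _)).congr' (Eventually.of_forall
      fun ε => (div_eq_mul_inv _ _).symm) ?_
    filter_upwards [self_mem_nhdsWithin] with ε hε
    have hpos : 0 < |ε| := abs_pos.2 hε
    have e : |ε| ^ (3 / 2 : ℝ) = ε ^ 2 * (√|ε|)⁻¹ := by
      rw [Real.sqrt_eq_rpow, ← Real.rpow_neg hpos.le, ← sq_abs ε, ← Real.rpow_natCast,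
        ← Real.rpow_add hpos]
      norm_num
    rw [e, errScale]
    ring
  refine IsBigO.trans (IsBigO.of_bound (|C₁| + |C₂|) ?_) hmain
  have hnear : ∀ᶠ ε : ℝ in 𝓝[≠] 0, |ε| < min δ₁ δ₂ := by
    refine nhdsWithin_le_nhds ?_
    filter_upwards [Metric.ball_mem_nhds (0 : ℝ) (lt_min hδ₁ hδ₂)] with ε hε
    simpa [Real.dist_eq] using hε
  filter_upwards [hnear, self_mem_nhdsWithin] with ε h1 h2
  refine (hbd ε ⟨abs_pos.2 h2, h1⟩).trans ?_
  rw [Real.norm_of_nonneg (div_nonneg (add_nonneg (hF0 _ _ _) (hF0 _ _ _)) (Real.sqrt_nonneg _))]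

/-- An eigenvalue that is absorbed at zero forces the coupling to be critical, and has the
asymptotics of the zeros of the matching function. -/
theorem eigenvalue_asymptotics {ρ a : ℝ} (hρ : 0 < ρ) (ha : 0 < a) {n : ℕ} {ℓ : ℤ}
    (hℓ : |ℓ| = ((n + 2 : ℕ) : ℤ)) {ε₁ : ℝ} (hε₁ : 0 < ε₁) {E : ℝ → ℝ}
    (hψ : ∀ ε ∈ Set.Ioo (-ε₁) 0, ∃ ψ : ℂ → ℂ,
      MemLp ψ 2 volume ∧ ¬ ψ =ᵐ[volume] 0 ∧ HasAngularMode ℓ ψ ∧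
        IsSolution (circularWell ρ (a ^ 2 - ε)) (E ε) ψ)
    (hE : Tendsto E (𝓝[<] 0) (𝓝[<] 0)) :
    bA (n + 1 : ℕ) (tauZero ρ a) = 0 ∧
      (fun ε : ℝ => E ε - ratio n * ε) =O[𝓝[<] 0] errScale n := by
  obtain ⟨c, hc⟩ := exists_matching_of_mode n
  have hE0 : Tendsto E (𝓝[<] 0) (𝓝 0) := hE.mono_right nhdsWithin_le_nhds
  have hEneg : ∀ᶠ ε in 𝓝[<] 0, E ε < 0 := hE.eventually self_mem_nhdsWithin
  have hid : Tendsto (fun ε : ℝ => ε) (𝓝[<] 0) (𝓝 0) := tendsto_id.mono_left nhdsWithin_le_nhds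
  have hpos : ∀ᶠ ε in 𝓝[<] 0, 0 < a ^ 2 - ε + E ε := by
    have h1 : Tendsto (fun ε => a ^ 2 - ε + E ε) (𝓝[<] 0) (𝓝 (a ^ 2 - 0 + 0)) :=
      (tendsto_const_nhds.sub hid).add hE0
    exact h1.eventually (lt_mem_nhds (by linarith [pow_pos ha 2]))
  have hI : ∀ᶠ ε : ℝ in 𝓝[<] 0, ε ∈ Set.Ioo (-ε₁) 0 := Ioo_mem_nhdsLT (by linarith)
  have hmatch : ∀ᶠ ε in 𝓝[<] 0, matchF 1 c n (tauZero ρ a) ((ε * ρ ^ 2 / 4 : ℝ) : ℂ)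
      ((-(E ε / 4) * ρ ^ 2 : ℝ) : ℂ) = 0 := by
    filter_upwards [hEneg, hpos, hI] with ε h1 h2 h3
    obtain ⟨ψ, p1, p2, p3, p4⟩ := hψ ε h3
    have h4 := hc hρ hℓ h2 h1 p1 p2 p3 p4
    have e : tauZero ρ a + ((ε * ρ ^ 2 / 4 : ℝ) : ℂ) + ((-(E ε / 4) * ρ ^ 2 : ℝ) : ℂ) =
        ((-((a ^ 2 - ε + E ε) / 4) * ρ ^ 2 : ℝ) : ℂ) := by
      rw [tauZero]; push_cast; ring
    rw [matchF, e]
    exact h4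
  have ht : Tendsto (fun ε => ((-(E ε / 4) * ρ ^ 2 : ℝ) : ℂ)) (𝓝[<] 0) (𝓝 0) := by
    have h1 : Tendsto (fun ε => -(E ε / 4) * ρ ^ 2) (𝓝[<] 0) (𝓝 (-(0 / 4) * ρ ^ 2)) :=
      (hE0.div_const 4).neg.mul_const _
    have h2 := (Complex.continuous_ofReal.tendsto _).comp h1
    simpa [Function.comp_def] using h2
  have he : Tendsto (fun ε : ℝ => ((ε * ρ ^ 2 / 4 : ℝ) : ℂ)) (𝓝[<] 0) (𝓝 0) := by
    have h1 : Continuous fun ε : ℝ => ((ε * ρ ^ 2 / 4 : ℝ) : ℂ) := by fun_prop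
    simpa using (h1.tendsto 0).mono_left (nhdsWithin_le_nhds (s := Set.Iio 0))
  -- In the limit of the matching equation the term with the factor t drops out, and the second
  -- solution of index n + 2 has a nonzero limit.
  have hτ : bA (n + 1 : ℕ) (tauZero ρ a) = 0 := by
    have harg := (tendsto_const_nhds (x := tauZero ρ a)).add he |>.add ht
    rw [add_zero, add_zero] at harg
    have hb : ∀ k : ℕ, Tendsto (fun ε : ℝ => bA k (tauZero ρ a + ((ε * ρ ^ 2 / 4 : ℝ) : ℂ) +
        ((-(E ε / 4) * ρ ^ 2 : ℝ) : ℂ))) (𝓝[<] 0) (𝓝 (bA k (tauZero ρ a))) := fun k =>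
      ((continuous_bA (k : ℂ)).tendsto _).comp harg
    have hm := fun k => (tendsto_mM (σ := 1) (by simp) c k).comp ht
    have hlim := ((hb (n + 1)).mul (hm (n + 1))).sub ((ht.mul (hb (n + 2))).mul (hm n))
    have h0 := tendsto_nhds_unique (hlim.congr' (f₂ := fun _ => (0 : ℂ)) ?_) tendsto_const_nhds
    · rw [zero_mul, zero_mul, sub_zero] at h0
      exact (mul_eq_zero.1 h0).resolve_right (bB_neg_nat_zero_ne_zero (n + 1))
    · filter_upwards [hmatch] with ε h1
      exact h1
  refine ⟨hτ, ?_⟩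
  obtain ⟨δ, hδ, hz⟩ := exists_norm_sub_approxZero_le (σ := 1) (by simp) c (slope_ne_zero hτ)
  have hres := (residual_isBigO (σ := 1) (by simp) c hτ hρ).mono
    (nhdsWithin_mono (s := Set.Iio 0) 0 fun ε hε => ne_of_lt hε)
  -- The factor 4/ρ² converts t = -Eρ²/4 back to E.
  refine IsBigO.trans (IsBigO.of_bound (4 / ρ ^ 2 * (2 / ‖slope n (tauZero ρ a)‖)) ?_) hres
  have hb1 := ht.eventually (Metric.ball_mem_nhds (0 : ℂ) hδ)
  have hb2 := he.eventually (Metric.ball_mem_nhds (0 : ℂ) hδ)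
  filter_upwards [hmatch, hEneg, hI, hb1, hb2] with ε h1 h2 h3 h4 h5
  rw [dist_zero_right] at h4
  rw [dist_zero_right, Complex.norm_real] at h5
  have hεn : ε < 0 := h3.2
  have hρ2 : 0 < ρ ^ 2 := by positivity
  have h6 := hz (ε * ρ ^ 2 / 4) (by nlinarith) h5
    ((-(E ε / 4) * ρ ^ 2 : ℝ) : ℂ) (mem_halfPlane_ofReal.2 (by nlinarith)) h4 h1
  have e1 : ‖((-(E ε / 4) * ρ ^ 2 : ℝ) : ℂ) - approxZero n ((ε * ρ ^ 2 / 4 : ℝ) : ℂ)‖ =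
      ρ ^ 2 / 4 * ‖E ε - ratio n * ε‖ := by
    rw [approxZero_ofReal, ← Complex.ofReal_sub, Complex.norm_real]
    rw [show -(E ε / 4) * ρ ^ 2 - -(ratio n * (ε * ρ ^ 2 / 4)) =
      -(ρ ^ 2 / 4) * (E ε - ratio n * ε) by ring, norm_mul, norm_neg,
      Real.norm_of_nonneg (by positivity : 0 ≤ ρ ^ 2 / 4)]
  rw [e1] at h6
  calc ‖E ε - ratio n * ε‖ = 4 / ρ ^ 2 * (ρ ^ 2 / 4 * ‖E ε - ratio n * ε‖) := by field_simp
    _ ≤ _ := by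
      rw [mul_assoc]
      exact mul_le_mul_of_nonneg_left h6 (by positivity)

end

end CircularWell

/-! ### The main theorem -/

open CircularWell in
theorem lemmal (ρ a₀ : ℝ) (hρ : 0 < ρ) (ha₀ : 0 < a₀) (ℓ : ℤ) (hℓ : 2 ≤ |ℓ|)
    (ε₁ : ℝ) (hε₁ : 0 < ε₁) (E : ℝ → ℝ)
    (hψ : ∀ ε ∈ Set.Ioo (-ε₁) 0, ∃ ψ : ℂ → ℂ,
      MemLp ψ 2 volume ∧ ¬ ψ =ᵐ[volume] 0 ∧ HasAngularMode ℓ ψ ∧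
        IsSolution (circularWell ρ (a₀ ^ 2 - ε)) (E ε) ψ)
    (hE : Tendsto E (𝓝[<] 0) (𝓝[<] 0)) :
    (∃ ε₀ > 0, ∃ lam : ℝ → ℂ,
      (∀ ε : ℝ, 0 < |ε| → |ε| < ε₀ →
        IsResonance (circularWell ρ (a₀ ^ 2 - ε)) ρ (lam ε)) ∧
      (fun ε : ℝ => lam ε - ((ε * ((|ℓ| : ℝ) - 1) / (|ℓ| : ℝ) : ℝ) : ℂ) ^ (1 / 2 : ℂ))
        =O[𝓝[≠] 0]
        (fun ε : ℝ => |ε| ^ (3 / 2 : ℝ) * (1 + (if |ℓ| = 2 then 1 else 0) * Real.log |ε|))) ∧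
    (fun ε : ℝ => E ε - ((|ℓ| : ℝ) - 1) / (|ℓ| : ℝ) * ε)
      =O[𝓝[<] 0]
      (fun ε : ℝ => ε ^ 2 * (1 + (if |ℓ| = 2 then 1 else 0) * Real.log |ε|)) := by
  -- Writing |ℓ| = n + 2 builds in the bound |ℓ| ≥ 2 and keeps the index |ℓ| - 1 = n + 1 of the
  -- critical Bessel function positive.
  obtain ⟨n, hn⟩ : ∃ n : ℕ, |ℓ| = ((n + 2 : ℕ) : ℤ) := ⟨(|ℓ| - 2).toNat, by push_cast; omega⟩
  have hnr : |(ℓ : ℝ)| = n + 2 := by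
    rw [← Int.cast_abs, hn]; push_cast; ring
  have hratio : (|(ℓ : ℝ)| - 1) / |(ℓ : ℝ)| = ratio n := by
    rw [hnr, ratio]; congr 1; ring
  have hif : (if |ℓ| = 2 then (1 : ℝ) else 0) = if n = 0 then 1 else 0 := by
    refine if_congr ?_ rfl rfl
    rw [hn]; push_cast; omega
  obtain ⟨hτ, hEas⟩ := eigenvalue_asymptotics hρ ha₀ hn hε₁ hψ hE
  obtain ⟨ε₀, hε₀, lam, h1, h2⟩ := exists_resonance_family hρ a₀ hτ
  simp only [hif, mul_div_assoc, hratio]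
  exact ⟨⟨ε₀, hε₀, lam, h1, h2⟩, hEas⟩
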